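/- **Setting.** Let $M$ be the interior of a compact, connected 3-manifold with non-empty boundary, with an ideal triangulation $\mathcal T$: finitely many Euclidean tetrahedra are glued along their faces in pairs by affine maps, no edge being identified with itself with reversed direction, and $M$ is the quotient with the vertices removed. Let $N$ assign a real number $N(\sigma,\theta)$ to each of the three quadrilateral types $\theta$ (partitions of the four vertices into two pairs) of each tetrahedron $\sigma$. $N$ is an *admissible solution of the $Q$-matching equations* if all $N(\sigma,\theta)\ge 0$; if in each tetrahedron at most one type has non-zero coordinate; and if for every edge $e$ the sum over the corners $(\sigma,ab)$ met when going once around $e$, entering $\sigma$ through the face $abc$ and leaving it through $abd$, of $N(\sigma,ac|bd)-N(\sigma,ad|bc)$ is $0$ (the edge carries a fixed direction $a\to b$). The *dual spine* $S(\sigma)$ is the metric tree consisting of an interval of length $k=\max_\theta N(\sigma,\theta)$ and one ray $[0,\infty)$ for each vertex of $\sigma$; the rays of two vertices are attached at the same end of the interval if and only if the type with coordinate $k>0$ does not separate these vertices (all four are attached at the same point if $k=0$). Each face of $\sigma$ determines the tripod in $S(\sigma)$ spanned by the three ends at its vertices. A *transversely measured singular foliation $\mathcal F$ of $M$ defined by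 $N$* is given by continuous maps $\ell_\sigma$ from the ideal tetrahedra onto their dual spines, such that: the fibres (the leaves in $\sigma$; those over the end points of the interval are singular and may be thick) are path-connected; each open edge $ab$ is mapped homeomorphically, respecting ends, onto the line joining the ends $a$ and $b$; each face is mapped into its tripod; and on two faces that are glued, the maps agree under the isometry of tripods that respects the ends. The transverse measure is pulled back from the metrics of the dual spines. Let $p:\widetilde M\to M$ be the universal covering and $\widetilde{\mathcal F}$ the lifted foliation. A path in $\widetilde M$ is *admissible* if it is a concatenation of finitely many paths, each running in one lifted ideal tetrahedron and each either contained in a leaf or transverse to $\widetilde{\mathcal F}$ (injectively mapped to the dual spine); its measure is the total mass of the transverse measure along it. Let $d_N(x,y)$ be the infimum of the measures of all admissible paths from $x$ to $y$, and let $\mathfrak T_N$ be the quotient of $\widetilde M$ by the relation $d_N(x,y)=0$, with the induced metric. (This is the leaf space $\widetilde M/\widetilde{\mathcal F}$ made Hausdorff.) **Theorem.** Every admissible solution $N$ of the $Q$-matching equations defines a transversely measured singular foliation $\mathcal F$ of $M$ as above, and for every such $\mathcal F$ the space $\mathfrak T_N$ is an $\mathbb R$-tree: $d_N$ is finite, any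 two points are joined by a segment isometric to a closed interval, and every arc joining them has the same image as this segment. The group $\pi_1(M)$ acts on $\mathfrak T_N$ by isometries so that the quotient map $\widetilde M\to\mathfrak T_N$ is equivariant with respect to the action of $\pi_1(M)$ on $\widetilde M$ by deck transformations. -/

import Mathlib

open scoped ENNReal

noncomputable section

/-! ### Ideal triangulations -/

/-- Combinatorial data of an ideal triangulation with set of tetrahedra `ι`. The faces of each
tetrahedron are labelled by the opposite vertex. Face `v` of tetrahedron `i` is glued to a face of
`adj i v` by the affine map sending each vertex `w ≠ v` to `glue i v w`; the permutation
`glue i v` also sends `v` to the vertex opposite the target face. Faces are glued in pairs. -/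
structure FaceGluing (ι : Type*) where
  adj : ι → Fin 4 → ι
  glue : ι → Fin 4 → Equiv.Perm (Fin 4)
  adj_adj : ∀ i v, adj (adj i v) (glue i v v) = i
  glue_glue : ∀ i v, glue (adj i v) (glue i v v) = (glue i v)⁻¹
  no_self : ∀ i v, ¬ (adj i v = i ∧ glue i v v = v)

/-- A flag `(i, σ)` is a tetrahedron `i` with its vertices listed as
`a = σ 0, b = σ 1, c = σ 2, d = σ 3`. It stands for the corner of `i` at the directed edge `a → b`,
entered through the face `abc` and left through the face `abd`. -/
abbrev TetFlag (ι : Type*) := ι × Equiv.Perm (Fin 4)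

/-- Leave the tetrahedron through the face `abd` (which is opposite `c`) and list the vertices of
the next tetrahedron around the same directed edge. -/
def FaceGluing.step {ι : Type*} (T : FaceGluing ι) (f : TetFlag ι) : TetFlag ι :=
  (T.adj f.1 (f.2 2), T.glue f.1 (f.2 2) * f.2 * Equiv.swap 2 3)

/-- An ideal triangulation of a 3-manifold: tetrahedra glued along their faces in pairs so that no
edge is identified with itself with reversed direction. The latter condition says exactly that the
quotient without its vertices is a 3-manifold (it is then the interior of a compact 3-manifold
whose boundary is the union of the vertex links). -/
structure IdealTriangulation (ι : Type*) extends FaceGluing ι where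
  no_reversal : ∀ (i : ι) (σ τ : Equiv.Perm (Fin 4)) (k : ℕ),
    toFaceGluing.step^[k] (i, σ) = (i, τ) → ¬ (τ 0 = σ 1 ∧ τ 1 = σ 0)

/-- The standard 3-simplex with its vertices removed, in barycentric coordinates. -/
abbrev IdealTet := {x : Fin 4 → ℝ // x ∈ stdSimplex ℝ (Fin 4) ∧ ∀ v, x v ≠ 1}

/-- The affine map of the ideal tetrahedron which moves each vertex `w` to `g w`. -/
def IdealTet.relabel (g : Equiv.Perm (Fin 4)) (x : IdealTet) : IdealTet :=
  ⟨fun w => x.1 (g⁻¹ w), ⟨fun w => x.2.1.1 _, by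
    exact (Equiv.sum_comp g⁻¹ x.1).trans x.2.1.2⟩, fun w => x.2.2 _⟩

namespace IdealTriangulation

variable {ι : Type*} (T : IdealTriangulation ι)

/-- Identification of points of the disjoint union of the ideal tetrahedra by the face pairings. -/
def FaceRel (x y : (_ : ι) × IdealTet) : Prop :=
  ∃ v, x.2.1 v = 0 ∧ y = ⟨T.adj x.1 v, x.2.relabel (T.glue x.1 v)⟩

/-- The ideally triangulated 3-manifold `M`, with the quotient topology. -/
def Manifold : Type _ := Quot T.FaceRel

instance : TopologicalSpace T.Manifold := inferInstanceAs (TopologicalSpace (Quot T.FaceRel))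

/-- The characteristic map of the ideal tetrahedron `i`. -/
def char (i : ι) (x : IdealTet) : T.Manifold := Quot.mk T.FaceRel ⟨i, x⟩

end IdealTriangulation

/-! ### Quadrilateral coordinates -/

/-- The three quadrilateral types in a tetrahedron correspond to the three partitions of its
vertices into two pairs; `quad a b` is the type separating the vertices `a, b` from the other two
(a junk value if `a = b`). -/
def quad (a b : Fin 4) : Fin 3 := !![0, 0, 1, 2; 0, 0, 2, 1; 1, 2, 0, 0; 2, 1, 0, 0] a b

/-- The slope, with respect to the corner of `f` with vertices `a, b, c, d`, of the quadrilaterals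
with coordinates `N`: those separating `a, c` from `b, d` have slope `1`, those separating `a, d`
from `b, c` have slope `-1`, and those separating `a, b` from `c, d` have slope `0`. -/
def quadSlope {ι : Type*} (N : ι → Fin 3 → ℝ) (f : TetFlag ι) : ℝ :=
  N f.1 (quad (f.2 0) (f.2 2)) - N f.1 (quad (f.2 0) (f.2 3))

/-- The `Q`-matching equations: for each edge, the total slope of all corners met when going once
around the edge is zero. -/
def IdealTriangulation.QMatching {ι : Type*} (T : IdealTriangulation ι) (N : ι → Fin 3 → ℝ) :
    Prop :=
  ∀ f : TetFlag ι, ∑ k ∈ Finset.range (Function.minimalPeriod T.step f), quadSlope N (T.step^[k] f) = 0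

/-- Admissible solutions of the `Q`-matching equations: the coordinates are non-negative, and in
each tetrahedron at most one quadrilateral type has non-zero coordinate. -/
structure IdealTriangulation.IsAdmissible {ι : Type*} (T : IdealTriangulation ι)
    (N : ι → Fin 3 → ℝ) : Prop where
  nonneg : ∀ i j, 0 ≤ N i j
  unique : ∀ i j j', N i j ≠ 0 → N i j' ≠ 0 → j = j'
  matching : T.QMatching N

/-! ### Dual spines

Let `q` be the quadrilateral coordinates in one tetrahedron, at most one of them non-zero, and
`k = q 0 + q 1 + q 2`. The dual spine is the metric tree made of an interval of length `k` and four
rays `[0, ∞)`, one for each vertex; if `k ≠ 0`, two rays are attached at each end point of the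
interval, as prescribed by the partition of the vertices. It is realised in `ℝ⁴` with the sup
metric: the coordinates of a point are the values at this point of the Busemann functions of the
four ends, normalised to vanish at the midpoint of the interval. -/

/-- The point at distance `h` from the origin of the ray towards the vertex `a`. -/
def spineRay (q : Fin 3 → ℝ) (a : Fin 4) (h : ℝ) : Fin 4 → ℝ := fun b =>
  if b = a then -((∑ j, q j) / 2 + h) else (∑ j, q j) / 2 + h - q (quad a b)

/-- The geodesic line of the dual spine joining the ends `a` and `b`. -/
def spineLine (q : Fin 3 → ℝ) (a b : Fin 4) : Set (Fin 4 → ℝ) :=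
  spineRay q a '' Set.Ici 0 ∪ segment ℝ (spineRay q a 0) (spineRay q b 0) ∪
    spineRay q b '' Set.Ici 0

/-- The dual spine. -/
def spine (q : Fin 3 → ℝ) : Set (Fin 4 → ℝ) := {f | ∃ a b, a ≠ b ∧ f ∈ spineLine q a b}

/-- The part of the dual spine met by the face opposite `v`: the tripod spanned by the ends other
than `v`. -/
def faceSpine (q : Fin 3 → ℝ) (v : Fin 4) : Set (Fin 4 → ℝ) :=
  {f | ∃ a b, a ≠ b ∧ a ≠ v ∧ b ≠ v ∧ f ∈ spineLine q a b}

/-- The centre of the tripod `faceSpine q v`. It is the end point of the interval opposite to the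
one where the ray towards `v` is attached (and the centre `0` if the interval is degenerate). -/
def faceCentre (q : Fin 3 → ℝ) (v : Fin 4) : Fin 4 → ℝ := -spineRay q v 0

/-! ### The transversely measured singular foliation -/

/-- The open edge `ab` of the ideal tetrahedron. -/
def openEdge (a b : Fin 4) : Set IdealTet := {x | ∀ c, c ≠ a → c ≠ b → x.1 c = 0}

/-- A transversely measured singular codimension-one foliation of `M` defined by `N`. It is given
in each ideal tetrahedron by a continuous map onto the dual spine: the leaves in the tetrahedron
are the fibres, and the transverse measure is pulled back from the metric of the dual spine. Each
edge is mapped homeomorphically onto the corresponding line, each face to the corresponding tripod,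
and leaves and transverse measures match up across the faces: the tripods of two faces that are
glued together are identified by the isometry which sends centre to centre and respects the ends
(points of the tripods are compared through the Busemann functions of the three ends, normalised at
the centres). Singular leaves are the fibres of the end points of the interval; they are allowed
to be thick. -/
structure MeasuredFoliation {ι : Type*} (T : IdealTriangulation ι) (N : ι → Fin 3 → ℝ) where
  leaf : ι → IdealTet → (Fin 4 → ℝ)
  continuous_leaf : ∀ i, Continuous (leaf i)
  leaf_mem : ∀ i x, leaf i x ∈ spine (N i)
  leaf_face : ∀ i v, ∀ x : IdealTet, x.1 v = 0 → leaf i x ∈ faceSpine (N i) v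
  leaf_edge : ∀ i a b, a ≠ b → leaf i '' openEdge a b = spineLine (N i) a b
  /-- The edge `ab` is mapped injectively, moving towards the end `b` as `x` moves towards `b`. -/
  leaf_edge_strict : ∀ i a b, a ≠ b → ∀ x ∈ openEdge a b, ∀ y ∈ openEdge a b,
    x.1 b < y.1 b → leaf i y b < leaf i x b
  leaf_connected : ∀ i, ∀ f ∈ spine (N i), IsPathConnected (leaf i ⁻¹' {f})
  leaf_glue : ∀ i v, ∀ x : IdealTet, x.1 v = 0 → ∀ w, w ≠ v →
    leaf (T.adj i v) (x.relabel (T.glue i v)) (T.glue i v w)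
        - faceCentre (N (T.adj i v)) (T.glue i v v) (T.glue i v w)
      = leaf i x w - faceCentre (N i) v w

namespace MeasuredFoliation

variable {ι : Type*} {T : IdealTriangulation ι} {N : ι → Fin 3 → ℝ} (F : MeasuredFoliation T N)
  {X : Type*} [TopologicalSpace X] (p : X → T.Manifold)

/-- A piece of an admissible path in `X`, where `p : X → M` is the universal covering and `X`
carries the lifted triangulation and foliation: it is a path `γ` which runs in a lift of the ideal
tetrahedron `i`, where it has coordinates `c`, and which is either contained in a leaf or transverse
to the foliation. Its measure is the mass of the transverse measure along it. -/
structure IsPiece (γ : C(unitInterval, X)) (m : ℝ≥0∞) (i : ι) (c : C(unitInterval, IdealTet)) : Prop where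
  lift : ∀ t, p (γ t) = T.char i (c t)
  leaf_or_transverse : (∀ s t, F.leaf i (c s) = F.leaf i (c t)) ∨
    Function.Injective fun t => F.leaf i (c t)
  measure : m = edist (F.leaf i (c 0)) (F.leaf i (c 1))

/-- There is an admissible path from `x` to `y` of measure `m`, i.e. a concatenation of finitely
many pieces, each of which is contained in a leaf or transverse to the foliation. -/
inductive AdmissiblePath : X → X → ℝ≥0∞ → Prop
  | nil (x : X) : AdmissiblePath x x 0
  | cons {γ : C(unitInterval, X)} {m m' : ℝ≥0∞} {i : ι} {c : C(unitInterval, IdealTet)} {y : X}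
      (hγ : F.IsPiece p γ m i c) (h : AdmissiblePath (γ 1) y m') :
      AdmissiblePath (γ 0) y (m + m')

variable {F p}

theorem AdmissiblePath.trans {x y z : X} {m m' : ℝ≥0∞} (h : AdmissiblePath F p x y m)
    (h' : AdmissiblePath F p y z m') : AdmissiblePath F p x z (m + m') := by
  induction h with
  | nil x => simpa using h'
  | cons hγ _ ih => rw [add_assoc]; exact .cons hγ (ih h')

theorem AdmissiblePath.symm {x y : X} {m : ℝ≥0∞} (h : AdmissiblePath F p x y m) :
    AdmissiblePath F p y x m := by
  induction h with
  | nil x => exact .nil x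
  | @cons γ m m' i c y hγ _ ih =>
    let r : C(unitInterval, unitInterval) := ⟨unitInterval.symm, unitInterval.continuous_symm⟩
    have hr : F.IsPiece p (γ.comp r) m i (c.comp r) :=
      ⟨fun t => hγ.lift _, hγ.leaf_or_transverse.imp (fun h s t => h _ _)
        (fun h => h.comp unitInterval.symm_bijective.injective), by
          simpa [r, edist_comm] using hγ.measure⟩
    have h1 := AdmissiblePath.cons hr (.nil _)
    have h0 : (γ.comp r) 0 = γ 1 := by simp [r]
    have h2 : (γ.comp r) 1 = γ 0 := by simp [r]
    rw [h0, h2] at h1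
    simpa [add_comm] using ih.trans h1

variable (F p)

/-- The total space of the universal covering, to be equipped with the pseudo-metric `d_N`. -/
def Cover (_ : MeasuredFoliation T N) (_ : X → T.Manifold) : Type _ := X

/-- The pseudo-metric `d_N` on the universal cover: the infimum of the measures of all admissible
paths between two points. -/
instance : PseudoEMetricSpace (F.Cover p) where
  edist x y := sInf {m | F.AdmissiblePath p x y m}
  edist_self x := le_antisymm (sInf_le (.nil _)) bot_le
  edist_comm x y := congrArg sInf (Set.ext fun _ => ⟨.symm, .symm⟩)
  edist_triangle x y z := by
    rw [ENNReal.sInf_add]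
    refine le_iInf₂ fun m hm => ?_
    rw [add_comm, ENNReal.sInf_add]
    refine le_iInf₂ fun m' hm' => ?_
    rw [add_comm]
    exact sInf_le (AdmissiblePath.trans hm hm')

/-- The space `𝔗_N`: the quotient of the universal cover obtained by identifying points at
`d_N`-distance zero, with the induced metric. -/
abbrev Tree : Type _ := SeparationQuotient (F.Cover p)

/-- The quotient map from the universal cover to `𝔗_N`. -/
def toTree (x : X) : F.Tree p := SeparationQuotient.mk (X := F.Cover p) x

end MeasuredFoliation

/-! ### ℝ-trees -/

/-- An `ℝ`-tree: a non-empty metric space in which any two points are joined by a segment isometric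
to a closed interval (in particular distances are finite), and any arc between the two points has
the same image as this segment. -/
def IsRTree (Y : Type*) [EMetricSpace Y] : Prop :=
  Nonempty Y ∧ ∀ x y : Y, ∃ (L : ℝ) (γ : ℝ → Y), 0 ≤ L ∧ γ 0 = x ∧ γ L = y ∧
    (∀ s ∈ Set.Icc 0 L, ∀ t ∈ Set.Icc 0 L, edist (γ s) (γ t) = edist s t) ∧
    ∀ δ : C(unitInterval, Y), Function.Injective δ → δ 0 = x → δ 1 = y → Set.range δ = γ '' Set.Icc 0 L

/-! ### Deck transformations -/

/-- The action of `π₁(M, p x₀)` by deck transformations on the universal cover `X` of `M`: the deck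
transformation of `g` maps the base point `x₀` to the end point of the lift, starting at `x₀`, of a
loop representing `g⁻¹`. (The product `g * h` in `FundamentalGroup` is the class of a loop `h`
followed by a loop `g`, hence the inverse.) -/
def IsDeckAction {X M : Type*} [TopologicalSpace X] [TopologicalSpace M] {p : X → M}
    (hp : IsCoveringMap p) (x₀ : X) (deck : FundamentalGroup M (p x₀) →* (X ≃ₜ X)) : Prop :=
  ∀ g, (∀ x, p (deck g x) = p x) ∧ deck g x₀ = (hp.monodromy (g⁻¹).toPath ⟨x₀, rfl⟩ : X)

end

/-!
The proof has two independent halves.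

*Existence of the foliation.* The leaf map of a tetrahedron is given by an explicit formula,
`tetLeaf`. On an edge `ab` it is logarithmic in the ratio of the barycentric coordinates, so it is
determined there by the level `t a b`, the value of the Busemann function of `b` at the midpoint
of the edge. The levels are free, and on a face the formula only involves the three levels of the
edges of this face, measured from the centre of the tripod (`IsLevel.tetLeaf_face`). Hence the leaf
maps fit together across the faces as soon as the normalised levels agree on the two sides. Going
from one tetrahedron to the next around an edge changes the level by a prescribed amount, and the
sum of these amounts around the edge is the left-hand side of the `Q`-matching equation: the
equations are exactly what is needed to choose the levels (`exists_coboundary`,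
`exists_edgeShift`). The leaves are connected because the preimage of a point of a ray is convex,
the preimages of the two ends of the interval are star-shaped, and the preimage of an interior
point retracts linearly to its convex intersection with a face (`IsLevel.isPathConnected_fibre`).

*The leaf space is an `ℝ`-tree.* This uses three properties of the metric space `𝔗`.

* Two points at distance less than `r` lie in a compact connected set along which the distances to
  the two points add up to less than `r` (`IsLengthConnected`). Indeed each piece of an admissible
  path can be replaced by a path in a leaf, a path along an edge, and a path in a leaf, whose
  measure is not larger (`MeasuredFoliation.AdmissiblePath.exists_connected`).
* Continuous maps from `𝔗` to the circle lift to the line (`HasCircleLifts`): they lift on the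
  simply connected space `X`, and the lift descends to `𝔗`, since it cannot jump by an integer
  along connected sets of small diameter (`MeasuredFoliation.hasCircleLifts_tree`).
* `𝔗` is covered by countably many lines, images of edges, since countably many lifts of the
  tetrahedra cover `X` (`IsCoveringMap.exists_countable_tetLift`).

Given `w` and `x`, let `V` be the component containing `x` of the complement of the closed ball of
radius `m` about `w`. Both `V` and its complement are connected. A space with lifts of circle maps
is unicoherent, in the sense that the frontier of `V` cannot be split into two disjoint non-empty
closed sets (`HasCircleLifts.frontier_not_separated`). By the third property, for all but countably
many `m` the sphere of radius `m` about `w` is seen from each point in a set of distances of measure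
zero (`countable_not_isNullLevel`), so that the frontier of `V` would split if it had two points. It
therefore consists of one point, which separates `w` from `x` (`exists_cut_point`). These cut points
lie in every connected set containing `w` and `x`, so by the first property they are placed
isometrically between `w` and `x`. The closure of the set of these points is the required segment
(`exists_segment`), and it is contained in every arc from `w` to `x`, hence equal to it
(`isRTree_of_hasCircleLifts`).

The deck transformations preserve admissible paths and their measures, hence act by isometries
(`MeasuredFoliation.exists_isometric_action`).
-/


/-! ### A criterion for `ℝ`-trees -/

section RTreeCriterion

open Set Metric MeasureTheory Topology

/-- Any two points lie in compact connected sets along which the triangle inequality is as close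
to an equality as desired. This is the form of "length space" used below. -/
def IsLengthConnected (T : Type*) [MetricSpace T] : Prop :=
  ∀ (x y : T) (r : ℝ), dist x y < r → ∃ C : Set T, IsCompact C ∧ IsPreconnected C ∧ x ∈ C ∧ y ∈ C ∧
    ∀ z ∈ C, dist x z + dist z y < r

/-- Every continuous map to the circle lifts to the real line. -/
def HasCircleLifts (T : Type*) [TopologicalSpace T] : Prop :=
  ∀ φ : C(T, AddCircle (1 : ℝ)), ∃ ψ : C(T, ℝ), ∀ z, (ψ z : AddCircle (1 : ℝ)) = φ z

/-- The level `m` of the distance to `w` is seen from every point in a null set of distances. -/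
def IsNullLevel {T : Type*} [MetricSpace T] (w : T) (m : ℝ) : Prop :=
  ∀ c : T, volume ((fun z => dist c z) '' {z | dist w z = m}) = 0

variable {T : Type*} [MetricSpace T]

theorem countable_not_isNullLevel {κ : Type*} [Countable κ] (lam : κ → ℝ → T)
    (hlam : ∀ k, LipschitzWith 1 (lam k)) (hcov : ∀ z, ∃ k t, lam k t = z) (w : T) :
    {m | ¬ IsNullLevel w m}.Countable := by
  have h1 : (⋃ k, {m | 0 < volume {t | dist w (lam k t) = m}}).Countable := by
    refine countable_iUnion fun k => Measure.countable_meas_level_set_pos ?_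
    exact (continuous_const.dist (hlam k).continuous).measurable
  refine h1.mono fun m hm => ?_
  by_contra hcon
  refine hm fun c => ?_
  simp only [mem_iUnion, mem_ofPred_eq, not_exists, not_lt, nonpos_iff_eq_zero] at hcon
  have hsub : (fun z => dist c z) '' {z | dist w z = m} ⊆
      ⋃ k, (fun t => dist c (lam k t)) '' {t | dist w (lam k t) = m} := by
    rintro _ ⟨z, hz, rfl⟩
    obtain ⟨k, t, rfl⟩ := hcov z
    exact mem_iUnion.2 ⟨k, t, hz, rfl⟩
  refine measure_mono_null hsub (measure_iUnion_null fun k => ?_)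
  have hl : LipschitzWith 1 fun t => dist c (lam k t) := by
    have := (LipschitzWith.dist_right c).comp (hlam k)
    rwa [mul_one] at this
  have := hl.hausdorffMeasure_image_le zero_le_one {t | dist w (lam k t) = m}
  rw [hausdorffMeasure_real, hcon k] at this
  simpa using this

namespace IsLengthConnected

variable (H : IsLengthConnected T)
include H

theorem isPreconnected_ball (w : T) (r : ℝ) : IsPreconnected (ball w r) := by
  refine isPreconnected_of_forall w fun y hy => ?_
  obtain ⟨C, -, hC, hw, hy', h⟩ := H w y r (by rwa [dist_comm])
  refine ⟨C, fun z hz => ?_, hw, hy', hC⟩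
  have := h z hz
  rw [mem_ball, dist_comm]
  linarith [dist_nonneg (x := z) (y := y)]

theorem isPreconnected_univ : IsPreconnected (univ : Set T) :=
  isPreconnected_of_forall_pair fun x _ y _ =>
    let ⟨C, _, hC, hx, hy, _⟩ := H x y (dist x y + 1) (by linarith)
    ⟨C, subset_univ _, hx, hy, hC⟩

theorem locallyConnectedSpace : LocallyConnectedSpace T :=
  locallyConnectedSpace_of_connected_bases (fun x r => ball x r) (fun _ r => 0 < r)
    (fun _ => nhds_basis_ball) fun x r _ => H.isPreconnected_ball x r

theorem mem_closure_ball {w z : T} {m : ℝ} (hm : 0 < m) (h : dist w z ≤ m) :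
    z ∈ closure (ball w m) := by
  rw [Metric.mem_closure_iff]
  intro ε hε
  obtain hlt | rfl := h.lt_or_eq
  · exact ⟨z, by rwa [mem_ball, dist_comm], by simpa⟩
  set η := min (ε / 2) (dist w z / 2) with hη
  have hη0 : 0 < η := lt_min (by linarith) (by linarith)
  obtain ⟨C, -, hC, hw, hz, hCd⟩ := H w z (dist w z + η) (by linarith)
  -- the point of `C` at distance `η` from `z` is nearer to `w` than `z`
  obtain ⟨y, hy, hyη⟩ : η ∈ (fun y => dist y z) '' C := by
    refine (hC.image (fun y => dist y z) (by fun_prop)).Icc_subset ⟨z, hz, dist_self z⟩ ⟨w, hw, rfl⟩ ⟨hη0.le, ?_⟩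
    exact (min_le_right _ _).trans (by linarith)
  have hd := hCd y hy
  simp only at hyη
  refine ⟨y, ?_, ?_⟩
  · rw [mem_ball, dist_comm]; linarith
  · rw [dist_comm, hyη]; exact (min_le_left _ _).trans_lt (by linarith)

theorem isPreconnected_closedBall (w : T) {m : ℝ} (hm : 0 < m) :
    IsPreconnected {z | dist w z ≤ m} := by
  refine (H.isPreconnected_ball w m).subset_closure (fun z hz => ?_)
    fun z hz => H.mem_closure_ball hm hz
  rw [mem_ball, dist_comm] at hz
  exact hz.le

/-- The frontier of a component of the complement of a ball lies in the sphere. -/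
theorem frontier_component {w x : T} {m : ℝ} :
    frontier (connectedComponentIn {z | m < dist w z} x) ⊆ {z | dist w z = m} := by
  have hU : IsOpen {z | m < dist w z} := isOpen_lt continuous_const (by fun_prop)
  have := H.locallyConnectedSpace
  intro z hz
  have hVo : IsOpen (connectedComponentIn {z | m < dist w z} x) := hU.connectedComponentIn
  rw [hVo.frontier_eq] at hz
  have h1 : m ≤ dist w z := by
    have : closure (connectedComponentIn {z | m < dist w z} x) ⊆ {z | m ≤ dist w z} :=
      closure_minimal ((connectedComponentIn_subset _ _).trans fun z (hz : m < dist w z) => hz.le)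
        (isClosed_le continuous_const (by fun_prop))
    exact this hz.1
  by_contra hne
  have hlt : m < dist w z := lt_of_le_of_ne h1 (Ne.symm hne)
  have hzo := (hU.connectedComponentIn (x := z)).mem_nhds (mem_connectedComponentIn hlt)
  obtain ⟨y, hy1, hy2⟩ := mem_closure_iff_nhds.1 hz.1 _ hzo
  apply hz.2
  rw [connectedComponentIn_eq hy2, ← connectedComponentIn_eq hy1]
  exact mem_connectedComponentIn hlt

/-- The complement of a component of the complement of a ball is connected. -/
theorem isPreconnected_compl_component {w x : T} {m : ℝ} (hm : 0 < m) :
    IsPreconnected (connectedComponentIn {z | m < dist w z} x)ᶜ := by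
  have := H.locallyConnectedSpace
  have : PreconnectedSpace T := ⟨H.isPreconnected_univ⟩
  have hU : IsOpen {z | m < dist w z} := isOpen_lt continuous_const (by fun_prop)
  have hsub : ∀ y, connectedComponentIn {z | m < dist w z} y ⊆ {z | m < dist w z} :=
    fun y => connectedComponentIn_subset _ _
  have hball : {z | dist w z ≤ m} ⊆ (connectedComponentIn {z | m < dist w z} x)ᶜ :=
    fun z (hz : dist w z ≤ m) hzV => not_lt_of_ge hz (show m < dist w z from hsub x hzV)
  have hw : w ∈ {z | dist w z ≤ m} := by simp [hm.le]
  refine isPreconnected_of_forall w fun z hz => ?_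
  by_cases hzm : dist w z ≤ m
  · exact ⟨_, hball, hw, hzm, H.isPreconnected_closedBall w hm⟩
  push Not at hzm
  set V := connectedComponentIn {z | m < dist w z} z with hV
  have hzV : z ∈ V := mem_connectedComponentIn hzm
  have hwV : w ∉ V := fun h => by
    have := hsub z h
    simp only [mem_ofPred_eq, dist_self] at this
    linarith
  obtain ⟨q, hq⟩ : (frontier V).Nonempty :=
    nonempty_frontier_iff.2 ⟨⟨z, hzV⟩, fun h => hwV (h ▸ mem_univ w)⟩
  refine ⟨closure V ∪ {z | dist w z ≤ m}, union_subset ?_ hball, Or.inr hw,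
    Or.inl (subset_closure hzV), ?_⟩
  · intro y hy hyx
    obtain ⟨u, hu1, hu2⟩ := mem_closure_iff_nhds.1 hy _ (hU.connectedComponentIn.mem_nhds hyx)
    apply hz
    rw [connectedComponentIn_eq hu1, ← connectedComponentIn_eq hu2]
    exact hzV
  · exact IsPreconnected.union q (frontier_subset_closure hq) (H.frontier_component hq).le
      isPreconnected_connectedComponentIn.closure (H.isPreconnected_closedBall w hm)

end IsLengthConnected

theorem AddCircle.exists_int_of_coe_eq {x y : ℝ} (h : (x : AddCircle (1 : ℝ)) = y) :
    ∃ n : ℤ, x - y = n := by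
  have h0 : ((x - y : ℝ) : AddCircle (1 : ℝ)) = 0 := by rw [AddCircle.coe_sub, h, sub_self]
  obtain ⟨n, hn⟩ := (AddCircle.coe_eq_zero_iff (1 : ℝ)).1 h0
  exact ⟨n, by simpa using hn.symm⟩

/-- A continuous function with integral values is constant on connected sets. -/
theorem IsPreconnected.eq_of_forall_int {S : Set T} (hS : IsPreconnected S) {f : T → ℝ}
    (hf : Continuous f) (hint : ∀ z ∈ S, ∃ n : ℤ, f z = n) {x y : T} (hx : x ∈ S) (hy : y ∈ S) :
    f x = f y := by
  have hconn : IsPreconnected (f '' S) := hS.image _ hf.continuousOn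
  have hsub : (f '' S).Subsingleton := by
    refine (countable_range (fun n : ℤ => (n : ℝ))).mono ?_ |>.isTotallyDisconnected _ subset_rfl hconn
    rintro _ ⟨z, hz, rfl⟩
    obtain ⟨n, hn⟩ := hint z hz
    exact ⟨n, hn.symm⟩
  exact hsub ⟨x, hx, rfl⟩ ⟨y, hy, rfl⟩

/-- Unicoherence: if continuous maps to the circle lift to the line, then the common frontier of an
open connected set and its connected complement is not the union of two disjoint non-empty closed
sets. Otherwise a function with values `0` and `1` on the two parts would define a map to the
circle, going half way round inside the set and back outside. -/
theorem HasCircleLifts.frontier_not_separated (hT : HasCircleLifts T) {V F₀ F₁ : Set T}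
    (hV : IsPreconnected V) (hV' : IsPreconnected Vᶜ) (hVo : IsOpen V)
    (h0 : IsClosed F₀) (h1 : IsClosed F₁) (hd : Disjoint F₀ F₁) (hfr : frontier V ⊆ F₀ ∪ F₁)
    {c₀ c₁ : T} (hc0 : c₀ ∈ frontier V) (hc1 : c₁ ∈ frontier V) (hc0' : c₀ ∈ F₀) (hc1' : c₁ ∈ F₁) :
    False := by
  classical
  obtain ⟨u, hu0, hu1, -⟩ := exists_continuous_zero_one_of_isClosed h0 h1 hd
  have hhalf : ((1 / 2 : ℝ) : AddCircle (1 : ℝ)) = ((-(1 / 2) : ℝ) : AddCircle (1 : ℝ)) := by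
    rw [← sub_eq_zero, ← AddCircle.coe_sub, AddCircle.coe_eq_zero_iff]
    exact ⟨1, by norm_num⟩
  have hfru : ∀ z ∈ frontier V, ((u z / 2 : ℝ) : AddCircle (1 : ℝ)) = ((-(u z / 2) : ℝ) : AddCircle (1 : ℝ)) := by
    intro z hz
    rcases hfr hz with h | h
    · rw [hu0 h]; simp
    · rw [hu1 h]; exact hhalf
  let φ : C(T, AddCircle (1 : ℝ)) :=
    ⟨fun z => if z ∈ V then ((u z / 2 : ℝ) : AddCircle (1 : ℝ)) else ((-(u z / 2) : ℝ) : AddCircle (1 : ℝ)),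
      continuous_if (fun z hz => hfru z hz)
        ((AddCircle.continuous_mk' (1:ℝ)).comp (by fun_prop)).continuousOn
        ((AddCircle.continuous_mk' (1:ℝ)).comp (by fun_prop)).continuousOn⟩
  obtain ⟨ψ, hψ⟩ := hT φ
  have hφ1 : ∀ z ∈ closure V, φ z = ((u z / 2 : ℝ) : AddCircle (1 : ℝ)) := by
    intro z hz
    by_cases hzV : z ∈ V
    · simp [φ, hzV]
    · have : z ∈ frontier V := by rw [hVo.frontier_eq]; exact ⟨hz, hzV⟩
      simp only [φ, ContinuousMap.coe_mk, if_neg hzV]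
      exact (hfru z this).symm
  have hφ2 : ∀ z ∈ Vᶜ, φ z = ((-(u z / 2) : ℝ) : AddCircle (1 : ℝ)) := by
    intro z hz
    simp only [φ, ContinuousMap.coe_mk, if_neg (show z ∉ V from hz)]
  have e1 : ψ c₀ - u c₀ / 2 = ψ c₁ - u c₁ / 2 :=
    hV.closure.eq_of_forall_int (f := fun z => ψ z - u z / 2) (by fun_prop)
      (fun z hz => AddCircle.exists_int_of_coe_eq ((hψ z).trans (hφ1 z hz)))
      (frontier_subset_closure hc0) (frontier_subset_closure hc1)
  rw [hVo.frontier_eq] at hc0 hc1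
  have e2 : ψ c₀ - -(u c₀ / 2) = ψ c₁ - -(u c₁ / 2) :=
    hV'.eq_of_forall_int (f := fun z => ψ z - -(u z / 2)) (by fun_prop)
      (fun z hz => AddCircle.exists_int_of_coe_eq ((hψ z).trans (hφ2 z hz))) hc0.2 hc1.2
  have a0 : u c₀ = 0 := hu0 hc0'
  have a1 : u c₁ = 1 := hu1 hc1'
  rw [a0, a1] at e1 e2
  linarith

/-- For a null level `m`, a component of the complement of the ball of radius `m` has only one
frontier point, which therefore separates it from the centre of the ball. -/
theorem exists_cut_point (H : IsLengthConnected T) (hT : HasCircleLifts T) {w x : T} {m : ℝ}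
    (hm : 0 < m) (hmx : m < dist w x) (hnull : IsNullLevel w m) :
    ∃ q, q ∈ frontier (connectedComponentIn {z | m < dist w z} x) ∧ dist w q = m ∧
      ∀ C : Set T, IsPreconnected C → w ∈ C →
        (C ∩ connectedComponentIn {z | m < dist w z} x).Nonempty → q ∈ C := by
  have := H.locallyConnectedSpace
  have : PreconnectedSpace T := ⟨H.isPreconnected_univ⟩
  have hU : IsOpen {z | m < dist w z} := isOpen_lt continuous_const (by fun_prop)
  set V := connectedComponentIn {z | m < dist w z} x with hV
  have hxV : x ∈ V := mem_connectedComponentIn hmx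
  have hwV : w ∉ V := fun h => by
    have := connectedComponentIn_subset _ _ h
    simp only [mem_ofPred_eq, dist_self] at this
    linarith
  have hVo : IsOpen V := hU.connectedComponentIn
  obtain ⟨q, hq⟩ : (frontier V).Nonempty :=
    nonempty_frontier_iff.2 ⟨⟨x, hxV⟩, fun h => hwV (h ▸ mem_univ w)⟩
  have huniq : ∀ q' ∈ frontier V, q' = q := by
    intro q' hq'
    by_contra hne
    have hpos : 0 < dist q q' := dist_pos.2 (Ne.symm hne)
    obtain ⟨r, hr, hrn⟩ : ∃ r ∈ Ioo 0 (dist q q'), r ∉ (fun z => dist q z) '' {z | dist w z = m} := by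
      by_contra! hcon
      have := measure_mono_null hcon (hnull q)
      rw [Real.volume_Ioo, sub_zero, ENNReal.ofReal_eq_zero] at this
      linarith
    refine hT.frontier_not_separated isPreconnected_connectedComponentIn
      (H.isPreconnected_compl_component hm) hVo
      (F₀ := frontier V ∩ {z | dist q z ≤ r}) (F₁ := frontier V ∩ {z | r ≤ dist q z})
      (isClosed_frontier.inter (isClosed_le (by fun_prop) continuous_const))
      (isClosed_frontier.inter (isClosed_le continuous_const (by fun_prop))) ?_ ?_ hq hq'
      ⟨hq, by simpa using hr.1.le⟩ ⟨hq', hr.2.le⟩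
    · rw [Set.disjoint_left]
      rintro z ⟨hz, hz1⟩ ⟨-, hz2⟩
      exact hrn ⟨z, H.frontier_component hz, le_antisymm hz1 hz2⟩
    · intro z hz
      rcases le_total (dist q z) r with h | h
      · exact Or.inl ⟨hz, h⟩
      · exact Or.inr ⟨hz, h⟩
  refine ⟨q, hq, H.frontier_component hq, fun C hC hwC hCV => ?_⟩
  by_contra hqC
  -- otherwise `C` would be split by the open sets `V` and `(closure V)ᶜ`
  obtain ⟨z, -, hz1, hz2⟩ := hC V (closure V)ᶜ hVo isClosed_closure.isOpen_compl (fun z hz => by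
    by_cases hzV : z ∈ closure V
    · left
      by_contra hzV'
      exact hqC (huniq z (by rw [hVo.frontier_eq]; exact ⟨hzV, hzV'⟩) ▸ hz)
    · exact Or.inr hzV) hCV ⟨w, hwC, fun hw => hqC (by
      rw [← huniq w (by rw [hVo.frontier_eq]; exact ⟨hw, hwV⟩)]; exact hwC)⟩
  exact hz2 (subset_closure hz1)

/-- A family of cut points between `w` and `x`, indexed by a dense set of distances to `w`. -/
theorem exists_cut_family (H : IsLengthConnected T) (hT : HasCircleLifts T) (w x : T) :
    ∃ q : ℝ → T, ∀ m ∈ Ioo 0 (dist w x), IsNullLevel w m →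
      dist w (q m) = m ∧ dist (q m) x = dist w x - m ∧
      (∀ C : Set T, IsPreconnected C → w ∈ C → x ∈ C → q m ∈ C) ∧
      ∀ m' ∈ Ioo m (dist w x), IsNullLevel w m' → dist (q m) (q m') = m' - m := by
  classical
  have hex : ∀ m, ∃ q, m ∈ Ioo 0 (dist w x) → IsNullLevel w m →
      q ∈ frontier (connectedComponentIn {z | m < dist w z} x) ∧ dist w q = m ∧
      ∀ C : Set T, IsPreconnected C → w ∈ C →
        (C ∩ connectedComponentIn {z | m < dist w z} x).Nonempty → q ∈ C := by
    intro m
    by_cases h : m ∈ Ioo 0 (dist w x) ∧ IsNullLevel w m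
    · obtain ⟨q, hq⟩ := exists_cut_point H hT h.1.1 h.1.2 h.2
      exact ⟨q, fun _ _ => hq⟩
    · exact ⟨w, fun h1 h2 => absurd ⟨h1, h2⟩ h⟩
  choose q hq using hex
  -- points behind a cut point are at the expected distance from it
  have key : ∀ m, m ∈ Ioo 0 (dist w x) → IsNullLevel w m → ∀ y ∈ connectedComponentIn {z | m < dist w z} x,
      dist (q m) y = dist w y - m := by
    intro m hm hn y hy
    obtain ⟨-, h2, h3⟩ := hq m hm hn
    refine le_antisymm (le_of_forall_pos_lt_add fun ε hε => ?_) ?_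
    · obtain ⟨C, -, hC, hwC, hyC, hCd⟩ := H w y (dist w y + ε) (by linarith)
      have := hCd _ (h3 C hC hwC ⟨y, hyC, hy⟩)
      linarith
    · linarith [dist_triangle w (q m) y]
  refine ⟨q, fun m hm hn => ?_⟩
  have hxV : x ∈ connectedComponentIn {z | m < dist w z} x := mem_connectedComponentIn hm.2
  obtain ⟨h1, h2, h3⟩ := hq m hm hn
  refine ⟨h2, key m hm hn x hxV, fun C hC hw hx => h3 C hC hw ⟨x, hx, hxV⟩, fun m' hm' hn' => ?_⟩
  have hm'' : m' ∈ Ioo 0 (dist w x) := ⟨hm.1.trans hm'.1, hm'.2⟩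
  obtain ⟨h1', h2', -⟩ := hq m' hm'' hn'
  rw [key m hm hn (q m'), h2']
  have hsub : insert (q m') (connectedComponentIn {z | m' < dist w z} x) ⊆
      connectedComponentIn {z | m < dist w z} x := by
    refine IsPreconnected.subset_connectedComponentIn ?_
      (mem_insert_of_mem _ (mem_connectedComponentIn hm'.2)) ?_
    · refine isPreconnected_connectedComponentIn.subset_closure (subset_insert _ _) ?_
      exact insert_subset (frontier_subset_closure h1') subset_closure
    · refine insert_subset (by simpa [h2'] using hm'.1) fun z hz => ?_
      have hz' : z ∈ {z | m' < dist w z} := connectedComponentIn_subset _ _ hz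
      exact lt_trans hm'.1 hz'
  exact hsub (mem_insert _ _)

/-- Two points are joined by a segment, the closure of the cut points between them, which is
contained in every closed connected set containing both points. -/
theorem exists_segment (H : IsLengthConnected T) (hT : HasCircleLifts T)
    {κ : Type*} [Countable κ] (lam : κ → ℝ → T)
    (hlam : ∀ k, LipschitzWith 1 (lam k)) (hcov : ∀ z, ∃ k t, lam k t = z) (w x : T) :
    ∃ γ : ℝ → T, γ 0 = w ∧ γ (dist w x) = x ∧
      (∀ s ∈ Icc 0 (dist w x), ∀ t ∈ Icc 0 (dist w x), dist (γ s) (γ t) = |s - t|) ∧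
      ∀ C : Set T, IsClosed C → IsPreconnected C → w ∈ C → x ∈ C → γ '' Icc 0 (dist w x) ⊆ C := by
  set D := dist w x with hD
  obtain hD0 | hDpos := (dist_nonneg : 0 ≤ dist w x).eq_or_lt
  · have hwx : w = x := dist_eq_zero.1 hD0.symm
    have hD' : D = 0 := hD0.symm
    refine ⟨fun _ => w, rfl, hwx, fun s hs t ht => ?_, fun C _ _ hw _ => ?_⟩
    · rw [hD', Icc_self, mem_singleton_iff] at hs ht
      simp [hs, ht]
    · rintro _ ⟨_, _, rfl⟩; exact hw
  obtain ⟨q, hq⟩ := exists_cut_family H hT w x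
  set G : Set ℝ := {m | m ∈ Ioo 0 D ∧ IsNullLevel w m} with hG
  have hqq : ∀ m ∈ G, ∀ m' ∈ G, dist (q m) (q m') = |m - m'| := by
    intro m hm m' hm'
    rcases lt_trichotomy m m' with h | h | h
    · rw [(hq m hm.1 hm.2).2.2.2 m' ⟨h, hm'.1.2⟩ hm'.2, abs_of_neg (by linarith)]; ring
    · simp [h]
    · rw [dist_comm, (hq m' hm'.1 hm'.2).2.2.2 m ⟨h, hm.1.2⟩ hm.2, abs_of_pos (by linarith)]
  -- the good levels are dense in the interval
  have hdense : ∀ t ∈ Icc 0 D, t ∈ closure G := by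
    have h1 : Dense {m | ¬ IsNullLevel w m}ᶜ :=
      (countable_not_isNullLevel lam hlam hcov w).dense_compl ℝ
    have h2 : Ioo 0 D ⊆ closure G := by
      have := h1.open_subset_closure_inter (isOpen_Ioo (a := (0:ℝ)) (b := D))
      refine this.trans (closure_mono fun m hm => ⟨hm.1, by simpa using hm.2⟩)
    intro t ht
    rw [← closure_Ioo hDpos.ne] at ht
    exact closure_minimal h2 isClosed_closure ht
  obtain ⟨K, hK, hKc, hwK, hxK, -⟩ := H w x (dist w x + 1) (by linarith)
  have hpt : ∀ t ∈ Icc 0 D, ∃ y, ∀ m ∈ G, dist y (q m) = |t - m| := by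
    intro t ht
    obtain ⟨a, haG, hat⟩ := mem_closure_iff_seq_limit.1 (hdense t ht)
    obtain ⟨y, -, φ, hφ, hy⟩ := hK.tendsto_subseq (x := fun n => q (a n)) fun n =>
      (hq _ (haG n).1 (haG n).2).2.2.1 K hKc hwK hxK
    refine ⟨y, fun m hm => ?_⟩
    have l1 : Filter.Tendsto (fun n => dist (q (a (φ n))) (q m)) Filter.atTop (𝓝 (dist y (q m))) :=
      hy.dist tendsto_const_nhds
    have l2 : Filter.Tendsto (fun n => |a (φ n) - m|) Filter.atTop (𝓝 |t - m|) :=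
      ((hat.comp hφ.tendsto_atTop).sub_const m).abs
    refine tendsto_nhds_unique l1 (l2.congr fun n => ?_)
    exact (hqq _ (haG _) _ hm).symm
  have : Nonempty T := ⟨w⟩
  choose! γ hγ using hpt
  have hγq : ∀ t ∈ Icc 0 D, ∀ ε > 0, ∃ m ∈ G, |t - m| < ε ∧ dist (γ t) (q m) < ε := by
    intro t ht ε hε
    obtain ⟨m, hm, hd⟩ := Metric.mem_closure_iff.1 (hdense t ht) ε hε
    rw [Real.dist_eq] at hd
    exact ⟨m, hm, hd, by rwa [hγ t ht m hm]⟩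
  have hm0 : (0 : ℝ) ∈ Icc 0 D := ⟨le_rfl, hDpos.le⟩
  have hmD : D ∈ Icc 0 D := ⟨hDpos.le, le_rfl⟩
  refine ⟨γ, ?_, ?_, fun s hs t ht => ?_, ?_⟩
  · refine dist_le_zero.1 (le_of_forall_pos_lt_add fun ε hε => ?_)
    obtain ⟨m, hm, h1, h2⟩ := hγq 0 hm0 (ε / 2) (by linarith)
    have h3 := (hq m hm.1 hm.2).1
    rw [zero_sub, abs_neg, abs_of_pos hm.1.1] at h1
    rw [dist_comm] at h3
    linarith [dist_triangle (γ 0) (q m) w]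
  · refine dist_le_zero.1 (le_of_forall_pos_lt_add fun ε hε => ?_)
    obtain ⟨m, hm, h1, h2⟩ := hγq D hmD (ε / 2) (by linarith)
    have h3 := (hq m hm.1 hm.2).2.1
    rw [abs_of_pos (by linarith [hm.1.2])] at h1
    linarith [dist_triangle (γ D) (q m) x]
  · refine eq_of_forall_dist_le fun ε hε => ?_
    obtain ⟨m, hm, h1, h2⟩ := hγq s hs (ε / 2) (by linarith)
    have h3 := hγ t ht m hm
    have h4 : |dist (γ s) (γ t) - dist (q m) (γ t)| ≤ dist (γ s) (q m) := abs_dist_sub_le _ _ _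
    have h5 : |(|t - m| - |s - t|)| ≤ |s - m| := by
      have := abs_abs_sub_abs_le (t - m) (t - s)
      rw [abs_sub_comm s t]
      refine this.trans (le_of_eq ?_)
      congr 1; ring
    rw [dist_comm (q m), h3] at h4
    rw [Real.dist_eq]
    exact (abs_sub_le _ |t - m| _).trans (by linarith)
  · rintro C hCl hC hw hx _ ⟨t, ht, rfl⟩
    rw [← hCl.closure_eq, Metric.mem_closure_iff]
    intro ε hε
    obtain ⟨m, hm, -, h2⟩ := hγq t ht ε hε
    exact ⟨q m, (hq m hm.1 hm.2).2.2.1 C hC hw hx, h2⟩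

/-- An arc whose image contains a connected set joining its end points is contained in that
set. -/
theorem range_subset_of_isPreconnected {Y : Type*} [TopologicalSpace Y] [T2Space Y]
    (δ : C(unitInterval, Y)) (hδ : Function.Injective δ) {S : Set Y} (hS : IsPreconnected S)
    (h0 : δ 0 ∈ S) (h1 : δ 1 ∈ S) (hsub : S ⊆ range δ) : range δ ⊆ S := by
  have hP : IsPreconnected (δ ⁻¹' S) :=
    hS.preimage_of_isClosedMap hδ δ.continuous.isClosedMap hsub
  rintro _ ⟨t, rfl⟩
  exact hP.ordConnected.out h0 h1 ⟨t.2.1, t.2.2⟩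

/-- A metric space which is a length space, lifts maps to the circle to the real line and is
covered by countably many lines is an `ℝ`-tree. -/
theorem isRTree_of_hasCircleLifts [Nonempty T] (H : IsLengthConnected T) (hT : HasCircleLifts T)
    {κ : Type*} [Countable κ] (lam : κ → ℝ → T)
    (hlam : ∀ k, LipschitzWith 1 (lam k)) (hcov : ∀ z, ∃ k t, lam k t = z) : IsRTree T := by
  refine ⟨inferInstance, fun w x => ?_⟩
  obtain ⟨γ, h0, h1, hiso, hC⟩ := exists_segment H hT lam hlam hcov w x
  refine ⟨dist w x, γ, dist_nonneg, h0, h1, fun s hs t ht => ?_, fun δ hδ hδ0 hδ1 => ?_⟩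
  · rw [edist_dist, edist_dist, hiso s hs t ht, Real.dist_eq]
  have hsub := hC (range δ) (isCompact_range δ.continuous).isClosed
    (isPreconnected_range δ.continuous) ⟨0, hδ0⟩ ⟨1, hδ1⟩
  refine Subset.antisymm (range_subset_of_isPreconnected δ hδ ?_ ?_ ?_ hsub) hsub
  · refine isPreconnected_Icc.image _ ?_
    have : LipschitzOnWith 1 γ (Icc 0 (dist w x)) := LipschitzOnWith.of_dist_le_mul
      fun s hs t ht => by rw [hiso s hs t ht, Real.dist_eq]; simp
    exact this.continuousOn
  · exact ⟨0, ⟨le_rfl, dist_nonneg⟩, h0.trans hδ0.symm⟩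
  · exact ⟨dist w x, ⟨dist_nonneg, le_rfl⟩, h1.trans hδ1.symm⟩

end RTreeCriterion

/-! ### Geometry of the dual spine -/

section Spine

open Set

theorem quad_comm (a b : Fin 4) : quad a b = quad b a := by
  revert a b; decide

/-- The three quadrilateral types are distinguished by the vertex paired with a given one. -/
theorem sum_eq_quad (q : Fin 3 → ℝ) {a b e : Fin 4} (hab : a ≠ b) (hea : e ≠ a) (heb : e ≠ b) :
    ∑ j, q j = q (quad a b) + q (quad a e) + q (quad b e) := by
  rw [Fin.sum_univ_three]
  fin_cases a <;> fin_cases b <;> fin_cases e <;> simp [quad] at * <;> ring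

theorem quad_ne (a b e : Fin 4) (hab : a ≠ b) (hea : e ≠ a) (heb : e ≠ b) :
    quad a b ≠ quad a e := by
  revert a b e; decide

/-- Admissibility in one tetrahedron: the coordinates are non-negative and at most one of them is
non-zero. -/
structure IsSpineWeight (q : Fin 3 → ℝ) : Prop where
  nonneg : ∀ j, 0 ≤ q j
  unique : ∀ j j', q j ≠ 0 → q j' ≠ 0 → j = j'

theorem IdealTriangulation.IsAdmissible.isSpineWeight {ι : Type*} {T : IdealTriangulation ι}
    {N : ι → Fin 3 → ℝ} (hN : T.IsAdmissible N) (i : ι) : IsSpineWeight (N i) :=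
  ⟨hN.nonneg i, hN.unique i⟩

/-- The point of the line joining the ends `a` and `b` at which the Busemann function of `b` has
the value `t`. -/
noncomputable def spinePoint (q : Fin 3 → ℝ) (a b : Fin 4) (t : ℝ) : Fin 4 → ℝ := fun e =>
  if e = b then t else if e = a then -q (quad a b) - t else
    |t - (q (quad a e) - q (quad b e) - q (quad a b)) / 2|
      + (q (quad a b) - q (quad a e) - q (quad b e)) / 2

@[simp] theorem spinePoint_right (q : Fin 3 → ℝ) (a b : Fin 4) (t : ℝ) :
    spinePoint q a b t b = t := by simp [spinePoint]

theorem edist_spinePoint (q : Fin 3 → ℝ) (a b : Fin 4) (s t : ℝ) :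
    edist (spinePoint q a b s) (spinePoint q a b t) = edist s t := by
  rw [edist_dist, edist_dist]
  congr 1
  refine le_antisymm ((dist_pi_le_iff dist_nonneg).2 fun e => ?_) ?_
  · simp only [spinePoint]
    split_ifs
    · exact le_rfl
    · rw [dist_sub_left]
    · rw [dist_add_right, Real.dist_eq, Real.dist_eq]
      refine (abs_abs_sub_abs_le _ _).trans (le_of_eq ?_)
      congr 1; ring
  · simpa using dist_le_pi_dist (spinePoint q a b s) (spinePoint q a b t) b

variable {q : Fin 3 → ℝ}

theorem IsSpineWeight.trichotomy (hq : IsSpineWeight q) {a b e : Fin 4} (hab : a ≠ b) (hea : e ≠ a)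
    (heb : e ≠ b) : (q (quad a e) = 0 ∧ q (quad b e) = 0) ∨
      (q (quad a b) = 0 ∧ q (quad b e) = 0) ∨ (q (quad a b) = 0 ∧ q (quad a e) = 0) := by
  have h1 := quad_ne a b e hab hea heb
  have h2 := quad_ne b a e hab.symm heb hea
  have h3 := quad_ne e a b hea heb.symm hab.symm
  rw [quad_comm b a] at h2
  rw [quad_comm e a, quad_comm e b] at h3
  by_contra! hcon
  by_cases hx : q (quad a b) = 0
  · exact h3 (hq.unique _ _ (hcon.2.2 hx) (hcon.2.1 hx))
  · by_cases hy : q (quad a e) = 0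
    · exact h2 (hq.unique _ _ hx (hcon.1 hy))
    · exact h1 (hq.unique _ _ hx hy)

theorem IsSpineWeight.spineRay_left (hq : IsSpineWeight q) {a b : Fin 4} (hab : a ≠ b) {h : ℝ}
    (hh : 0 ≤ h) : spineRay q a h = spinePoint q a b ((∑ j, q j) / 2 + h - q (quad a b)) := by
  ext e
  simp only [spineRay, spinePoint]
  by_cases heb : e = b
  · subst heb; simp [hab.symm]
  by_cases hea : e = a
  · subst hea; simp [heb]; ring
  · simp only [hea, heb, if_false]
    rw [sum_eq_quad q hab hea heb]
    have h1 := hq.nonneg (quad a b)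
    have h2 := hq.nonneg (quad a e)
    have h3 := hq.nonneg (quad b e)
    rw [abs_of_nonneg]
    · ring
    · rcases hq.trichotomy hab hea heb with h | h | h <;> rw [h.1, h.2] <;> linarith

theorem IsSpineWeight.spineRay_right (hq : IsSpineWeight q) {a b : Fin 4} (hab : a ≠ b) {h : ℝ}
    (hh : 0 ≤ h) : spineRay q b h = spinePoint q a b (-((∑ j, q j) / 2 + h)) := by
  ext e
  simp only [spineRay, spinePoint]
  by_cases heb : e = b
  · subst heb; simp
  by_cases hea : e = a
  · subst hea; simp [heb, quad_comm b e]; ring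
  · simp only [hea, heb, if_false]
    rw [sum_eq_quad q hab hea heb]
    have h1 := hq.nonneg (quad a b)
    have h2 := hq.nonneg (quad a e)
    have h3 := hq.nonneg (quad b e)
    rw [abs_of_nonpos]
    · ring
    · rcases hq.trichotomy hab hea heb with h | h | h <;> rw [h.1, h.2] <;> linarith

theorem IsSpineWeight.le_sum (hq : IsSpineWeight q) (a b : Fin 4) : q (quad a b) ≤ ∑ j, q j :=
  Finset.single_le_sum (fun j _ => hq.nonneg j) (Finset.mem_univ _)

/-- The restriction of `spinePoint` to the interval is affine. -/
theorem IsSpineWeight.spinePoint_combo (hq : IsSpineWeight q) {a b : Fin 4} (hab : a ≠ b) {s t : ℝ}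
    (hs : 0 ≤ s) (ht : 0 ≤ t) (hst : s + t = 1) :
    s • spineRay q a 0 + t • spineRay q b 0 =
      spinePoint q a b (s * ((∑ j, q j) / 2 - q (quad a b)) - t * ((∑ j, q j) / 2)) := by
  obtain rfl : s = 1 - t := by linarith
  ext e
  simp only [Pi.add_apply, Pi.smul_apply, smul_eq_mul, spineRay, spinePoint]
  by_cases heb : e = b
  · subst heb; simp [hab.symm]; ring
  by_cases hea : e = a
  · subst hea; simp [heb, quad_comm b e]; ring
  · simp only [hea, heb, if_false]
    rw [sum_eq_quad q hab hea heb]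
    have h1 := hq.nonneg (quad a b)
    have h2 := hq.nonneg (quad a e)
    have h3 := hq.nonneg (quad b e)
    rcases hq.trichotomy hab hea heb with h | h | h
    · rw [h.1, h.2, abs_of_nonneg (by linarith)]; ring
    · rw [h.1, h.2, abs_of_nonpos (by nlinarith)]; ring
    · rw [h.1, h.2, abs_of_nonneg (by nlinarith)]; ring

theorem IsSpineWeight.spineLine_eq (hq : IsSpineWeight q) {a b : Fin 4} (hab : a ≠ b) :
    spineLine q a b = range (spinePoint q a b) := by
  have hk := hq.le_sum a b
  apply Subset.antisymm
  · rintro f ((⟨h, hh, rfl⟩ | ⟨s, t, hs, ht, hst, rfl⟩) | ⟨h, hh, rfl⟩)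
    · exact ⟨_, (hq.spineRay_left hab hh).symm⟩
    · exact ⟨_, (hq.spinePoint_combo hab hs ht hst).symm⟩
    · exact ⟨_, (hq.spineRay_right hab hh).symm⟩
  · rintro _ ⟨t, rfl⟩
    set k := ∑ j, q j with hkdef
    rcases le_total (k / 2 - q (quad a b)) t with h1 | h1
    · refine Or.inl (Or.inl ⟨t - (k / 2 - q (quad a b)), by simpa using h1, ?_⟩)
      rw [hq.spineRay_left hab (by linarith)]
      congr 1; ring
    rcases le_total t (-(k / 2)) with h2 | h2
    · refine Or.inr ⟨-t - k / 2, by simp; linarith, ?_⟩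
      rw [hq.spineRay_right hab (by linarith)]
      congr 1; ring
    rcases hk.eq_or_lt with h3 | h3
    · have : t = k / 2 - q (quad a b) := by linarith
      refine Or.inl (Or.inl ⟨0, by simp, ?_⟩)
      rw [hq.spineRay_left hab le_rfl, this]
      congr 1; ring
    · have hpos : 0 < k - q (quad a b) := by linarith
      refine Or.inl (Or.inr ⟨(t + k / 2) / (k - q (quad a b)),
        (k / 2 - q (quad a b) - t) / (k - q (quad a b)),
        div_nonneg (by linarith) hpos.le, div_nonneg (by linarith) hpos.le, ?_, ?_⟩)
      · rw [← add_div, div_eq_one_iff_eq hpos.ne']; ring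
      · rw [hq.spinePoint_combo hab (div_nonneg (by linarith) hpos.le)
          (div_nonneg (by linarith) hpos.le)]
        · congr 1; field_simp; ring
        · rw [← add_div, div_eq_one_iff_eq hpos.ne']; ring

theorem IsSpineWeight.mem_spineLine_iff (hq : IsSpineWeight q) {a b : Fin 4} (hab : a ≠ b)
    {f : Fin 4 → ℝ} : f ∈ spineLine q a b ↔ f = spinePoint q a b (f b) := by
  rw [hq.spineLine_eq hab]
  constructor
  · rintro ⟨t, rfl⟩; simp
  · intro h; exact ⟨_, h.symm⟩

/-- The vertices on the same side as `0` of a quadrilateral of type `θ`. -/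
def quadSide (θ : Fin 3) (v : Fin 4) : Bool := v = 0 ∨ quad 0 v = θ

theorem quad_eq_iff {θ : Fin 3} {a b : Fin 4} (hab : a ≠ b) :
    quad a b = θ ↔ quadSide θ a = quadSide θ b := by
  revert θ a b; decide

/-- Every vertex has exactly one partner on its side of the quadrilateral. -/
theorem exists_partition (θ : Fin 3) (a : Fin 4) : ∃ b c d : Fin 4, a ≠ b ∧ a ≠ c ∧ a ≠ d ∧ b ≠ c ∧
    b ≠ d ∧ c ≠ d ∧ quadSide θ b = quadSide θ a ∧ quadSide θ c = !quadSide θ a ∧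
    quadSide θ d = !quadSide θ a := by
  revert θ a; decide

theorem IsSpineWeight.exists_type (hq : IsSpineWeight q) :
    ∃ (θ : Fin 3) (k : ℝ), 0 ≤ k ∧ q = Pi.single θ k := by
  by_cases h : ∃ θ, q θ ≠ 0
  · obtain ⟨θ, hθ⟩ := h
    refine ⟨θ, q θ, hq.nonneg θ, funext fun j => ?_⟩
    by_cases hj : j = θ
    · subst hj; simp
    · rw [Pi.single_eq_of_ne hj]
      by_contra h0
      exact hj (hq.unique _ _ h0 hθ)
  · push Not at h
    exact ⟨0, 0, le_rfl, by rw [Pi.single_zero]; exact funext h⟩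

theorem isSpineWeight_single {θ : Fin 3} {k : ℝ} (hk : 0 ≤ k) : IsSpineWeight (Pi.single θ k) := by
  refine ⟨fun j => ?_, fun j j' h h' => ?_⟩
  · by_cases h : j = θ
    · subst h; simpa
    · simp [h]
  · have h1 : j = θ := by by_contra h0; exact h (Pi.single_eq_of_ne h0 _)
    have h2 : j' = θ := by by_contra h0; exact h' (Pi.single_eq_of_ne h0 _)
    rw [h1, h2]

/-- The interval of the dual spine: the Busemann functions of the ends on the side of the vertex
`0` have the value `s`, and the other two the value `-s`. -/
def spineInterval (θ : Fin 3) (s : ℝ) : Fin 4 → ℝ := fun v => if quadSide θ v then s else -s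

theorem single_quad {θ : Fin 3} {k : ℝ} {a b : Fin 4} (hab : a ≠ b) :
    (Pi.single θ k : Fin 3 → ℝ) (quad a b) = if quadSide θ a = quadSide θ b then k else 0 := by
  rw [Pi.single_apply]
  simp only [quad_eq_iff hab]

theorem spineRay_single (θ : Fin 3) (k : ℝ) (a : Fin 4) (h : ℝ) :
    spineRay (Pi.single θ k) a h = fun b => if b = a then -(k / 2 + h) else
      if quadSide θ b = quadSide θ a then h - k / 2 else h + k / 2 := by
  ext b
  simp only [spineRay, Finset.sum_pi_single', Finset.mem_univ, if_true]
  by_cases hb : b = a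
  · simp [hb]
  · rw [if_neg hb, if_neg hb, single_quad (Ne.symm hb)]
    by_cases h' : quadSide θ b = quadSide θ a
    · rw [if_pos h', if_pos h'.symm]; ring
    · rw [if_neg h', if_neg (Ne.symm h')]; ring

theorem spineRay_single_zero (θ : Fin 3) (k : ℝ) (a : Fin 4) :
    spineRay (Pi.single θ k) a 0 = spineInterval θ (if quadSide θ a then -(k / 2) else k / 2) := by
  rw [spineRay_single]
  ext b
  by_cases hb : b = a
  · subst hb; cases h : quadSide θ b <;> simp [spineInterval, h]
  · cases h : quadSide θ b <;> cases h' : quadSide θ a <;> simp [spineInterval, h, hb]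

theorem spineInterval_mem_segment {θ : Fin 3} {k s : ℝ} (hs : |s| ≤ k / 2) {a b : Fin 4}
    (h : quadSide θ a ≠ quadSide θ b) :
    spineInterval θ s ∈ segment ℝ (spineRay (Pi.single θ k) a 0) (spineRay (Pi.single θ k) b 0) := by
  have hlin : ∀ u v x y : ℝ, u • spineInterval θ x + v • spineInterval θ y =
      spineInterval θ (u * x + v * y) := by
    intro u v x y
    ext e
    simp only [spineInterval, Pi.add_apply, Pi.smul_apply, smul_eq_mul]
    split_ifs <;> ring
  have hs' := abs_le.1 hs
  have hseg : ∀ x y : ℝ, s ∈ segment ℝ x y → spineInterval θ s ∈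
      segment ℝ (spineInterval θ x) (spineInterval θ y) := by
    rintro x y ⟨u, v, hu, hv, huv, hs⟩
    exact ⟨u, v, hu, hv, huv, by rw [hlin]; congr 1⟩
  rw [spineRay_single_zero, spineRay_single_zero]
  apply hseg
  cases ha : quadSide θ a <;> cases hb : quadSide θ b <;> simp_all
  · rw [segment_symm, segment_eq_Icc (by linarith)]; exact hs'
  · rw [segment_eq_Icc (by linarith)]; exact hs'

/-- A point of the dual spine lies on one of the four rays or on the interval. -/
theorem mem_spineLine_cases {θ : Fin 3} {k : ℝ} (hk : 0 ≤ k) {a b : Fin 4}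
    {f : Fin 4 → ℝ} (hf : f ∈ spineLine (Pi.single θ k) a b) :
    (∃ h, 0 ≤ h ∧ (f = spineRay (Pi.single θ k) a h ∨ f = spineRay (Pi.single θ k) b h)) ∨
      ∃ s, |s| ≤ k / 2 ∧ f = spineInterval θ s := by
  rcases hf with (⟨h, hh, rfl⟩ | ⟨u, v, hu, hv, huv, rfl⟩) | ⟨h, hh, rfl⟩
  · exact Or.inl ⟨h, hh, Or.inl rfl⟩
  · right
    refine ⟨u * (if quadSide θ a then -(k / 2) else k / 2) +
      v * (if quadSide θ b then -(k / 2) else k / 2), ?_, ?_⟩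
    · obtain rfl : u = 1 - v := by linarith
      rw [abs_le]
      split_ifs <;> constructor <;> nlinarith
    · rw [spineRay_single_zero, spineRay_single_zero]
      ext e
      simp only [spineInterval, Pi.add_apply, Pi.smul_apply, smul_eq_mul]
      split_ifs <;> ring
  · exact Or.inl ⟨h, hh, Or.inr rfl⟩

theorem mem_spine_cases {θ : Fin 3} {k : ℝ} (hk : 0 ≤ k) {f : Fin 4 → ℝ}
    (hf : f ∈ spine (Pi.single θ k)) : (∃ a h, 0 ≤ h ∧ f = spineRay (Pi.single θ k) a h) ∨
      ∃ s, |s| ≤ k / 2 ∧ f = spineInterval θ s := by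
  obtain ⟨a, b, -, hf⟩ := hf
  rcases mem_spineLine_cases hk hf with ⟨h, hh, h1 | h1⟩ | h
  · exact Or.inl ⟨a, h, hh, h1⟩
  · exact Or.inl ⟨b, h, hh, h1⟩
  · exact Or.inr h

/-- Any two points of the dual spine lie on a line joining two ends. -/
theorem IsSpineWeight.exists_line (hq : IsSpineWeight q) {f g : Fin 4 → ℝ} (hf : f ∈ spine q)
    (hg : g ∈ spine q) : ∃ a b, a ≠ b ∧ f ∈ spineLine q a b ∧ g ∈ spineLine q a b := by
  obtain ⟨θ, k, hk, rfl⟩ := hq.exists_type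
  have hseg : ∀ {s : ℝ} {a b : Fin 4}, |s| ≤ k / 2 → quadSide θ a ≠ quadSide θ b →
      spineInterval θ s ∈ spineLine (Pi.single θ k) a b :=
    fun hs h => Or.inl (Or.inr (spineInterval_mem_segment hs h))
  have hopp : ∀ a, ∃ b, a ≠ b ∧ quadSide θ a ≠ quadSide θ b := fun a => by
    obtain ⟨b, c, d, -, h, -, -, -, -, -, h', -⟩ := exists_partition θ a
    exact ⟨c, h, by rw [h']; cases quadSide θ a <;> simp⟩
  rcases mem_spine_cases hk hf with ⟨a, h, hh, rfl⟩ | ⟨s, hs, rfl⟩ <;>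
    rcases mem_spine_cases hk hg with ⟨a', h', hh', rfl⟩ | ⟨s', hs', rfl⟩
  · by_cases haa : a = a'
    · subst haa
      obtain ⟨b, hb, -⟩ := hopp a
      exact ⟨a, b, hb, Or.inl (Or.inl ⟨h, hh, rfl⟩), Or.inl (Or.inl ⟨h', hh', rfl⟩)⟩
    · exact ⟨a, a', haa, Or.inl (Or.inl ⟨h, hh, rfl⟩), Or.inr ⟨h', hh', rfl⟩⟩
  · obtain ⟨b, hb, hb'⟩ := hopp a
    exact ⟨a, b, hb, Or.inl (Or.inl ⟨h, hh, rfl⟩), hseg hs' hb'⟩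
  · obtain ⟨b, hb, hb'⟩ := hopp a'
    exact ⟨a', b, hb, hseg hs hb', Or.inl (Or.inl ⟨h', hh', rfl⟩)⟩
  · obtain ⟨b, hb, hb'⟩ := hopp 0
    exact ⟨0, b, hb, hseg hs hb', hseg hs' hb'⟩

end Spine

/-! ### The ideal tetrahedron and its lifts to the universal covering -/

section Lifts

open Set Topology

theorem IdealTet.convex : Convex ℝ {x : Fin 4 → ℝ | x ∈ stdSimplex ℝ (Fin 4) ∧ ∀ v, x v ≠ 1} := by
  rintro x ⟨hx, hx1⟩ y ⟨hy, hy1⟩ a b ha hb hab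
  refine ⟨convex_stdSimplex ℝ _ hx hy ha hb hab, fun v hv => ?_⟩
  have h1 : x v ≤ 1 := hx.2 ▸ Finset.single_le_sum (fun w _ => hx.1 w) (Finset.mem_univ v)
  have h2 : y v ≤ 1 := hy.2 ▸ Finset.single_le_sum (fun w _ => hy.1 w) (Finset.mem_univ v)
  have h1' := lt_of_le_of_ne h1 (hx1 v)
  have h2' := lt_of_le_of_ne h2 (hy1 v)
  simp only [Pi.add_apply, Pi.smul_apply, smul_eq_mul] at hv
  rcases ha.eq_or_lt with rfl | ha'
  · rw [zero_add] at hab; subst hab; linarith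
  · nlinarith

theorem IdealTet.nonneg (x : IdealTet) (v : Fin 4) : 0 ≤ x.1 v := x.2.1.1 v

theorem IdealTet.sum_eq_one (x : IdealTet) : ∑ v, x.1 v = 1 := x.2.1.2

@[simp] theorem IdealTet.relabel_apply (g : Equiv.Perm (Fin 4)) (x : IdealTet) (w : Fin 4) :
    (x.relabel g).1 (g w) = x.1 w := by
  simp [IdealTet.relabel]

theorem IdealTet.relabel_inv (g : Equiv.Perm (Fin 4)) (x : IdealTet) :
    (x.relabel g).relabel g⁻¹ = x := by
  apply Subtype.ext
  ext w
  simp [IdealTet.relabel]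

/-- The centre of the face opposite `v`. -/
noncomputable def IdealTet.faceBarycentre (v : Fin 4) : IdealTet :=
  ⟨fun w => if w = v then 0 else 1 / 3, ⟨fun w => by dsimp only; split_ifs <;> norm_num, by
    fin_cases v <;> simp [Fin.sum_univ_four] <;> norm_num⟩, fun w => by
    dsimp only; split_ifs <;> norm_num⟩

theorem IdealTet.isPathConnected_of_convex {s : Set IdealTet} (hne : s.Nonempty)
    (h : ∀ x ∈ s, ∀ y ∈ s, ∀ z : IdealTet, z.1 ∈ segment ℝ x.1 y.1 → z ∈ s) :
    IsPathConnected s := by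
  have hind : IsInducing (Subtype.val : IdealTet → Fin 4 → ℝ) := ⟨rfl⟩
  rw [hind.isPathConnected_iff]
  refine Convex.isPathConnected ?_ (hne.image _)
  rw [convex_iff_segment_subset]
  rintro _ ⟨x, hx, rfl⟩ _ ⟨y, hy, rfl⟩ z hz
  exact ⟨⟨z, IdealTet.convex.segment_subset x.2 y.2 hz⟩, h x hx y hy _ hz, rfl⟩

theorem IdealTet.isPathConnected_face (v : Fin 4) : IsPathConnected {x : IdealTet | x.1 v = 0} := by
  refine IdealTet.isPathConnected_of_convex ⟨faceBarycentre v, by simp [faceBarycentre]⟩ ?_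
  rintro x hx y hy z ⟨a, b, -, -, -, h⟩
  have := congrFun h v
  simp only [Pi.add_apply, Pi.smul_apply, smul_eq_mul] at this
  rw [mem_ofPred_eq] at hx hy ⊢
  rw [← this, hx, hy]; ring

instance : ContractibleSpace IdealTet :=
  IdealTet.convex.contractibleSpace ⟨_, (IdealTet.faceBarycentre 0).2⟩

instance : LocallyPathConnectedSpace IdealTet := IdealTet.convex.locallyPathConnectedSpace

theorem IsLocalHomeomorph.locallyPathConnectedSpace {X M : Type*} [TopologicalSpace X]
    [TopologicalSpace M] [LocallyPathConnectedSpace M] {p : X → M} (hp : IsLocalHomeomorph p) :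
    LocallyPathConnectedSpace X :=
  letI : ChartedSpace M X :=
    { atlas := univ
      chartAt := fun x => (hp x).choose
      mem_chart_source := fun x => (hp x).choose_spec.1
      chart_mem_atlas := fun _ => mem_univ _ }
  ChartedSpace.locallyPathConnectedSpace M X

variable {ι : Type*} (T : IdealTriangulation ι)

instance : LocallyPathConnectedSpace T.Manifold :=
  inferInstanceAs (LocallyPathConnectedSpace (Quot T.FaceRel))

theorem IdealTriangulation.continuous_char (i : ι) : Continuous (T.char i) :=
  continuous_quot_mk.comp (continuous_sigmaMk (σ := fun _ : ι => IdealTet))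

variable {T}

theorem IdealTriangulation.char_eq_of_face (i : ι) (v : Fin 4) {u : IdealTet} (hu : u.1 v = 0) :
    T.char (T.adj i v) (u.relabel (T.glue i v)) = T.char i u :=
  (Quot.sound ⟨v, hu, rfl⟩).symm

theorem IdealTriangulation.FaceRel.symm {s t : (_ : ι) × IdealTet} (h : T.FaceRel s t) :
    T.FaceRel t s := by
  obtain ⟨v, hv, rfl⟩ := h
  refine ⟨T.glue s.1 v v, by simpa using hv, ?_⟩
  simp only
  rw [T.glue_glue, IdealTet.relabel_inv, T.adj_adj]

variable {X : Type*} [TopologicalSpace X] {p : X → T.Manifold}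

/-- The continuous map `L` is a lift to `X` of the ideal tetrahedron `i`. -/
def IsTetLift (p : X → T.Manifold) (i : ι) (L : C(IdealTet, X)) : Prop :=
  ∀ u, p (L u) = T.char i u

theorem IsCoveringMap.exists_tetLift (hp : IsCoveringMap p) {i : ι} {u : IdealTet} {x : X}
    (h : p x = T.char i u) : ∃ L, IsTetLift p i L ∧ L u = x := by
  obtain ⟨L, ⟨h1, h2⟩, -⟩ := hp.existsUnique_continuousMap_lifts ⟨T.char i, T.continuous_char i⟩ u x h
  exact ⟨L, fun u => congrFun h2 u, h1⟩

theorem IsCoveringMap.exists_tetLift_through (hp : IsCoveringMap p) (x : X) :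
    ∃ i u L, IsTetLift p i L ∧ L u = x := by
  obtain ⟨⟨i, u⟩, hu⟩ := Quot.exists_rep (p x)
  obtain ⟨L, hL⟩ := hp.exists_tetLift (i := i) (u := u) hu.symm
  exact ⟨i, u, L, hL⟩

theorem IsTetLift.eq (hp : IsCoveringMap p) {i : ι} {L L' : C(IdealTet, X)} (hL : IsTetLift p i L)
    (hL' : IsTetLift p i L') {u : IdealTet} (h : L u = L' u) : L = L' :=
  ContinuousMap.coe_injective (hp.eq_of_comp_eq L.continuous L'.continuous
    (funext fun u => (hL u).trans (hL' u).symm) u h)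

/-- The covering space has the topology coherent with the lifted ideal tetrahedra. -/
theorem IsCoveringMap.isOpen_of_tetLift (hp : IsCoveringMap p) {U : Set X}
    (hU : ∀ i L, IsTetLift p i L → IsOpen (L ⁻¹' U)) : IsOpen U := by
  rw [isOpen_iff_mem_nhds]
  intro x hx
  obtain ⟨e, hxe, rfl⟩ := hp.isLocalHomeomorph x
  set W := e '' (U ∩ e.source) with hW
  have hWo : IsOpen W := by
    refine (isQuotientMap_quot_mk (r := T.FaceRel)).isOpen_preimage.1 (isOpen_sigma_iff.2 fun i => ?_)
    rw [isOpen_iff_mem_nhds]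
    rintro u ⟨y, ⟨hyU, hye⟩, hyu⟩
    obtain ⟨L, hL, hLu⟩ := hp.exists_tetLift (i := i) (u := u) hyu
    have ho : IsOpen (L ⁻¹' (U ∩ e.source)) := (hU i L hL).inter (e.open_source.preimage L.continuous)
    refine Filter.mem_of_superset (ho.mem_nhds (show L u ∈ U ∩ e.source from hLu.symm ▸ ⟨hyU, hye⟩)) ?_
    exact fun u' hu' => ⟨L u', hu', hL u'⟩
  refine Filter.mem_of_superset ((e.isOpen_inter_preimage hWo).mem_nhds ⟨hxe, x, ⟨hx, hxe⟩, rfl⟩) ?_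
  rintro y ⟨hye, z, ⟨hzU, hze⟩, hzy⟩
  rwa [← e.injOn hze hye hzy]

theorem IsCoveringMap.continuous_of_tetLift (hp : IsCoveringMap p) {Y : Type*} [TopologicalSpace Y]
    {f : X → Y} (hf : ∀ i L, IsTetLift p i L → Continuous fun u => f (L u)) : Continuous f :=
  ⟨fun _ hU => hp.isOpen_of_tetLift fun i L hL => hU.preimage (hf i L hL)⟩

/-- A set meeting each lifted ideal tetrahedron in nothing or in all of it is everything. -/
theorem IsCoveringMap.eq_univ_of_tetLift [PreconnectedSpace X] (hp : IsCoveringMap p) {U : Set X}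
    (hne : U.Nonempty) (hU : ∀ i L, IsTetLift p i L → ∀ u u', L u ∈ U → L u' ∈ U) : U = univ := by
  refine IsClopen.eq_univ ⟨⟨hp.isOpen_of_tetLift fun i L hL => ?_⟩,
    hp.isOpen_of_tetLift fun i L hL => ?_⟩ hne <;> by_cases h : ∃ u, L u ∈ U
  · obtain ⟨u, hu⟩ := h
    convert isOpen_empty
    exact eq_empty_of_forall_notMem fun u' hu' => hu' (hU i L hL u u' hu)
  · convert isOpen_univ
    exact eq_univ_of_forall fun u' hu' => h ⟨u', hu'⟩
  · obtain ⟨u, hu⟩ := h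
    convert isOpen_univ
    exact eq_univ_of_forall fun u' => hU i L hL u u' hu
  · convert isOpen_empty
    exact eq_empty_of_forall_notMem fun u' hu' => h ⟨u', hu'⟩

/-- Every face of a lifted ideal tetrahedron belongs to a lift of the adjacent tetrahedron. -/
theorem IsTetLift.exists_adjacent (hp : IsCoveringMap p) {i : ι} {L : C(IdealTet, X)}
    (hL : IsTetLift p i L) (v : Fin 4) : ∃ L', IsTetLift p (T.adj i v) L' ∧
      ∀ u : IdealTet, u.1 v = 0 → L' (u.relabel (T.glue i v)) = L u := by
  have hb : (IdealTet.faceBarycentre v).1 v = 0 := by simp [IdealTet.faceBarycentre]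
  obtain ⟨L', hL', hLb⟩ := hp.exists_tetLift (i := T.adj i v)
    (u := (IdealTet.faceBarycentre v).relabel (T.glue i v)) (x := L (IdealTet.faceBarycentre v))
    (by rw [hL, T.char_eq_of_face i v hb])
  refine ⟨L', hL', ?_⟩
  have hc : Continuous fun u : IdealTet => u.relabel (T.glue i v) := by
    have : Continuous fun (u : IdealTet) (w : Fin 4) => u.1 ((T.glue i v)⁻¹ w) :=
      continuous_pi fun w => (continuous_apply _).comp continuous_subtype_val
    exact this.subtype_mk _
  exact hp.eqOn_of_comp_eqOn (IdealTet.isPathConnected_face v).isConnected.isPreconnected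
    (L'.continuous.comp hc).continuousOn L.continuous.continuousOn
    (fun u hu => ((hL' _).trans (T.char_eq_of_face i v hu)).trans (hL u).symm) hb hLb

/-- Countably many lifts of ideal tetrahedra cover a connected covering space: they are reached
from one of them by crossing finitely many faces. -/
theorem IsCoveringMap.exists_countable_tetLift [ConnectedSpace X] (hp : IsCoveringMap p) :
    ∃ A : List (Fin 4) → ι × C(IdealTet, X), (∀ l, IsTetLift p (A l).1 (A l).2) ∧
      ∀ x, ∃ l u, (A l).2 u = x := by
  have hadj : ∀ (a : {a : ι × C(IdealTet, X) // IsTetLift p a.1 a.2}) (v : Fin 4),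
      ∃ b : {a : ι × C(IdealTet, X) // IsTetLift p a.1 a.2}, b.1.1 = T.adj a.1.1 v ∧
        ∀ u : IdealTet, u.1 v = 0 → b.1.2 (u.relabel (T.glue a.1.1 v)) = a.1.2 u := by
    rintro ⟨⟨i, L⟩, hL⟩ v
    obtain ⟨L', hL', h⟩ := IsTetLift.exists_adjacent hp hL v
    exact ⟨⟨(_, L'), hL'⟩, rfl, h⟩
  choose next hnext1 hnext2 using hadj
  obtain ⟨i₀, u₀, L₀, hL₀, -⟩ := hp.exists_tetLift_through (Classical.arbitrary X)
  let A : List (Fin 4) → {a : ι × C(IdealTet, X) // IsTetLift p a.1 a.2} :=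
    fun l => l.foldr (fun v a => next a v) ⟨(i₀, L₀), hL₀⟩
  have step : ∀ s t : (_ : ι) × IdealTet, T.FaceRel s t → ∀ l, (A l).1.1 = s.1 →
      ∃ l', (A l').1.1 = t.1 ∧ (A l').1.2 t.2 = (A l).1.2 s.2 := by
    rintro s t ⟨v, hv, rfl⟩ l hl
    refine ⟨v :: l, ?_, ?_⟩
    · rw [← hl]; exact hnext1 (A l) v
    · rw [← hl]; exact hnext2 (A l) v _ hv
  have chain : ∀ s t : (_ : ι) × IdealTet, Relation.EqvGen T.FaceRel s t →
      (∀ l, (A l).1.1 = s.1 → ∃ l', (A l').1.1 = t.1 ∧ (A l').1.2 t.2 = (A l).1.2 s.2) ∧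
      (∀ l, (A l).1.1 = t.1 → ∃ l', (A l').1.1 = s.1 ∧ (A l').1.2 s.2 = (A l).1.2 t.2) := by
    intro s t h
    induction h with
    | rel s t h => exact ⟨step s t h, step t s h.symm⟩
    | refl s => exact ⟨fun l hl => ⟨l, hl, rfl⟩, fun l hl => ⟨l, hl, rfl⟩⟩
    | symm s t _ ih => exact ih.symm
    | trans s t r _ _ ih1 ih2 =>
      refine ⟨fun l hl => ?_, fun l hl => ?_⟩
      · obtain ⟨l1, h1, h1'⟩ := ih1.1 l hl
        obtain ⟨l2, h2, h2'⟩ := ih2.1 l1 h1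
        exact ⟨l2, h2, h2'.trans h1'⟩
      · obtain ⟨l1, h1, h1'⟩ := ih2.2 l hl
        obtain ⟨l2, h2, h2'⟩ := ih1.2 l1 h1
        exact ⟨l2, h2, h2'.trans h1'⟩
  refine ⟨fun l => (A l).1, fun l => (A l).2, fun x => ?_⟩
  have huniv : {x | ∃ l u, (A l).1.2 u = x} = univ := by
    refine hp.eq_univ_of_tetLift ⟨_, [], u₀, rfl⟩ fun i L hL u u' hu => ?_
    obtain ⟨l, w, hw⟩ := hu
    have hq : T.char (A l).1.1 w = T.char i u := by
      rw [← hL u, ← hw]; exact ((A l).2 w).symm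
    obtain ⟨l', hl', hl''⟩ := (chain ⟨_, w⟩ ⟨i, u⟩ (Quot.eqvGen_exact hq)).1 l rfl
    have hlift : IsTetLift p i (A l').1.2 := by
      have := (A l').2
      rwa [show (A l').1.1 = i from hl'] at this
    exact ⟨l', u', by rw [IsTetLift.eq hp hlift hL (hl''.trans hw)]⟩
  exact (huniv.symm ▸ mem_univ x : x ∈ {x | ∃ l u, (A l).1.2 u = x})

end Lifts

/-! ### Deck transformations -/

section Deck

variable {X M : Type*} [TopologicalSpace X] [TopologicalSpace M] {p : X → M}

theorem IsCoveringMap.monodromy_deck (hp : IsCoveringMap p) (D : C(X, X)) (hD : ∀ x, p (D x) = p x)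
    {a b : M} (γ : Path.Homotopic.Quotient a b) (e : p ⁻¹' {a}) :
    (hp.monodromy γ ⟨D e, (hD e).trans e.2⟩ : X) = D (hp.monodromy γ e) := by
  obtain ⟨γ⟩ := γ
  have h0 : γ 0 = p (e : X) := γ.source.trans e.2.symm
  have h : D.comp (hp.liftPath γ e h0) = hp.liftPath γ (D e) (h0.trans (hD e).symm) := by
    rw [hp.eq_liftPath_iff']
    refine ⟨funext fun t => (hD _).trans ?_, ?_⟩
    · exact congrFun (hp.liftPath_lifts γ e h0) t
    · simp [hp.liftPath_zero]
  exact (congrArg (fun f : C(unitInterval, X) => f 1) h).symm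

theorem IsCoveringMap.exists_deck [SimplyConnectedSpace X] [LocallyPathConnectedSpace X] (hp : IsCoveringMap p) {x y : X} (h : p y = p x) :
    ∃ D : C(X, X), (∀ z, p (D z) = p z) ∧ D x = y := by
  obtain ⟨D, ⟨h1, h2⟩, -⟩ := hp.existsUnique_continuousMap_lifts ⟨p, hp.continuous⟩ x y h
  exact ⟨D, fun z => congrFun h2 z, h1⟩

theorem IsCoveringMap.deck_ext [PreconnectedSpace X] (hp : IsCoveringMap p) {D D' : C(X, X)} (hD : ∀ z, p (D z) = p z)
    (hD' : ∀ z, p (D' z) = p z) {x : X} (h : D x = D' x) : D = D' :=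
  ContinuousMap.coe_injective (hp.eq_of_comp_eq D.continuous D'.continuous
    (funext fun u => (hD u).trans (hD' u).symm) x h)

theorem IsCoveringMap.exists_isDeckAction [SimplyConnectedSpace X] [LocallyPathConnectedSpace X]
    (hp : IsCoveringMap p) (x₀ : X) :
    ∃ deck : FundamentalGroup M (p x₀) →* (X ≃ₜ X), IsDeckAction hp x₀ deck := by
  have hex : ∀ g : FundamentalGroup M (p x₀), ∃ D : C(X, X), (∀ z, p (D z) = p z) ∧
      D x₀ = (hp.monodromy (g⁻¹).toPath ⟨x₀, rfl⟩ : X) :=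
    fun g => hp.exists_deck (hp.monodromy (g⁻¹).toPath ⟨x₀, rfl⟩).2
  choose D hD hD0 using hex
  have hone : D 1 = ContinuousMap.id X := by
    refine hp.deck_ext (hD 1) (fun z => rfl) (x := x₀) ?_
    rw [hD0, inv_one]
    exact congrArg Subtype.val (congrFun hp.monodromy_refl _)
  have hmul : ∀ g h, D (g * h) = (D g).comp (D h) := by
    intro g h
    refine hp.deck_ext (hD _) (fun z => (hD g _).trans (hD h z)) (x := x₀) ?_
    rw [hD0, mul_inv_rev, ContinuousMap.comp_apply, hD0 h,
      ← hp.monodromy_deck (D g) (hD g) (h⁻¹).toPath]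
    have : (⟨D g x₀, (hD g x₀).trans rfl⟩ : p ⁻¹' {p x₀}) = hp.monodromy (g⁻¹).toPath ⟨x₀, rfl⟩ :=
      Subtype.ext (hD0 g)
    rw [this]
    exact congrArg Subtype.val (hp.monodromy_trans_apply (g⁻¹).toPath (h⁻¹).toPath _)
  have hinv : ∀ g x, D g⁻¹ (D g x) = x := fun g x => by
    rw [← ContinuousMap.comp_apply, ← hmul, inv_mul_cancel, hone]; rfl
  let deck : FundamentalGroup M (p x₀) →* (X ≃ₜ X) :=
    { toFun := fun g =>
        { toFun := D g
          invFun := D g⁻¹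
          left_inv := hinv g
          right_inv := fun x => by simpa using hinv g⁻¹ x
          continuous_toFun := (D g).continuous
          continuous_invFun := (D g⁻¹).continuous }
      map_one' := Homeomorph.ext fun x => by
        change D 1 x = x
        rw [hone]; rfl
      map_mul' := fun g h => Homeomorph.ext fun x => by
        change D (g * h) x = D g (D h x)
        rw [hmul]; rfl }
  exact ⟨deck, fun g => ⟨hD g, hD0 g⟩⟩

end Deck

/-! ### The leaf space made Hausdorff -/

namespace MeasuredFoliation

open Set Topology

variable {ι : Type*} {T : IdealTriangulation ι} {N : ι → Fin 3 → ℝ} (F : MeasuredFoliation T N)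
  {X : Type*} [TopologicalSpace X] {p : X → T.Manifold}

theorem edist_toTree_le {x y : X} {m : ℝ≥0∞} (h : F.AdmissiblePath p x y m) :
    edist (F.toTree p x) (F.toTree p y) ≤ m :=
  sInf_le h

theorem exists_admissiblePath_lt {x y : X} {r : ℝ≥0∞}
    (h : edist (F.toTree p x) (F.toTree p y) < r) : ∃ m < r, F.AdmissiblePath p x y m := by
  obtain ⟨m, hm, hmr⟩ := sInf_lt_iff.1 (show sInf {m | F.AdmissiblePath p x y m} < r from h)
  exact ⟨m, hmr, hm⟩

/-- The straight path between two points of an open edge. -/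
theorem exists_path_openEdge {a b : Fin 4} {u v : IdealTet} (hu : u ∈ openEdge a b)
    (hv : v ∈ openEdge a b) : ∃ c : C(unitInterval, IdealTet), c 0 = u ∧ c 1 = v ∧
      (∀ t, c t ∈ openEdge a b) ∧ ∀ (t : unitInterval) (w : Fin 4), (c t).1 w = (1 - t) * u.1 w + t * v.1 w := by
  have hmem : ∀ t : unitInterval, (fun w => (1 - (t : ℝ)) * u.1 w + t * v.1 w) ∈
      {x : Fin 4 → ℝ | x ∈ stdSimplex ℝ (Fin 4) ∧ ∀ v, x v ≠ 1} := fun t =>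
    IdealTet.convex u.2 v.2 (sub_nonneg.2 t.2.2) t.2.1 (by ring)
  refine ⟨⟨fun t => ⟨_, hmem t⟩, Continuous.subtype_mk (by fun_prop) _⟩, ?_, ?_, ?_, ?_⟩
  · apply Subtype.ext; ext w; simp
  · apply Subtype.ext; ext w; simp
  · intro t w h1 h2
    simp [hu w h1 h2, hv w h1 h2]
  · intro t w; rfl

theorem openEdge_ext {a b : Fin 4} (hab : a ≠ b) {u v : IdealTet} (hu : u ∈ openEdge a b)
    (hv : v ∈ openEdge a b) (h : u.1 b = v.1 b) : u = v := by
  have key : ∀ w ∈ openEdge a b, w.1 a = 1 - w.1 b := by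
    intro w hw
    have hs := w.sum_eq_one
    rw [← Finset.sum_subset (Finset.subset_univ {a, b}), Finset.sum_pair hab] at hs
    · linarith
    · intro e _ he
      simp only [Finset.mem_insert, Finset.mem_singleton, not_or] at he
      exact hw e he.1 he.2
  apply Subtype.ext
  ext w
  by_cases hb : w = b
  · rw [hb, h]
  by_cases ha : w = a
  · rw [ha, key u hu, key v hv, h]
  · rw [hu w ha hb, hv w ha hb]

theorem leaf_mem_spineLine {i : ι} {a b : Fin 4} (hab : a ≠ b) {u : IdealTet}
    (hu : u ∈ openEdge a b) : F.leaf i u ∈ spineLine (N i) a b := by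
  rw [← F.leaf_edge i a b hab]; exact ⟨u, hu, rfl⟩

theorem leaf_lt_iff {i : ι} {a b : Fin 4} (hab : a ≠ b) {u v : IdealTet} (hu : u ∈ openEdge a b)
    (hv : v ∈ openEdge a b) : F.leaf i v b < F.leaf i u b ↔ u.1 b < v.1 b := by
  refine ⟨fun h => ?_, F.leaf_edge_strict i a b hab u hu v hv⟩
  by_contra! hle
  rcases hle.lt_or_eq with hlt | heq
  · exact lt_asymm h (F.leaf_edge_strict i a b hab v hv u hu hlt)
  · rw [openEdge_ext hab hu hv heq.symm] at h
    exact lt_irrefl _ h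

theorem admissiblePath_lift {i : ι} {L : C(IdealTet, X)} (hL : IsTetLift p i L)
    {c : C(unitInterval, IdealTet)} (hc : (∀ s t, F.leaf i (c s) = F.leaf i (c t)) ∨
      Function.Injective fun t => F.leaf i (c t)) :
    F.AdmissiblePath p (L (c 0)) (L (c 1)) (edist (F.leaf i (c 0)) (F.leaf i (c 1))) := by
  have h : F.IsPiece p (L.comp c) (edist (F.leaf i (c 0)) (F.leaf i (c 1))) i c :=
    ⟨fun t => hL _, hc, rfl⟩
  simpa using AdmissiblePath.cons h (.nil _)

/-- Within a leaf of a tetrahedron any two points are joined by a path. -/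
theorem exists_path_leaf {i : ι} {u v : IdealTet} (h : F.leaf i u = F.leaf i v) :
    ∃ c : C(unitInterval, IdealTet), c 0 = u ∧ c 1 = v ∧ ∀ t, F.leaf i (c t) = F.leaf i u := by
  obtain ⟨γ, hγ⟩ := (F.leaf_connected i _ (F.leaf_mem i u)).joinedIn u rfl v h.symm
  exact ⟨γ, γ.source, γ.target, hγ⟩

theorem edist_toTree_eq_zero_of_leaf {i : ι} {L : C(IdealTet, X)} (hL : IsTetLift p i L)
    {u v : IdealTet} (h : F.leaf i u = F.leaf i v) :
    edist (F.toTree p (L u)) (F.toTree p (L v)) = 0 := by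
  obtain ⟨c, rfl, rfl, hc⟩ := F.exists_path_leaf h
  refine le_antisymm ?_ bot_le
  have := F.edist_toTree_le (F.admissiblePath_lift hL (Or.inl fun s t => (hc s).trans (hc t).symm))
  rwa [h, edist_self] at this

theorem edist_toTree_le_of_openEdge {i : ι} {L : C(IdealTet, X)} (hL : IsTetLift p i L)
    {a b : Fin 4} (hab : a ≠ b) {u v : IdealTet} (hu : u ∈ openEdge a b) (hv : v ∈ openEdge a b) :
    edist (F.toTree p (L u)) (F.toTree p (L v)) ≤ edist (F.leaf i u) (F.leaf i v) := by
  by_cases huv : u.1 b = v.1 b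
  · rw [openEdge_ext hab hu hv huv]; simp
  obtain ⟨c, h0, h1, hc, hcw⟩ := exists_path_openEdge hu hv
  have hinj : Function.Injective fun t => F.leaf i (c t) := by
    intro s t hst
    have hb : (c s).1 b = (c t).1 b := by
      by_contra hne
      rcases lt_or_gt_of_ne hne with h | h
      · exact (F.leaf_edge_strict i a b hab _ (hc s) _ (hc t) h).ne (congrFun hst b).symm
      · exact (F.leaf_edge_strict i a b hab _ (hc t) _ (hc s) h).ne (congrFun hst b)
    rw [hcw, hcw] at hb
    have : ((s : ℝ) - t) * (v.1 b - u.1 b) = 0 := by linarith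
    rcases mul_eq_zero.1 this with h | h
    · exact Subtype.ext (by linarith)
    · exact absurd (by linarith) huv
  have := F.edist_toTree_le (F.admissiblePath_lift hL (Or.inr hinj))
  rwa [h0, h1] at this

theorem edist_triangle_zero {Y : Type*} [PseudoEMetricSpace Y] {x x' y y' : Y} (hx : edist x x' = 0)
    (hy : edist y' y = 0) : edist x y ≤ edist x' y' := by
  refine (edist_triangle4 x x' y' y).trans ?_
  rw [hx, hy, zero_add, add_zero]

variable (hN : T.IsAdmissible N)
include hN

theorem exists_edge_points {i : ι} (u v : IdealTet) : ∃ a b, a ≠ b ∧ ∃ u' ∈ openEdge a b,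
    ∃ v' ∈ openEdge a b, F.leaf i u' = F.leaf i u ∧ F.leaf i v' = F.leaf i v := by
  obtain ⟨a, b, hab, hu, hv⟩ := (hN.isSpineWeight i).exists_line (F.leaf_mem i u) (F.leaf_mem i v)
  rw [← F.leaf_edge i a b hab] at hu hv
  obtain ⟨u', hu', hu''⟩ := hu
  obtain ⟨v', hv', hv''⟩ := hv
  exact ⟨a, b, hab, u', hu', v', hv', hu'', hv''⟩

/-- On a lifted tetrahedron the distance in the leaf space is at most the one in the dual spine:
move in a leaf to an edge, along this edge, and again in a leaf. -/
theorem edist_toTree_lift_le {i : ι} {L : C(IdealTet, X)} (hL : IsTetLift p i L) (u v : IdealTet) :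
    edist (F.toTree p (L u)) (F.toTree p (L v)) ≤ edist (F.leaf i u) (F.leaf i v) := by
  obtain ⟨a, b, hab, u', hu', v', hv', hu'', hv''⟩ := F.exists_edge_points hN (i := i) u v
  rw [← hu'', ← hv'']
  exact (edist_triangle_zero (F.edist_toTree_eq_zero_of_leaf hL hu''.symm)
    (F.edist_toTree_eq_zero_of_leaf hL hv'')).trans (F.edist_toTree_le_of_openEdge hL hab hu' hv')

theorem exists_connected_lift {i : ι} {L : C(IdealTet, X)} (hL : IsTetLift p i L) (u v : IdealTet) :
    ∃ K : Set IdealTet, IsCompact K ∧ IsPreconnected K ∧ u ∈ K ∧ v ∈ K ∧ ∀ z ∈ K,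
      edist (F.toTree p (L u)) (F.toTree p (L z)) + edist (F.toTree p (L z)) (F.toTree p (L v)) ≤
        edist (F.leaf i u) (F.leaf i v) := by
  obtain ⟨a, b, hab, u', hu', v', hv', hu'', hv''⟩ := F.exists_edge_points hN (i := i) u v
  obtain ⟨c₁, h10, h11, hc₁⟩ := F.exists_path_leaf hu''.symm
  obtain ⟨c₂, h20, h21, hc₂, hcw⟩ := exists_path_openEdge hu' hv'
  obtain ⟨c₃, h30, h31, hc₃⟩ := F.exists_path_leaf hv''
  refine ⟨range c₁ ∪ range c₂ ∪ range c₃,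
    ((isCompact_range c₁.continuous).union (isCompact_range c₂.continuous)).union
      (isCompact_range c₃.continuous), ?_, Or.inl (Or.inl ⟨0, h10⟩), Or.inr ⟨1, h31⟩, ?_⟩
  · refine IsPreconnected.union v' (Or.inr ⟨1, h21⟩) ⟨0, h30⟩ (IsPreconnected.union u' ⟨1, h11⟩ ⟨0, h20⟩
      (isPreconnected_range c₁.continuous) (isPreconnected_range c₂.continuous))
      (isPreconnected_range c₃.continuous)
  have hle : ∀ z, edist (F.toTree p (L u)) (F.toTree p (L z)) +
      edist (F.toTree p (L z)) (F.toTree p (L v)) ≤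
      edist (F.leaf i u) (F.leaf i z) + edist (F.leaf i z) (F.leaf i v) := fun z =>
    add_le_add (F.edist_toTree_lift_le hN hL _ _) (F.edist_toTree_lift_le hN hL _ _)
  rintro z ((⟨t, rfl⟩ | ⟨t, rfl⟩) | ⟨t, rfl⟩)
  · refine (hle _).trans ?_
    rw [hc₁, edist_self, zero_add]
  · refine (hle _).trans (le_of_eq ?_)
    -- on the edge the leaf map is monotone, so its image is a segment of the line
    have hq := hN.isSpineWeight i
    have hl : ∀ w ∈ openEdge a b, F.leaf i w = spinePoint (N i) a b (F.leaf i w b) := fun w hw =>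
      (hq.mem_spineLine_iff hab).1 (F.leaf_mem_spineLine hab hw)
    have hmono : ∀ x ∈ openEdge a b, ∀ y ∈ openEdge a b, x.1 b ≤ y.1 b →
        F.leaf i y b ≤ F.leaf i x b := by
      intro x hx y hy hxy
      by_contra! hlt
      exact absurd ((F.leaf_lt_iff hab hy hx).1 hlt) (not_lt.2 hxy)
    rw [← hu'', ← hv'', hl u' hu', hl v' hv', hl _ (hc₂ t), edist_spinePoint, edist_spinePoint,
      edist_spinePoint, edist_dist, edist_dist, edist_dist, ← ENNReal.ofReal_add dist_nonneg dist_nonneg]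
    congr 1
    have ht := hcw t b
    have t0 := t.2.1
    have t1 := t.2.2
    rw [Real.dist_eq, Real.dist_eq, Real.dist_eq]
    rcases le_total (u'.1 b) (v'.1 b) with h | h
    · have e1 := hmono _ hu' _ (hc₂ t) (by rw [ht]; nlinarith)
      have e2 := hmono _ (hc₂ t) _ hv' (by rw [ht]; nlinarith)
      rw [abs_of_nonneg (by linarith), abs_of_nonneg (by linarith), abs_of_nonneg (by linarith)]
      ring
    · have e1 := hmono _ (hc₂ t) _ hu' (by rw [ht]; nlinarith)
      have e2 := hmono _ hv' _ (hc₂ t) (by rw [ht]; nlinarith)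
      rw [abs_of_nonpos (by linarith), abs_of_nonpos (by linarith), abs_of_nonpos (by linarith)]
      ring
  · refine (hle _).trans ?_
    rw [hc₃, hv'', edist_self, add_zero]

variable (hp : IsCoveringMap p)
include hp

/-- An admissible path can be tightened to a connected set along which distances in the leaf space
add up to at most its measure. -/
theorem AdmissiblePath.exists_connected {x y : X} {m : ℝ≥0∞} (h : F.AdmissiblePath p x y m) :
    ∃ C : Set X, IsCompact C ∧ IsPreconnected C ∧ x ∈ C ∧ y ∈ C ∧ ∀ z ∈ C,
      edist (F.toTree p x) (F.toTree p z) + edist (F.toTree p z) (F.toTree p y) ≤ m := by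
  induction h with
  | nil x => exact ⟨{x}, isCompact_singleton, isPreconnected_singleton, rfl, rfl, by simp⟩
  | @cons γ m m' i c y hγ h ih =>
    obtain ⟨C, hCc, hC, h1, hy, hCd⟩ := ih
    obtain ⟨L, hL, hL0⟩ := hp.exists_tetLift (hγ.lift 0)
    have hLγ : ∀ t, L (c t) = γ t := fun t => congrFun (hp.eq_of_comp_eq (g₁ := fun t => L (c t))
      (L.continuous.comp c.continuous) γ.continuous
      (funext fun t => (hL _).trans (hγ.lift t).symm) 0 hL0) t
    obtain ⟨K, hKc, hK, hK0, hK1, hKd⟩ := F.exists_connected_lift hN hL (c 0) (c 1)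
    rw [hLγ, hLγ, ← hγ.measure] at hKd
    have hdy := F.edist_toTree_le h
    refine ⟨L '' K ∪ C, (hKc.image L.continuous).union hCc, IsPreconnected.union (γ 1)
      ⟨c 1, hK1, hLγ 1⟩ h1 (hK.image _ L.continuous.continuousOn) hC, Or.inl ⟨c 0, hK0, hLγ 0⟩,
      Or.inr hy, ?_⟩
    rintro z (⟨z, hz, rfl⟩ | hz)
    · refine (add_le_add le_rfl (edist_triangle _ (F.toTree p (γ 1)) _)).trans ?_
      rw [← add_assoc]
      exact add_le_add (hKd z hz) hdy
    · refine (add_le_add (edist_triangle _ (F.toTree p (γ 1)) _) le_rfl).trans ?_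
      rw [add_assoc]
      refine add_le_add ?_ (hCd z hz)
      simpa [hLγ] using hKd (c 1) hK1

theorem continuous_toTree : Continuous (F.toTree p) := by
  refine hp.continuous_of_tetLift fun i L hL => continuous_iff_continuousAt.2 fun u => ?_
  rw [ContinuousAt, tendsto_iff_edist_tendsto_0]
  refine tendsto_of_tendsto_of_tendsto_of_le_of_le tendsto_const_nhds ?_ (fun _ => bot_le)
    fun v => F.edist_toTree_lift_le hN hL v u
  exact tendsto_iff_edist_tendsto_0.1 (F.continuous_leaf i).continuousAt

theorem edist_toTree_ne_top [ConnectedSpace X] (x y : X) :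
    edist (F.toTree p x) (F.toTree p y) ≠ ⊤ := by
  have h : {y | edist (F.toTree p x) (F.toTree p y) < ⊤} = univ := by
    refine hp.eq_univ_of_tetLift ⟨x, by simp⟩ fun i L hL u u' hu => ?_
    refine (edist_triangle _ (F.toTree p (L u)) _).trans_lt (ENNReal.add_lt_top.2 ⟨hu, ?_⟩)
    exact (F.edist_toTree_lift_le hN hL u u').trans_lt (edist_lt_top _ _)
  exact (h.symm ▸ mem_univ y : y ∈ {y | edist (F.toTree p x) (F.toTree p y) < ⊤}).ne

/-- A lift to the line of a map from the leaf space to the circle is continuous on the leaf space: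
along a connected set in a small ball it cannot jump by an integer. -/
theorem continuous_lift_of_circle {φ : F.Tree p → AddCircle (1 : ℝ)} (hφ : Continuous φ) {ψ : X → ℝ}
    (hψc : Continuous ψ) (hψ : ∀ x, (ψ x : AddCircle (1 : ℝ)) = φ (F.toTree p x)) (x : X) {η : ℝ}
    (hη : 0 < η) : ∃ ε > 0, ∀ y, edist (F.toTree p x) (F.toTree p y) < ε → |ψ y - ψ x| < η := by
  set η' := min η (1 / 4) with hη'
  have hη0 : 0 < η' := lt_min hη (by norm_num)
  obtain ⟨ε, hε, hball⟩ := EMetric.mem_nhds_iff.1 (hφ.continuousAt.preimage_mem_nhds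
    (Metric.ball_mem_nhds (φ (F.toTree p x)) hη0))
  refine ⟨ε, hε, fun y hy => ?_⟩
  obtain ⟨m, hm, hmp⟩ := F.exists_admissiblePath_lt hy
  obtain ⟨C, -, hC, hx, hyC, hCd⟩ := AdmissiblePath.exists_connected F hN hp hmp
  have hnear : ∀ z ∈ C, ‖((ψ z - ψ x : ℝ) : AddCircle (1 : ℝ))‖ < η' := by
    intro z hz
    have h1 : edist (F.toTree p z) (F.toTree p x) < ε := by
      rw [edist_comm]
      exact (le_self_add.trans (hCd z hz)).trans_lt hm
    have h2 : dist (φ (F.toTree p z)) (φ (F.toTree p x)) < η' := hball h1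
    rwa [dist_eq_norm, ← hψ, ← hψ, ← AddCircle.coe_sub] at h2
  refine lt_of_lt_of_le ?_ (min_le_left η (1 / 4))
  by_contra! hge
  have him : IsPreconnected ((fun z => |ψ z - ψ x|) '' C) :=
    hC.image _ (by fun_prop)
  obtain ⟨z, hz, hzη⟩ := him.Icc_subset ⟨x, hx, by simp⟩ ⟨y, hyC, rfl⟩ ⟨hη0.le, hge⟩
  have h3 := hnear z hz
  have hzη' : |ψ z - ψ x| = η' := hzη
  have hq : η' ≤ 1 / 4 := min_le_right _ _
  rw [(AddCircle.norm_coe_eq_abs_iff (1 : ℝ) one_ne_zero).2 (by rw [hzη', abs_one]; linarith), hzη'] at h3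
  exact lt_irrefl _ h3

variable [SimplyConnectedSpace X]

theorem hasCircleLifts_tree : HasCircleLifts (F.Tree p) := by
  intro φ
  have : LocallyPathConnectedSpace X := hp.isLocalHomeomorph.locallyPathConnectedSpace
  have hx₀ : Nonempty X := inferInstance
  obtain ⟨x₀⟩ := hx₀
  obtain ⟨t₀, ht₀⟩ := QuotientAddGroup.mk_surjective (φ (F.toTree p x₀))
  obtain ⟨ψ, ⟨-, hψ⟩, -⟩ := (AddCircle.isCoveringMap_coe (1 : ℝ)).existsUnique_continuousMap_lifts
    (⟨fun x => φ (F.toTree p x), φ.continuous.comp (F.continuous_toTree hN hp)⟩ : C(X, AddCircle (1 : ℝ)))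
    x₀ t₀ ht₀
  have hψ' : ∀ x, (ψ x : AddCircle (1 : ℝ)) = φ (F.toTree p x) := fun x => congrFun hψ x
  have hcont := F.continuous_lift_of_circle hN hp φ.continuous ψ.continuous hψ'
  have hwd : ∀ x y : F.Cover p, Inseparable x y → ψ x = ψ y := by
    intro x y hxy
    have h0 : edist (F.toTree p x) (F.toTree p y) = 0 := by
      have : F.toTree p x = F.toTree p y := SeparationQuotient.mk_eq_mk.2 hxy
      rw [this, edist_self]
    refine eq_of_forall_dist_le fun η hη => ?_
    obtain ⟨ε, hε, h⟩ := hcont x hη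
    rw [dist_comm, Real.dist_eq]
    exact (h y (h0 ▸ hε)).le
  have hψF : Continuous fun x : F.Cover p => ψ x := by
    rw [EMetric.continuous_iff]
    intro x δ hδ
    obtain ⟨η, hη, hηδ⟩ := ENNReal.lt_iff_exists_real_btwn.1 hδ
    rw [ENNReal.ofReal_pos] at hηδ
    obtain ⟨ε, hε, h⟩ := hcont x hηδ.1
    refine ⟨ε, hε, fun y hy => ?_⟩
    rw [edist_comm] at hy
    refine lt_trans ?_ hηδ.2
    rw [edist_dist, Real.dist_eq]
    exact (ENNReal.ofReal_lt_ofReal_iff hηδ.1).2 (h y hy)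
  exact ⟨⟨SeparationQuotient.lift (X := F.Cover p) (fun x => ψ x) hwd,
    SeparationQuotient.continuous_lift hψF⟩, SeparationQuotient.surjective_mk.forall.2 hψ'⟩

theorem isRTree_tree : IsRTree (F.Tree p) := by
  have hfin : ∀ a b : F.Tree p, edist a b ≠ ⊤ := SeparationQuotient.surjective_mk.forall₂.2
    fun x y => F.edist_toTree_ne_top hN hp x y
  let : MetricSpace (F.Tree p) := EMetricSpace.toMetricSpace hfin
  have : Nonempty (F.Tree p) := (inferInstance : Nonempty X).map (F.toTree p)
  have hH : IsLengthConnected (F.Tree p) := by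
    refine SeparationQuotient.surjective_mk.forall₂.2 fun x y r hr => ?_
    have hr' : edist (F.toTree p x) (F.toTree p y) < ENNReal.ofReal r := by
      rw [edist_dist]
      exact (ENNReal.ofReal_lt_ofReal_iff (dist_nonneg.trans_lt hr)).2 hr
    obtain ⟨m, hm, hmp⟩ := F.exists_admissiblePath_lt hr'
    obtain ⟨C, hCc, hC, hx, hy, hCd⟩ := AdmissiblePath.exists_connected F hN hp hmp
    have hcont := F.continuous_toTree hN hp
    refine ⟨F.toTree p '' C, hCc.image hcont, hC.image _ hcont.continuousOn, ⟨x, hx, rfl⟩,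
      ⟨y, hy, rfl⟩, ?_⟩
    rintro _ ⟨z, hz, rfl⟩
    have := (hCd z hz).trans_lt hm
    rw [edist_dist, edist_dist, ← ENNReal.ofReal_add dist_nonneg dist_nonneg] at this
    exact (ENNReal.ofReal_lt_ofReal_iff_of_nonneg (add_nonneg dist_nonneg dist_nonneg)).1 this
  obtain ⟨A, hA, hAcov⟩ := hp.exists_countable_tetLift
  have hedge : ∀ (i : ι) (ab : {ab : Fin 4 × Fin 4 // ab.1 ≠ ab.2}) (t : ℝ), ∃ u : IdealTet,
      F.leaf i u = spinePoint (N i) ab.1.1 ab.1.2 t := by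
    intro i ab t
    have : spinePoint (N i) ab.1.1 ab.1.2 t ∈ spineLine (N i) ab.1.1 ab.1.2 := by
      rw [(hN.isSpineWeight i).spineLine_eq ab.2]; exact ⟨t, rfl⟩
    rw [← F.leaf_edge i _ _ ab.2] at this
    obtain ⟨u, -, hu⟩ := this
    exact ⟨u, hu⟩
  choose e he using hedge
  refine isRTree_of_hasCircleLifts hH (F.hasCircleLifts_tree hN hp)
    (κ := List (Fin 4) × {ab : Fin 4 × Fin 4 // ab.1 ≠ ab.2})
    (fun k t => F.toTree p ((A k.1).2 (e (A k.1).1 k.2 t))) (fun k s t => ?_) ?_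
  · refine (F.edist_toTree_lift_le hN (hA k.1) _ _).trans ?_
    rw [he, he, edist_spinePoint, ENNReal.coe_one, one_mul]
  · refine SeparationQuotient.surjective_mk.forall.2 fun x => ?_
    obtain ⟨l, u, rfl⟩ := hAcov x
    obtain ⟨a, b, hab, hu⟩ := F.leaf_mem (A l).1 u
    refine ⟨(l, ⟨(a, b), hab⟩), F.leaf (A l).1 u b, ?_⟩
    refine edist_eq_zero.1 (F.edist_toTree_eq_zero_of_leaf (hA l) ?_)
    rw [he]
    exact (((hN.isSpineWeight _).mem_spineLine_iff hab).1 hu).symm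

omit hN hp [SimplyConnectedSpace X]

theorem AdmissiblePath.map_deck {D : C(X, X)} (hD : ∀ x, p (D x) = p x) {x y : X} {m : ℝ≥0∞}
    (h : F.AdmissiblePath p x y m) : F.AdmissiblePath p (D x) (D y) m := by
  induction h with
  | nil x => exact .nil _
  | @cons γ m m' i c y hγ _ ih =>
    have h : F.IsPiece p (D.comp γ) m i c :=
      ⟨fun t => (hD _).trans (hγ.lift t), hγ.leaf_or_transverse, hγ.measure⟩
    exact AdmissiblePath.cons h ih

/-- Deck transformations act on the leaf space by isometries. -/
theorem exists_isometric_action {G : Type*} [Group G] (deck : G →* (X ≃ₜ X))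
    (hdeck : ∀ g x, p (deck g x) = p x) : ∃ ρ : G →* (F.Tree p ≃ᵢ F.Tree p),
      ∀ g x, ρ g (F.toTree p x) = F.toTree p (deck g x) := by
  have hle : ∀ g x y, edist (F.toTree p (deck g x)) (F.toTree p (deck g y)) ≤
      edist (F.toTree p x) (F.toTree p y) := fun g x y =>
    le_sInf fun m hm => F.edist_toTree_le
      (AdmissiblePath.map_deck F (D := ⟨deck g, (deck g).continuous⟩) (hdeck g) hm)
  let f : G → F.Tree p → F.Tree p := fun g => SeparationQuotient.lift (X := F.Cover p)
    (fun x => F.toTree p (deck g x)) fun x y hxy => by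
      have h0 : F.toTree p x = F.toTree p y := SeparationQuotient.mk_eq_mk.2 hxy
      have := hle g x y
      rw [h0, edist_self, nonpos_iff_eq_zero] at this
      exact edist_eq_zero.1 this
  have hf : ∀ g x, f g (F.toTree p x) = F.toTree p (deck g x) := fun g x => rfl
  have hmul : ∀ g h a, f (g * h) a = f g (f h a) := fun g h =>
    SeparationQuotient.surjective_mk.forall.2 fun x =>
      congrArg (F.toTree p) (by rw [map_mul]; rfl : deck (g * h) x = deck g (deck h x))
  have hone : ∀ a, f 1 a = a := SeparationQuotient.surjective_mk.forall.2 fun x =>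
    congrArg (F.toTree p) (by rw [map_one]; rfl : deck 1 x = x)
  have hfle : ∀ g a b, edist (f g a) (f g b) ≤ edist a b := fun g =>
    SeparationQuotient.surjective_mk.forall₂.2 fun x y => hle g x y
  have hinv : ∀ g a, f g⁻¹ (f g a) = a := fun g a => by rw [← hmul, inv_mul_cancel, hone]
  refine ⟨
    { toFun := fun g =>
        { toFun := f g
          invFun := f g⁻¹
          left_inv := hinv g
          right_inv := fun a => by simpa using hinv g⁻¹ a
          isometry_toFun := fun a b => le_antisymm (hfle g a b) (by
            simpa [hinv] using hfle g⁻¹ (f g a) (f g b)) }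
      map_one' := IsometryEquiv.ext fun a => hone a
      map_mul' := fun g h => IsometryEquiv.ext fun a => hmul g h a }, hf⟩

end MeasuredFoliation

/-! ### Matching the levels along the edges -/

section EdgeShift

open Finset Function

/-- A function on a finite set is the coboundary, along a permutation, of another function if its
sum over each cycle is zero: average the partial sums along the cycle. -/
theorem exists_coboundary {α : Type*} [Finite α] {P : α → α} (hP : Injective P) (δ : α → ℝ)
    (hδ : ∀ f, ∑ k ∈ range (minimalPeriod P f), δ (P^[k] f) = 0) :
    ∃ s : α → ℝ, ∀ f, s (P f) = s f + δ f := by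
  have hδ' : ∀ f, birkhoffSum P δ (minimalPeriod P f) f = 0 := hδ
  refine ⟨fun f => -(∑ k ∈ range (minimalPeriod P f), birkhoffSum P δ k f) / minimalPeriod P f,
    fun f => ?_⟩
  have hper : f ∈ periodicPts P := hP.mem_periodicPts f
  have hn : 0 < minimalPeriod P f := minimalPeriod_pos_of_mem_periodicPts hper
  have hn' : (minimalPeriod P f : ℝ) ≠ 0 := by exact_mod_cast hn.ne'
  dsimp only
  rw [minimalPeriod_apply hper]
  have h1 : ∀ k, birkhoffSum P δ k (P f) = birkhoffSum P δ (k + 1) f - δ f := fun k => by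
    rw [birkhoffSum_succ']; ring
  have h2 : ∑ k ∈ range (minimalPeriod P f), birkhoffSum P δ (k + 1) f =
      ∑ k ∈ range (minimalPeriod P f), birkhoffSum P δ k f := by
    have h3 := sum_range_succ (fun k => birkhoffSum P δ k f) (minimalPeriod P f)
    rw [sum_range_succ', hδ', birkhoffSum_zero] at h3
    linarith
  simp only [h1, sum_sub_distrib, h2, sum_const, card_range, nsmul_eq_mul]
  field_simp
  ring

variable {ι : Type*} (T : IdealTriangulation ι)

/-- List the vertices around the same directed edge in the opposite rotational direction. -/
def flagTurn (f : TetFlag ι) : TetFlag ι := (f.1, f.2 * Equiv.swap 2 3)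

/-- The flag with the same vertices in the tetrahedron behind the face `abd`. -/
def flagCross (f : TetFlag ι) : TetFlag ι := (T.adj f.1 (f.2 2), T.glue f.1 (f.2 2) * f.2)

theorem flagTurn_flagTurn (f : TetFlag ι) : flagTurn (flagTurn f) = f := by
  simp [flagTurn, mul_assoc]

theorem flagCross_flagCross (f : TetFlag ι) : flagCross T (flagCross T f) = f := by
  simp only [flagCross, Equiv.Perm.mul_apply, T.adj_adj, T.glue_glue, inv_mul_cancel_left]

theorem step_eq (f : TetFlag ι) : T.step f = flagTurn (flagCross T f) := rfl

theorem step_injective : Injective T.step := by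
  have h1 : Injective (flagTurn (ι := ι)) :=
    LeftInverse.injective flagTurn_flagTurn
  have h2 : Injective (flagCross T) := LeftInverse.injective (flagCross_flagCross T)
  exact h1.comp h2

theorem quad_perm (σ : Equiv.Perm (Fin 4)) :
    quad (σ 2) (σ 1) = quad (σ 0) (σ 3) ∧ quad (σ 3) (σ 1) = quad (σ 0) (σ 2) := by
  have h : ∀ a b c d : Fin 4, a ≠ b → a ≠ c → a ≠ d → b ≠ c → b ≠ d → c ≠ d →
      quad c b = quad a d ∧ quad d b = quad a c := by decide
  apply h <;> exact fun h => absurd (σ.injective h) (by decide)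

theorem perm_eq_or_of_edge_eq {σ τ : Equiv.Perm (Fin 4)} (h0 : σ 0 = τ 0) (h1 : σ 1 = τ 1) :
    τ = σ ∨ τ = σ * Equiv.swap 2 3 := by
  have h : ∀ a b c d c' d' : Fin 4, a ≠ b → a ≠ c → a ≠ d → b ≠ c → b ≠ d → c ≠ d → a ≠ c' →
      a ≠ d' → b ≠ c' → b ≠ d' → c' ≠ d' → (c' = c ∧ d' = d) ∨ (c' = d ∧ d' = c) := by decide
  have ne : ∀ (π : Equiv.Perm (Fin 4)) {x y : Fin 4}, x ≠ y → π x ≠ π y :=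
    fun π _ _ hxy h => hxy (π.injective h)
  rcases h (σ 0) (σ 1) (σ 2) (σ 3) (τ 2) (τ 3) (ne σ (by decide)) (ne σ (by decide))
    (ne σ (by decide)) (ne σ (by decide)) (ne σ (by decide)) (ne σ (by decide))
    (h0 ▸ ne τ (by decide)) (h0 ▸ ne τ (by decide)) (h1 ▸ ne τ (by decide))
    (h1 ▸ ne τ (by decide)) (ne τ (by decide)) with h | h
  · left
    ext v
    fin_cases v <;> simp [h0, h1, h]
  · right
    ext v
    fin_cases v
    · simp [h0, Equiv.swap_apply_of_ne_of_ne]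
    · simp [h1, Equiv.swap_apply_of_ne_of_ne]
    · simp [h]
    · simp [h]

theorem exists_perm {a b v : Fin 4} (hab : a ≠ b) (hav : a ≠ v) (hbv : b ≠ v) :
    ∃ σ : Equiv.Perm (Fin 4), σ 0 = a ∧ σ 1 = b ∧ σ 2 = v := by
  obtain ⟨d, hd⟩ : ∃ d : Fin 4, d ≠ a ∧ d ≠ b ∧ d ≠ v := by
    revert a b v; decide
  have hinj : Injective ![a, b, v, d] := by
    intro x y hxy
    fin_cases x <;> fin_cases y <;> simp_all
  exact ⟨Equiv.ofBijective _ (Finite.injective_iff_bijective.1 hinj), rfl, rfl, rfl⟩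

theorem faceCentre_apply (q : Fin 3 → ℝ) {v b : Fin 4} (h : b ≠ v) :
    faceCentre q v b = q (quad v b) - (∑ j, q j) / 2 := by
  simp [faceCentre, spineRay, h]

theorem faceCentre_add (q : Fin 3 → ℝ) {a b v : Fin 4} (hab : a ≠ b) (hav : a ≠ v) (hbv : b ≠ v) :
    faceCentre q v a + faceCentre q v b = -q (quad a b) := by
  rw [faceCentre_apply q hav, faceCentre_apply q hbv, sum_eq_quad q hab hav.symm hbv.symm,
    quad_comm v a, quad_comm v b]
  ring

/-- The `Q`-matching equations allow to choose, consistently across all faces, the positions of the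
edges on the lines of the dual spines. Here `s i a b` is the value of the Busemann function of `b`
at the midpoint of the edge `ab`. -/
theorem exists_edgeShift [Finite ι] {N : ι → Fin 3 → ℝ} (hN : T.QMatching N) :
    ∃ s : ι → Fin 4 → Fin 4 → ℝ, (∀ i a b, a ≠ b → s i a b + s i b a = -N i (quad a b)) ∧
      ∀ i v a b, a ≠ b → a ≠ v → b ≠ v →
        s (T.adj i v) (T.glue i v a) (T.glue i v b)
          - faceCentre (N (T.adj i v)) (T.glue i v v) (T.glue i v b) =
        s i a b - faceCentre (N i) v b := by
  set φ : TetFlag ι → ℝ := fun f => faceCentre (N f.1) (f.2 2) (f.2 1) with hφ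
  set δ : TetFlag ι → ℝ := fun f => φ (flagCross T f) - φ f with hδ
  have hslope : ∀ f, φ (flagTurn f) - φ f = quadSlope N f := by
    rintro ⟨i, σ⟩
    have ne : ∀ {x y : Fin 4}, x ≠ y → σ x ≠ σ y := fun hxy h => hxy (σ.injective h)
    have e2 : (Equiv.swap (2 : Fin 4) 3) 1 = 1 := by decide
    simp only [hφ, flagTurn, Equiv.Perm.mul_apply, Equiv.swap_apply_left, e2, quadSlope]
    rw [faceCentre_apply _ (ne (by decide)), faceCentre_apply _ (ne (by decide)),
      (quad_perm σ).1, (quad_perm σ).2]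
    ring
  obtain ⟨s₁, hs₁⟩ : ∃ s : TetFlag ι → ℝ, ∀ f, s (T.step f) = s f + δ f := by
    refine exists_coboundary (step_injective T) δ fun f => ?_
    have h1 : ∀ k, δ (T.step^[k] f) = quadSlope N (T.step^[k] f) +
        (φ (flagTurn (T.step^[k + 1] f)) - φ (flagTurn (T.step^[k] f))) := by
      intro k
      rw [iterate_succ_apply', step_eq, flagTurn_flagTurn, ← hslope]
      simp only [hδ]; ring
    simp only [h1, sum_add_distrib]
    rw [hN f, sum_range_sub (fun k => φ (flagTurn (T.step^[k] f))), iterate_minimalPeriod]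
    simp
  -- averaging over both rotational directions gives a function of directed edges
  set s₂ : TetFlag ι → ℝ := fun f => (s₁ f + s₁ (flagTurn f)) / 2 with hs₂
  have hturn : ∀ f, s₂ (flagTurn f) = s₂ f := fun f => by
    simp only [hs₂, flagTurn_flagTurn]; ring
  have hcross : ∀ f, s₂ (flagCross T f) = s₂ f + δ f := fun f => by
    have h1 := hs₁ f
    have h2 := hs₁ (flagCross T f)
    rw [step_eq] at h1 h2
    rw [flagCross_flagCross] at h2
    simp only [hs₂, hδ, flagCross_flagCross] at h1 h2 ⊢
    linarith
  have hedge : ∀ i a b, ∃ r, ∀ σ : Equiv.Perm (Fin 4), σ 0 = a → σ 1 = b → s₂ (i, σ) = r := by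
    intro i a b
    by_cases h : ∃ σ : Equiv.Perm (Fin 4), σ 0 = a ∧ σ 1 = b
    · obtain ⟨σ, h0, h1⟩ := h
      refine ⟨s₂ (i, σ), fun τ h0' h1' => ?_⟩
      rcases perm_eq_or_of_edge_eq (h0.trans h0'.symm) (h1.trans h1'.symm) with rfl | rfl
      · rfl
      · exact hturn (i, σ)
    · push Not at h
      exact ⟨0, fun σ h0 h1 => absurd h1 (h σ h0)⟩
  choose s₀ hs₀ using hedge
  have hface : ∀ i v a b, a ≠ b → a ≠ v → b ≠ v →
      s₀ (T.adj i v) (T.glue i v a) (T.glue i v b)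
        - faceCentre (N (T.adj i v)) (T.glue i v v) (T.glue i v b) =
      s₀ i a b - faceCentre (N i) v b := by
    intro i v a b hab hav hbv
    obtain ⟨σ, rfl, rfl, rfl⟩ := exists_perm hab hav hbv
    have h := hcross (i, σ)
    rw [hs₀ i _ _ σ rfl rfl, flagCross, hs₀ _ (T.glue i (σ 2) (σ 0)) (T.glue i (σ 2) (σ 1)) _ rfl rfl] at h
    rw [h]
    simp only [hδ, hφ, flagCross, Equiv.Perm.mul_apply]
    ring
  -- make the positions compatible with the reversal of edges
  refine ⟨fun i a b => (s₀ i a b - N i (quad a b) - s₀ i b a) / 2, fun i a b hab => ?_,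
    fun i v a b hab hav hbv => ?_⟩
  · dsimp only
    rw [quad_comm b a]; ring
  · have hg : ∀ {x y : Fin 4}, x ≠ y → T.glue i v x ≠ T.glue i v y :=
      fun hxy h => hxy ((T.glue i v).injective h)
    have h1 := hface i v a b hab hav hbv
    have h2 := hface i v b a hab.symm hbv hav
    have h3 := faceCentre_add (N i) hab hav hbv
    have h4 := faceCentre_add (N (T.adj i v)) (hg hab) (hg hav) (hg hbv)
    dsimp only
    linarith

end EdgeShift

/-! ### The leaf map of one tetrahedron -/

section TetLeaf

open Set

theorem exists_partition_sum (θ : Fin 3) (a : Fin 4) : ∃ b c d : Fin 4, a ≠ b ∧ a ≠ c ∧ a ≠ d ∧ b ≠ c ∧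
    b ≠ d ∧ c ≠ d ∧ quadSide θ b = quadSide θ a ∧ quadSide θ c = !quadSide θ a ∧
    quadSide θ d = !quadSide θ a ∧ ∀ f : Fin 4 → ℝ, ∑ e, f e = f a + f b + f c + f d := by
  obtain ⟨b, c, d, h1, h2, h3, h4, h5, h6, hb, hc, hd⟩ := exists_partition θ a
  refine ⟨b, c, d, h1, h2, h3, h4, h5, h6, hb, hc, hd, fun f => ?_⟩
  have hu : ∀ a b c d : Fin 4, a ≠ b → a ≠ c → a ≠ d → b ≠ c → b ≠ d → c ≠ d →
      (Finset.univ : Finset (Fin 4)) = {a, b, c, d} := by decide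
  rw [hu a b c d h1 h2 h3 h4 h5 h6, Finset.sum_insert (by simp [h1, h2, h3]),
    Finset.sum_insert (by simp [h4, h5]), Finset.sum_pair h6]
  ring

/-- Prescribed values `t a b` at the midpoint of each edge `ab` of the Busemann function of the end
`b`. The condition says that `t a b` and `t b a` describe the same point of the line of the dual
spine joining the ends `a` and `b`. -/
def IsLevel (θ : Fin 3) (k : ℝ) (t : Fin 4 → Fin 4 → ℝ) : Prop :=
  ∀ a b, a ≠ b → t a b + t b a = -(if quadSide θ a = quadSide θ b then k else 0)

noncomputable section

variable (θ : Fin 3) (k : ℝ) (t : Fin 4 → Fin 4 → ℝ)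

/-- On the edge `ab` the ray towards the end `b` begins where `x b = edgeRatio a b * x a`. -/
def edgeRatio (a b : Fin 4) : ℝ := Real.exp (t a b + k / 2)

/-- The ray towards the end `b` begins at the plane `x b = rayBase b x`. -/
def rayBase (b : Fin 4) (x : Fin 4 → ℝ) : ℝ := ∑ a, if a = b then 0 else edgeRatio k t a b * x a

/-- The part of `rayBase` from the vertices on the other side of the quadrilateral. -/
def crossBase (b : Fin 4) (x : Fin 4 → ℝ) : ℝ :=
  ∑ a, if quadSide θ a = quadSide θ b then 0 else edgeRatio k t a b * x a

/-- The height on the ray towards the end `b`. -/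
def rayHeight (b : Fin 4) (x : Fin 4 → ℝ) : ℝ := Real.log (max 1 (x b / rayBase k t b x))

/-- The sum of the quotients `x b / crossBase b` over the two vertices on the side of `0`, each
truncated at `1` in order to be defined everywhere. -/
def crossRatio (x : Fin 4 → ℝ) : ℝ :=
  ∑ b, if quadSide θ b then x b / max (x b) (crossBase θ k t b x) else 0

/-- The distance on the interval from the end on the side of the vertex `0`. -/
def intervalHeight (x : Fin 4 → ℝ) : ℝ :=
  -Real.log (max (Real.exp (-k)) (min 1 (crossRatio θ k t x)))

/-- The leaf map. At most one of the four heights on the rays is non-zero, and then the height on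
the interval is the one of the end point of this ray. -/
def tetLeaf (x : Fin 4 → ℝ) (v : Fin 4) : ℝ :=
  spineInterval θ (intervalHeight θ k t x - k / 2) v +
    ∑ e, if e = v then -rayHeight k t e x else rayHeight k t e x

end

variable {θ : Fin 3} {k : ℝ} {t : Fin 4 → Fin 4 → ℝ}

theorem edgeRatio_pos (a b : Fin 4) : 0 < edgeRatio k t a b := Real.exp_pos _

theorem IsLevel.edgeRatio_mul (ht : IsLevel θ k t) {a b : Fin 4} (hab : a ≠ b) :
    edgeRatio k t a b * edgeRatio k t b a =
      if quadSide θ a = quadSide θ b then 1 else Real.exp k := by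
  rw [edgeRatio, edgeRatio, ← Real.exp_add]
  have := ht a b hab
  split_ifs with h
  · rw [if_pos h] at this
    rw [Real.exp_eq_one_iff]; linarith
  · rw [if_neg h] at this
    congr 1; linarith

theorem IsLevel.one_le_edgeRatio_mul (ht : IsLevel θ k t) (hk : 0 ≤ k) {a b : Fin 4} (hab : a ≠ b) :
    1 ≤ edgeRatio k t a b * edgeRatio k t b a := by
  rw [ht.edgeRatio_mul hab]
  split_ifs
  · exact le_rfl
  · exact Real.one_le_exp hk

theorem edgeRatio_mul_le_rayBase (x : IdealTet) {a b : Fin 4} (hab : a ≠ b) :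
    edgeRatio k t a b * x.1 a ≤ rayBase k t b x.1 := by
  have h := Finset.single_le_sum (f := fun a => if a = b then 0 else edgeRatio k t a b * x.1 a)
    (fun a _ => by
      split_ifs
      · exact le_rfl
      · exact mul_nonneg (edgeRatio_pos a b).le (x.nonneg a)) (Finset.mem_univ a)
  rwa [if_neg hab] at h

theorem edgeRatio_mul_le_crossBase (x : IdealTet) {a b : Fin 4} (hab : quadSide θ a ≠ quadSide θ b) :
    edgeRatio k t a b * x.1 a ≤ crossBase θ k t b x.1 := by
  have h := Finset.single_le_sum
    (f := fun a => if quadSide θ a = quadSide θ b then 0 else edgeRatio k t a b * x.1 a)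
    (fun a _ => by
      split_ifs
      · exact le_rfl
      · exact mul_nonneg (edgeRatio_pos a b).le (x.nonneg a)) (Finset.mem_univ a)
  rwa [if_neg hab] at h

theorem crossBase_nonneg (x : IdealTet) (b : Fin 4) : 0 ≤ crossBase θ k t b x.1 :=
  Finset.sum_nonneg fun a _ => by
    split_ifs
    · exact le_rfl
    · exact mul_nonneg (edgeRatio_pos a b).le (x.nonneg a)

theorem crossBase_le_rayBase (x : IdealTet) (b : Fin 4) :
    crossBase θ k t b x.1 ≤ rayBase k t b x.1 := by
  refine Finset.sum_le_sum fun a _ => ?_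
  have := mul_nonneg (edgeRatio_pos (k := k) (t := t) a b).le (x.nonneg a)
  by_cases hab : a = b
  · simp [hab]
  · rw [if_neg hab]
    split_ifs
    · exact this
    · exact le_rfl

theorem IdealTet.exists_pos_ne (x : IdealTet) (b : Fin 4) : ∃ a, a ≠ b ∧ 0 < x.1 a := by
  by_contra! h
  refine x.2.2 b ?_
  exact (Finset.sum_eq_single b (fun a _ ha => le_antisymm (h a ha) (x.nonneg a)) (by simp)).symm.trans
    x.sum_eq_one

theorem rayBase_pos (x : IdealTet) (b : Fin 4) : 0 < rayBase k t b x.1 := by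
  obtain ⟨a, ha, hxa⟩ := x.exists_pos_ne b
  exact (mul_pos (edgeRatio_pos a b) hxa).trans_le (edgeRatio_mul_le_rayBase x ha)

/-- The denominators in `crossRatio` are positive since the vertices are removed. -/
theorem max_crossBase_pos (x : IdealTet) (b : Fin 4) : 0 < max (x.1 b) (crossBase θ k t b x.1) := by
  obtain ⟨b', c, d, hbb', -, -, -, -, -, hb', -, -, -⟩ := exists_partition_sum θ b
  obtain ⟨a, ha, hxa⟩ := x.exists_pos_ne b'
  by_cases hab : quadSide θ a = quadSide θ b
  · have : a = b := by
      by_contra hne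
      have h : ∀ (θ : Fin 3) (a b b' : Fin 4), a ≠ b' → a ≠ b → b ≠ b' →
        quadSide θ a = quadSide θ b → quadSide θ b' = quadSide θ b → False := by decide
      exact h θ a b b' ha hne hbb' hab hb'
    exact lt_max_of_lt_left (this ▸ hxa)
  · exact lt_max_of_lt_right ((mul_pos (edgeRatio_pos a b) hxa).trans_le
      (edgeRatio_mul_le_crossBase x hab))

theorem continuous_rayBase (b : Fin 4) : Continuous fun x : IdealTet => rayBase k t b x.1 := by
  have h : ∀ a, Continuous fun x : IdealTet => x.1 a :=
    fun a => (continuous_apply a).comp continuous_subtype_val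
  refine continuous_finsetSum _ fun a _ => ?_
  split_ifs
  · exact continuous_const
  · exact continuous_const.mul (h a)

theorem continuous_crossBase (b : Fin 4) : Continuous fun x : IdealTet => crossBase θ k t b x.1 := by
  have h : ∀ a, Continuous fun x : IdealTet => x.1 a :=
    fun a => (continuous_apply a).comp continuous_subtype_val
  refine continuous_finsetSum _ fun a _ => ?_
  split_ifs
  · exact continuous_const
  · exact continuous_const.mul (h a)

theorem continuous_intervalHeight : Continuous fun x : IdealTet => intervalHeight θ k t x.1 := by
  have h : ∀ a, Continuous fun x : IdealTet => x.1 a :=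
    fun a => (continuous_apply a).comp continuous_subtype_val
  have hW : Continuous fun x : IdealTet => crossRatio θ k t x.1 := by
    refine continuous_finsetSum _ fun b _ => ?_
    split_ifs
    · exact (h b).div ((h b).max (continuous_crossBase b)) fun x => (max_crossBase_pos x b).ne'
    · exact continuous_const
  exact ((continuous_const.max (continuous_const.min hW)).log fun x =>
    (lt_max_of_lt_left (Real.exp_pos _)).ne').neg

theorem continuous_rayHeight (b : Fin 4) : Continuous fun x : IdealTet => rayHeight k t b x.1 := by
  have h : Continuous fun x : IdealTet => x.1 b :=
    (continuous_apply b).comp continuous_subtype_val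
  exact (continuous_const.max (h.div (continuous_rayBase b) fun x => (rayBase_pos x b).ne')).log
    fun x => (lt_max_of_lt_left one_pos).ne'

theorem continuous_tetLeaf : Continuous fun x : IdealTet => tetLeaf θ k t x.1 := by
  refine continuous_pi fun v => ?_
  have h := continuous_intervalHeight (θ := θ) (k := k) (t := t)
  refine Continuous.add ?_ (continuous_finsetSum _ fun e _ => ?_)
  · simp only [spineInterval]
    split_ifs
    · exact h.sub continuous_const
    · exact (h.sub continuous_const).neg
  · split_ifs
    · exact (continuous_rayHeight e).neg
    · exact continuous_rayHeight e

theorem rayHeight_of_le {x : IdealTet} {b : Fin 4} (h : x.1 b ≤ rayBase k t b x.1) :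
    rayHeight k t b x.1 = 0 := by
  rw [rayHeight, max_eq_left ((div_le_one (rayBase_pos x b)).2 h), Real.log_one]

theorem rayHeight_of_ge {x : IdealTet} {b : Fin 4} (h : rayBase k t b x.1 ≤ x.1 b) :
    rayHeight k t b x.1 = Real.log (x.1 b / rayBase k t b x.1) := by
  rw [rayHeight, max_eq_right ((one_le_div (rayBase_pos x b)).2 h)]

/-- The rays have disjoint preimages. -/
theorem IsLevel.le_rayBase_of_lt (ht : IsLevel θ k t) (hk : 0 ≤ k) {x : IdealTet} {b b' : Fin 4}
    (hb : b' ≠ b) (h : rayBase k t b x.1 < x.1 b) : x.1 b' ≤ rayBase k t b' x.1 := by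
  have h1 := edgeRatio_mul_le_rayBase (k := k) (t := t) x hb
  have h2 := edgeRatio_mul_le_rayBase (k := k) (t := t) x hb.symm
  have h3 := ht.one_le_edgeRatio_mul hk hb.symm
  have h4 := edgeRatio_pos (k := k) (t := t) b b'
  have h5 := x.nonneg b'
  nlinarith

theorem intervalHeight_nonneg (hk : 0 ≤ k) (x : Fin 4 → ℝ) : 0 ≤ intervalHeight θ k t x := by
  rw [intervalHeight, neg_nonneg]
  refine Real.log_nonpos (le_max_of_le_left (Real.exp_pos _).le) (max_le ?_ (min_le_left _ _))
  rw [Real.exp_le_one_iff]; linarith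

theorem intervalHeight_le (x : Fin 4 → ℝ) : intervalHeight θ k t x ≤ k := by
  rw [intervalHeight, neg_le, ← Real.log_exp (-k)]
  refine Real.log_le_log (Real.exp_pos _) ?_
  rw [Real.log_exp]; exact le_max_left _ _

theorem intervalHeight_anti {x y : Fin 4 → ℝ} (h : crossRatio θ k t x ≤ crossRatio θ k t y) :
    intervalHeight θ k t y ≤ intervalHeight θ k t x := by
  rw [intervalHeight, intervalHeight, neg_le_neg_iff]
  exact Real.log_le_log (lt_max_of_lt_left (Real.exp_pos _)) (max_le_max le_rfl (min_le_min le_rfl h))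

theorem intervalHeight_of_one_le (hk : 0 ≤ k) {x : Fin 4 → ℝ} (h : 1 ≤ crossRatio θ k t x) :
    intervalHeight θ k t x = 0 := by
  rw [intervalHeight, min_eq_left h, max_eq_right, Real.log_one, neg_zero]
  rw [Real.exp_le_one_iff]; linarith

theorem intervalHeight_of_le {x : Fin 4 → ℝ} (h : crossRatio θ k t x ≤ Real.exp (-k)) :
    intervalHeight θ k t x = k := by
  rw [intervalHeight, max_eq_left ((min_le_right _ _).trans h), Real.log_exp, neg_neg]

theorem crossRatio_of_intervalHeight {x : Fin 4 → ℝ} (h0 : 0 < intervalHeight θ k t x)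
    (h1 : intervalHeight θ k t x < k) :
    crossRatio θ k t x = Real.exp (-intervalHeight θ k t x) := by
  have hpos : 0 < max (Real.exp (-k)) (min 1 (crossRatio θ k t x)) :=
    lt_max_of_lt_left (Real.exp_pos _)
  have h2 : Real.exp (-intervalHeight θ k t x) = max (Real.exp (-k)) (min 1 (crossRatio θ k t x)) := by
    rw [intervalHeight, neg_neg, Real.exp_log hpos]
  have h3 : Real.exp (-k) < Real.exp (-intervalHeight θ k t x) := Real.exp_lt_exp.2 (by linarith)
  have h4 : Real.exp (-intervalHeight θ k t x) < 1 := by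
    rw [← Real.exp_zero]; exact Real.exp_lt_exp.2 (by linarith)
  rw [h2] at h3 h4 ⊢
  rcases lt_max_iff.1 h3 with h | h
  · exact absurd h (lt_irrefl _)
  · rw [max_eq_right h.le] at h4 ⊢
    rcases min_lt_iff.1 h4 with h' | h'
    · exact absurd h' (lt_irrefl _)
    · exact (min_eq_right h'.le).symm

theorem intervalHeight_of_crossRatio {x : Fin 4 → ℝ} {j : ℝ} (h0 : 0 ≤ j) (h1 : j ≤ k)
    (h : crossRatio θ k t x = Real.exp (-j)) : intervalHeight θ k t x = j := by
  rw [intervalHeight, h, min_eq_right (Real.exp_le_one_iff.2 (by linarith)),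
    max_eq_right (Real.exp_le_exp.2 (by linarith)), Real.log_exp, neg_neg]

theorem crossRatio_term_nonneg (x : IdealTet) (b : Fin 4) :
    0 ≤ if quadSide θ b then x.1 b / max (x.1 b) (crossBase θ k t b x.1) else 0 := by
  split_ifs
  · exact div_nonneg (x.nonneg b) (max_crossBase_pos x b).le
  · exact le_rfl

theorem one_le_crossRatio {x : IdealTet} {b : Fin 4} (hb : quadSide θ b = true) (h0 : 0 < x.1 b)
    (h : crossBase θ k t b x.1 ≤ x.1 b) : 1 ≤ crossRatio θ k t x.1 := by
  have h1 := Finset.single_le_sum (fun b _ => crossRatio_term_nonneg (θ := θ) (k := k) (t := t) x b)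
    (Finset.mem_univ b)
  rwa [if_pos hb, max_eq_left h, div_self h0.ne'] at h1

theorem IsLevel.crossRatio_le (ht : IsLevel θ k t) {x : IdealTet} {b : Fin 4}
    (hb : quadSide θ b = false) (h : rayBase k t b x.1 < x.1 b) :
    crossRatio θ k t x.1 ≤ Real.exp (-k) := by
  have hxb : 0 < x.1 b := (rayBase_pos x b).trans h
  have h1 : crossRatio θ k t x.1 ≤ Real.exp (-k) / x.1 b * crossBase θ k t b x.1 := by
    rw [crossRatio, crossBase, Finset.mul_sum]
    refine Finset.sum_le_sum fun a _ => ?_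
    by_cases ha : quadSide θ a = true
    · have hne : quadSide θ a ≠ quadSide θ b := by rw [ha, hb]; decide
      have hab : a ≠ b := fun h => hne (congrArg _ h)
      rw [if_pos ha, if_neg hne]
      have hE := ht.edgeRatio_mul hab
      rw [if_neg hne] at hE
      have h2 := edgeRatio_mul_le_crossBase (k := k) (t := t) x hne.symm
      have h3 := mul_pos (edgeRatio_pos (k := k) (t := t) b a) hxb
      refine (div_le_div_of_nonneg_left (x.nonneg a) h3 (h2.trans (le_max_right _ _))).trans
        (le_of_eq ?_)
      rw [Real.exp_neg, ← hE]
      have := edgeRatio_pos (k := k) (t := t) b a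
      have := edgeRatio_pos (k := k) (t := t) a b
      field_simp
    · rw [if_neg ha, if_pos (by rw [hb]; simpa using ha), mul_zero]
  refine h1.trans ?_
  rw [div_mul_eq_mul_div, div_le_iff₀ hxb]
  exact mul_le_mul_of_nonneg_left ((crossBase_le_rayBase x b).trans h.le) (Real.exp_pos _).le

/-- On the preimage of a ray the height on the interval is that of the origin of the ray. -/
theorem IsLevel.intervalHeight_of_lt (ht : IsLevel θ k t) (hk : 0 ≤ k) {x : IdealTet} {b : Fin 4}
    (h : rayBase k t b x.1 < x.1 b) :
    intervalHeight θ k t x.1 = if quadSide θ b then 0 else k := by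
  split_ifs with hb
  · exact intervalHeight_of_one_le hk (one_le_crossRatio hb ((rayBase_pos x b).trans h)
      ((crossBase_le_rayBase x b).trans h.le))
  · exact intervalHeight_of_le (ht.crossRatio_le (by simpa using hb) h)

theorem tetLeaf_of_le {x : IdealTet} (h : ∀ b, x.1 b ≤ rayBase k t b x.1) :
    tetLeaf θ k t x.1 = spineInterval θ (intervalHeight θ k t x.1 - k / 2) := by
  ext v
  simp [tetLeaf, rayHeight_of_le (h _)]

theorem IsLevel.tetLeaf_of_lt (ht : IsLevel θ k t) (hk : 0 ≤ k) {x : IdealTet} {b : Fin 4}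
    (h : rayBase k t b x.1 < x.1 b) :
    tetLeaf θ k t x.1 = spineRay (Pi.single θ k) b (Real.log (x.1 b / rayBase k t b x.1)) := by
  rw [spineRay_single]
  ext v
  have h0 : ∀ e, e ≠ b → rayHeight k t e x.1 = 0 :=
    fun e he => rayHeight_of_le (ht.le_rayBase_of_lt hk he h)
  rw [tetLeaf, Finset.sum_eq_single b (fun e _ he => by simp [h0 e he]) (by simp),
    rayHeight_of_ge h.le, ht.intervalHeight_of_lt hk h, spineInterval]
  by_cases hv : v = b
  · subst hv
    cases hs : quadSide θ v <;> simp <;> ring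
  · cases hs : quadSide θ v <;> cases hs' : quadSide θ b <;> simp [hv, Ne.symm hv] <;> ring

/-- A point of the tetrahedron is mapped to a ray or to the interval. -/
theorem IsLevel.tetLeaf_cases (ht : IsLevel θ k t) (hk : 0 ≤ k) (x : IdealTet) :
    (∃ b h, 0 < h ∧ 0 < x.1 b ∧ x.1 b = Real.exp h * rayBase k t b x.1 ∧
      tetLeaf θ k t x.1 = spineRay (Pi.single θ k) b h) ∨
    ((∀ b, x.1 b ≤ rayBase k t b x.1) ∧ |intervalHeight θ k t x.1 - k / 2| ≤ k / 2 ∧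
      tetLeaf θ k t x.1 = spineInterval θ (intervalHeight θ k t x.1 - k / 2)) := by
  by_cases h : ∃ b, rayBase k t b x.1 < x.1 b
  · left
    obtain ⟨b, hb⟩ := h
    have hD := rayBase_pos (k := k) (t := t) x b
    have h1 : 1 < x.1 b / rayBase k t b x.1 := (one_lt_div hD).2 hb
    refine ⟨b, _, Real.log_pos h1, hD.trans hb, ?_, ht.tetLeaf_of_lt hk hb⟩
    rw [Real.exp_log (by linarith), div_mul_cancel₀ _ hD.ne']
  · right
    push Not at h
    refine ⟨h, ?_, tetLeaf_of_le h⟩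
    have h1 := intervalHeight_nonneg (θ := θ) (t := t) hk x.1
    have h2 := intervalHeight_le (θ := θ) (k := k) (t := t) x.1
    rw [abs_le]; constructor <;> linarith

end TetLeaf

/-! ### The leaf map on faces and edges -/

section FaceLeaf

open Set

/-- The leg of a tripod made of the interval, traversed towards the side of the vertex `0`, and a
ray: the distance from the centre is the height on the ray plus the distance travelled on the
interval. Here `y` is the quotient `x b / rayBase b` for the end `b` of the leg. -/
theorem log_max_exp_mul {k y : ℝ} (hk : 0 ≤ k) (hy : 0 ≤ y) :
    Real.log (max 1 (Real.exp k * y)) =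
      Real.log (max 1 y) + k + Real.log (max (Real.exp (-k)) (min 1 (y / max y 1))) := by
  have h1 : 1 ≤ Real.exp k := Real.one_le_exp hk
  have h2 : Real.exp (-k) ≤ 1 := Real.exp_le_one_iff.2 (by linarith)
  rcases le_total 1 y with h | h
  · rw [max_eq_right h, max_eq_left h, div_self (by linarith), min_self, max_eq_right h2,
      Real.log_one, max_eq_right (by nlinarith), Real.log_mul (by positivity) (by linarith),
      Real.log_exp]
    ring
  · rw [max_eq_left h, max_eq_right h, div_one, min_eq_right h, Real.log_one, zero_add,
      ← Real.log_exp k, ← Real.log_mul (by positivity) (lt_max_of_lt_left (Real.exp_pos _)).ne',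
      Real.log_exp, mul_max_of_nonneg _ _ (by positivity), ← Real.exp_add, add_neg_cancel,
      Real.exp_zero]

/-- The counterpart of `log_max_exp_mul` for the interval traversed away from the side of the
vertex `0`. -/
theorem log_max_exp_mul_div {k X α β : ℝ} (hk : 0 ≤ k) (hX : 0 ≤ X) (hα : 0 ≤ α) (hβ : 0 ≤ β)
    (hD : 0 < α + β) :
    Real.log (max 1 (Real.exp k * X / (α + β))) = Real.log (max 1 (X / (α + β))) -
      Real.log (max (Real.exp (-k))
        (min 1 (α / max α (Real.exp k * X) + β / max β (Real.exp k * X)))) := by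
  have h1 : 1 ≤ Real.exp k := Real.one_le_exp hk
  have h2 : Real.exp (-k) ≤ 1 := Real.exp_le_one_iff.2 (by linarith)
  have hXY : X ≤ Real.exp k * X := by nlinarith
  have hee : Real.exp (-k) * Real.exp k = 1 := by rw [← Real.exp_add]; simp
  set Y := Real.exp k * X with hY
  have hY0 : 0 ≤ Y := hX.trans hXY
  have hbig : Y ≤ α + β → 1 ≤ α / max α Y + β / max β Y → Real.log (max 1 (Y / (α + β))) =
      Real.log (max 1 (X / (α + β))) -
      Real.log (max (Real.exp (-k)) (min 1 (α / max α Y + β / max β Y))) := by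
    intro h3 h4
    rw [min_eq_left h4, max_eq_right h2, max_eq_left ((div_le_one hD).2 h3),
      max_eq_left ((div_le_one hD).2 (hXY.trans h3))]
    simp
  by_cases ha : Y ≤ α ∧ 0 < α
  · refine hbig (by linarith) ?_
    rw [max_eq_left ha.1, div_self ha.2.ne']
    linarith [div_nonneg hβ (hβ.trans (le_max_left β Y))]
  by_cases hb : Y ≤ β ∧ 0 < β
  · refine hbig (by linarith) ?_
    rw [max_eq_left hb.1, div_self hb.2.ne']
    linarith [div_nonneg hα (hα.trans (le_max_left α Y))]
  have hYpos : 0 < Y := by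
    rcases hY0.eq_or_lt with h | h
    · rcases hα.eq_or_lt with h' | h'
      · exact absurd ⟨by linarith, by linarith⟩ hb
      · exact absurd ⟨by linarith, h'⟩ ha
    · exact h
  have ha' : α < Y := by
    by_contra! h; exact ha ⟨h, by linarith⟩
  have hb' : β < Y := by
    by_contra! h; exact hb ⟨h, by linarith⟩
  rw [max_eq_right ha'.le, max_eq_right hb'.le, ← add_div]
  rcases le_total Y (α + β) with h | h
  · rw [min_eq_left ((one_le_div hYpos).2 h), max_eq_right h2, max_eq_left ((div_le_one hD).2 h),
      max_eq_left ((div_le_one hD).2 (hXY.trans h))]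
    simp
  · rw [min_eq_right ((div_le_one hYpos).2 h), max_eq_right ((one_le_div hD).2 h)]
    have hXpos : 0 < X := by
      by_contra! h0
      have : X = 0 := le_antisymm h0 hX
      rw [hY, this, mul_zero] at hYpos
      exact lt_irrefl _ hYpos
    have hXe : X = Real.exp (-k) * Y := by rw [hY, ← mul_assoc, hee, one_mul]
    rcases le_total (α + β) X with h' | h'
    · rw [max_eq_right ((one_le_div hD).2 h'), max_eq_left, hY, mul_div_assoc,
        Real.log_mul (by positivity) (by positivity), Real.log_exp, Real.log_exp]
      · ring
      · rw [div_le_iff₀ hYpos, ← hXe]; exact h'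
    · rw [max_eq_left ((div_le_one hD).2 h'), max_eq_right, Real.log_one,
        Real.log_div hYpos.ne' hD.ne', Real.log_div hD.ne' hYpos.ne']
      · ring
      · rw [le_div_iff₀ hYpos, ← hXe]; exact h'

/-- The distance from the centre on the leg towards `e` of the tripod of the face opposite `v`,
where the levels `m` are normalised at the centre. -/
noncomputable def faceLeg (m : Fin 4 → Fin 4 → ℝ) (v e : Fin 4) (x : Fin 4 → ℝ) : ℝ :=
  Real.log (max 1 (x e / ∑ e', if e' = e ∨ e' = v then 0 else Real.exp (m e' e) * x e'))

variable {θ : Fin 3} {k : ℝ} {t : Fin 4 → Fin 4 → ℝ}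

theorem faceCentre_single {v e : Fin 4} (h : e ≠ v) :
    faceCentre (Pi.single θ k) v e = (if quadSide θ e = quadSide θ v then k else 0) - k / 2 := by
  rw [faceCentre_apply _ h, quad_comm, single_quad h]
  simp

/-- The leg consists of the ray, preceded by the interval for the vertex on the same side as `v`. -/
theorem IsLevel.faceLeg_eq (ht : IsLevel θ k t) (hk : 0 ≤ k) {x : IdealTet} {v e : Fin 4}
    (hx : x.1 v = 0) (hev : e ≠ v) :
    faceLeg (fun a b => t a b - faceCentre (Pi.single θ k) v b) v e x.1 = rayHeight k t e x.1 +
      if quadSide θ e = quadSide θ v then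
        (if quadSide θ v then k - intervalHeight θ k t x.1 else intervalHeight θ k t x.1) else 0 := by
  have hD := rayBase_pos (k := k) (t := t) x e
  have hden : (∑ e', if e' = e ∨ e' = v then 0 else
      Real.exp (t e' e - faceCentre (Pi.single θ k) v e) * x.1 e') =
      Real.exp (-(if quadSide θ e = quadSide θ v then k else 0)) * rayBase k t e x.1 := by
    rw [rayBase, Finset.mul_sum]
    refine Finset.sum_congr rfl fun e' _ => ?_
    by_cases h1 : e' = e
    · simp [h1]
    by_cases h2 : e' = v
    · simp [h2, hx]
    · rw [if_neg (by simp [h1, h2]), if_neg h1, edgeRatio, ← mul_assoc, ← Real.exp_add,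
        faceCentre_single hev]
      congr 2; ring
  simp only [faceLeg]
  rw [hden]
  by_cases hs : quadSide θ e = quadSide θ v
  swap
  · rw [if_neg hs, if_neg hs, neg_zero, Real.exp_zero, one_mul, add_zero]; rfl
  rw [if_pos hs, if_pos hs]
  have hdiv : x.1 e / (Real.exp (-k) * rayBase k t e x.1) =
      Real.exp k * (x.1 e / rayBase k t e x.1) := by
    rw [Real.exp_neg]; field_simp
  rw [hdiv]
  obtain ⟨b, c, d, hvb, hvc, hvd, hbc, hbd, hcd, hb, hc, hd, hsum⟩ := exists_partition_sum θ v
  have heb : e = b := by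
    have h : ∀ (θ : Fin 3) (v b e : Fin 4), v ≠ b → e ≠ v → quadSide θ b = quadSide θ v →
      quadSide θ e = quadSide θ v → e = b := by decide
    exact h θ v b e hvb hev hb hs
  subst heb
  cases hv : quadSide θ v
  · -- the two other vertices are on the side of `0`
    rw [hv] at hb hc hd
    simp only [Bool.not_false] at hc hd
    have hec := ht.edgeRatio_mul hbc.symm
    have hed := ht.edgeRatio_mul hbd.symm
    rw [if_neg (by rw [hb, hc]; decide)] at hec
    rw [if_neg (by rw [hb, hd]; decide)] at hed
    have hrb : rayBase k t e x.1 = edgeRatio k t c e * x.1 c + edgeRatio k t d e * x.1 d := by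
      rw [rayBase, hsum]
      simp [hvb, hbc.symm, hbd.symm, hx]
    have hpc : crossBase θ k t c x.1 = edgeRatio k t e c * x.1 e := by
      rw [crossBase, hsum]
      simp [hv, hb, hc, hd, hx]
    have hpd : crossBase θ k t d x.1 = edgeRatio k t e d * x.1 e := by
      rw [crossBase, hsum]
      simp [hv, hb, hc, hd, hx]
    have hterm : ∀ u E E' X : ℝ, 0 < E → E * E' = Real.exp k →
        u / max u (E' * X) = E * u / max (E * u) (Real.exp k * X) := by
      intro u E E' X hE hEE
      rw [← hEE, mul_assoc, ← mul_max_of_nonneg _ _ hE.le, mul_div_mul_left _ _ hE.ne']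
    have hW : crossRatio θ k t x.1 = edgeRatio k t c e * x.1 c /
        max (edgeRatio k t c e * x.1 c) (Real.exp k * x.1 e) + edgeRatio k t d e * x.1 d /
        max (edgeRatio k t d e * x.1 d) (Real.exp k * x.1 e) := by
      rw [crossRatio, hsum]
      simp only [hv, hb, hc, hd, if_true, Bool.false_eq_true, if_false, zero_add, hpc, hpd]
      rw [hterm _ _ _ _ (edgeRatio_pos c e) hec, hterm _ _ _ _ (edgeRatio_pos d e) hed]
    simp only [Bool.false_eq_true, if_false]
    rw [rayHeight, intervalHeight, hW, ← mul_div_assoc, hrb, log_max_exp_mul_div hk (x.nonneg e)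
      (mul_nonneg (edgeRatio_pos c e).le (x.nonneg c))
      (mul_nonneg (edgeRatio_pos d e).le (x.nonneg d)) (hrb ▸ hD)]
    ring
  · rw [hv] at hb hc hd
    simp only [Bool.not_true] at hc hd
    have hrb : crossBase θ k t e x.1 = rayBase k t e x.1 := by
      rw [rayBase, crossBase, hsum, hsum]
      simp [hv, hb, hc, hd, hvb, hbc.symm, hbd.symm, hx]
    have hW : crossRatio θ k t x.1 =
        x.1 e / rayBase k t e x.1 / max (x.1 e / rayBase k t e x.1) 1 := by
      rw [crossRatio, hsum]
      simp only [hv, hb, hc, hd, if_true, Bool.false_eq_true, if_false, hx, zero_div, zero_add,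
        add_zero, hrb]
      have h : ∀ u D : ℝ, 0 < D → u / max u D = u / D / max (u / D) 1 := fun u D hD => by
        conv_rhs => rw [← div_self hD.ne']
        rw [max_div_div_right hD.le, div_div_div_cancel_right₀ hD.ne']
      exact h _ _ hD
    simp only [if_true]
    rw [rayHeight, intervalHeight, hW, log_max_exp_mul hk (div_nonneg (x.nonneg e) hD.le)]
    ring

/-- On a face, the leaf map relative to the centre of the tripod only depends on the normalised
levels of the three edges of this face. -/
theorem IsLevel.tetLeaf_face (ht : IsLevel θ k t) (hk : 0 ≤ k) {x : IdealTet} {v w : Fin 4}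
    (hx : x.1 v = 0) (hwv : w ≠ v) :
    tetLeaf θ k t x.1 w - faceCentre (Pi.single θ k) v w = ∑ e, if e = v then 0 else
      if e = w then -faceLeg (fun a b => t a b - faceCentre (Pi.single θ k) v b) v e x.1
      else faceLeg (fun a b => t a b - faceCentre (Pi.single θ k) v b) v e x.1 := by
  have hv0 : rayHeight k t v x.1 = 0 := by simp [rayHeight, hx]
  obtain ⟨b, c, d, hvb, hvc, hvd, hbc, hbd, hcd, hb, hc, hd, hsum⟩ := exists_partition_sum θ v
  have hlb := ht.faceLeg_eq hk hx hvb.symm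
  have hlc := ht.faceLeg_eq hk hx hvc.symm
  have hld := ht.faceLeg_eq hk hx hvd.symm
  rw [if_pos hb] at hlb
  rw [if_neg (by rw [hc]; simp)] at hlc
  rw [if_neg (by rw [hd]; simp)] at hld
  rw [tetLeaf, hsum, hsum, hlb, hlc, hld, hv0, faceCentre_single hwv]
  simp only [if_true, if_neg hvb.symm, if_neg hvc.symm, if_neg hvd.symm, spineInterval]
  have hw : w = b ∨ w = c ∨ w = d := by
    have h : ∀ v b c d w : Fin 4, v ≠ b → v ≠ c → v ≠ d → b ≠ c → b ≠ d → c ≠ d → w ≠ v →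
      w = b ∨ w = c ∨ w = d := by decide
    exact h v b c d w hvb hvc hvd hbc hbd hcd hwv
  rcases hw with rfl | rfl | rfl
  · rw [hb]
    cases hv : quadSide θ v <;> simp [hbc.symm, hbd.symm] <;> ring
  · rw [hc]
    cases hv : quadSide θ v <;> simp [hbc, hcd.symm] <;> ring
  · rw [hd]
    cases hv : quadSide θ v <;> simp [hbd, hcd] <;> ring

/-- On an edge the leaf map is logarithmic in the ratio of the barycentric coordinates. -/
theorem IsLevel.tetLeaf_edge (ht : IsLevel θ k t) (hk : 0 ≤ k) {a b : Fin 4} (hab : a ≠ b)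
    {x : IdealTet} (hx : x ∈ openEdge a b) (ha : 0 < x.1 a) (hb : 0 < x.1 b) :
    tetLeaf θ k t x.1 b = t a b - Real.log (x.1 b / x.1 a) := by
  obtain ⟨c, d, hca, hcb, hda, hdb, hcd, hsum⟩ : ∃ c d : Fin 4, c ≠ a ∧ c ≠ b ∧ d ≠ a ∧ d ≠ b ∧
      c ≠ d ∧ ∀ f : Fin 4 → ℝ, ∑ e, f e = f a + f b + f c + f d := by
    obtain ⟨c, d, h⟩ : ∃ c d : Fin 4, c ≠ a ∧ c ≠ b ∧ d ≠ a ∧ d ≠ b ∧ c ≠ d ∧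
        (Finset.univ : Finset (Fin 4)) = {a, b, c, d} := by
      clear hx ha hb
      revert a b; decide
    obtain ⟨h1, h2, h3, h4, h5, hu⟩ := h
    refine ⟨c, d, h1, h2, h3, h4, h5, fun f => ?_⟩
    rw [hu, Finset.sum_insert (by simp [hab, h1.symm, h3.symm]),
      Finset.sum_insert (by simp [h2.symm, h4.symm]), Finset.sum_pair h5]
    ring
  have hc0 := hx c hca hcb
  have hd0 := hx d hda hdb
  have h := ht.tetLeaf_face hk hc0 hcb.symm
  set m : Fin 4 → Fin 4 → ℝ := fun a b => t a b - faceCentre (Pi.single θ k) c b with hm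
  have hmab : m b a = -m a b := by
    have h1 := ht a b hab
    have h2 := faceCentre_add (Pi.single θ k) hab hca.symm hcb.symm
    rw [single_quad hab] at h2
    simp only [hm]
    linarith
  have e1 : faceLeg m c d x.1 = 0 := by simp [faceLeg, hd0]
  have e2 : faceLeg m c b x.1 = Real.log (max 1 (x.1 b / (Real.exp (m a b) * x.1 a))) := by
    rw [faceLeg, hsum]
    simp [hab, hca.symm, hdb, hcd.symm, hd0]
  have e3 : faceLeg m c a x.1 = Real.log (max 1 (x.1 a / (Real.exp (m b a) * x.1 b))) := by
    rw [faceLeg, hsum]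
    simp [hab.symm, hcb.symm, hda, hcd.symm, hd0]
  rw [hsum, e1, e2, e3] at h
  simp only [if_neg hca.symm, if_neg hcb.symm, if_neg hcd.symm, if_neg hab, if_neg hdb, if_true,
    add_zero] at h
  set y := x.1 b / (Real.exp (m a b) * x.1 a) with hy
  have hypos : 0 < y := by positivity
  have hinv : x.1 a / (Real.exp (m b a) * x.1 b) = y⁻¹ := by
    rw [hmab, Real.exp_neg, hy]; field_simp
  have hlog : Real.log (max 1 y⁻¹) + -Real.log (max 1 y) = -Real.log y := by
    rcases le_total 1 y with h' | h'
    · rw [max_eq_right h', max_eq_left (inv_le_one_of_one_le₀ h')]; simp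
    · rw [max_eq_left h', max_eq_right (one_le_inv₀ hypos |>.2 h')]; simp
  rw [hinv, hlog] at h
  have hlogy : Real.log y = Real.log (x.1 b / x.1 a) - m a b := by
    rw [hy, mul_comm, ← div_div, Real.log_div (by positivity) (by positivity), Real.log_exp]
  rw [hlogy] at h
  simp only [hm] at h
  linarith

/-- An interior point of an edge with prescribed ratio of coordinates. -/
theorem exists_openEdge_ratio {a b : Fin 4} (hab : a ≠ b) {r : ℝ} (hr : 0 < r) :
    ∃ x ∈ openEdge a b, 0 < x.1 a ∧ x.1 b = r * x.1 a := by
  have h1 : 0 < 1 + r := by linarith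
  have hsum : ∑ e, (fun e => if e = a then 1 / (1 + r) else if e = b then r / (1 + r) else 0) e = 1 := by
    rw [← Finset.sum_subset (Finset.subset_univ {a, b}), Finset.sum_pair hab]
    · simp only [if_true, if_neg hab.symm]
      field_simp
    · intro e _ he
      simp only [Finset.mem_insert, Finset.mem_singleton, not_or] at he
      simp [he.1, he.2]
  refine ⟨⟨fun e => if e = a then 1 / (1 + r) else if e = b then r / (1 + r) else 0,
    ⟨fun e => ?_, hsum⟩, fun e => ?_⟩, fun e hea heb => by simp [hea, heb], ?_, ?_⟩
  · dsimp only; split_ifs <;> positivity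
  · dsimp only
    split_ifs
    · rw [Ne, div_eq_one_iff_eq h1.ne']; linarith
    · rw [Ne, div_eq_one_iff_eq h1.ne']; linarith
    · exact zero_ne_one
  · simp only [if_true]; positivity
  · simp only [if_true, if_neg hab.symm]; field_simp

theorem openEdge_pos {a b : Fin 4} {x : IdealTet} (hx : x ∈ openEdge a b) :
    0 < x.1 a ∧ 0 < x.1 b := by
  obtain ⟨c, hc, hc'⟩ := x.exists_pos_ne b
  obtain ⟨d, hd, hd'⟩ := x.exists_pos_ne a
  have h1 : c = a := by by_contra h; rw [hx c h hc] at hc'; exact lt_irrefl _ hc'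
  have h2 : d = b := by by_contra h; rw [hx d hd h] at hd'; exact lt_irrefl _ hd'
  exact ⟨h1 ▸ hc', h2 ▸ hd'⟩

theorem IsLevel.tetLeaf_mem_faceSpine (ht : IsLevel θ k t) (hk : 0 ≤ k) {x : IdealTet} {v : Fin 4}
    (hx : x.1 v = 0) : tetLeaf θ k t x.1 ∈ faceSpine (Pi.single θ k) v := by
  rcases ht.tetLeaf_cases hk x with ⟨b, h, hh, hb, -, he⟩ | ⟨-, hs, he⟩
  · have hbv : b ≠ v := fun h => by rw [h, hx] at hb; exact lt_irrefl _ hb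
    obtain ⟨a, ha1, ha2⟩ : ∃ a : Fin 4, a ≠ b ∧ a ≠ v := by
      have h : ∀ b v : Fin 4, ∃ a, a ≠ b ∧ a ≠ v := by decide
      exact h b v
    rw [he]
    exact ⟨b, a, ha1.symm, hbv, ha2, Or.inl (Or.inl ⟨h, hh.le, rfl⟩)⟩
  · obtain ⟨b, c, d, hvb, hvc, -, hbc, -, -, hb, hc, -, -⟩ := exists_partition_sum θ v
    rw [he]
    exact ⟨b, c, hbc, hvb.symm, hvc.symm,
      Or.inl (Or.inr (spineInterval_mem_segment hs (by rw [hb, hc]; simp)))⟩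

theorem IsLevel.tetLeaf_mem_spine (ht : IsLevel θ k t) (hk : 0 ≤ k) (x : IdealTet) :
    tetLeaf θ k t x.1 ∈ spine (Pi.single θ k) := by
  obtain ⟨b, c, d, hvb, hvc, -, -, -, -, -, hc, -, -⟩ := exists_partition_sum θ 0
  rcases ht.tetLeaf_cases hk x with ⟨b, h, hh, hb, -, he⟩ | ⟨-, hs, he⟩
  · obtain ⟨a, ha⟩ := exists_ne b
    rw [he]
    exact ⟨b, a, ha.symm, Or.inl (Or.inl ⟨h, hh.le, rfl⟩)⟩
  · rw [he]
    exact ⟨0, c, hvc, Or.inl (Or.inr (spineInterval_mem_segment hs (by rw [hc]; simp)))⟩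

theorem IsLevel.tetLeaf_mem_spineLine (ht : IsLevel θ k t) (hk : 0 ≤ k) {a b : Fin 4}
    {x : IdealTet} (hx : x ∈ openEdge a b) :
    tetLeaf θ k t x.1 ∈ spineLine (Pi.single θ k) a b := by
  have hpos := openEdge_pos hx
  rcases ht.tetLeaf_cases hk x with ⟨e, h, hh, he, -, hf⟩ | ⟨-, hs, hf⟩
  · rw [hf]
    by_cases hea : e = a
    · exact Or.inl (Or.inl ⟨h, hh.le, by rw [hea]⟩)
    by_cases heb : e = b
    · exact Or.inr ⟨h, hh.le, by rw [heb]⟩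
    · rw [hx e hea heb] at he; exact absurd he (lt_irrefl _)
  · rw [hf]
    by_cases hside : quadSide θ a = quadSide θ b
    swap
    · exact Or.inl (Or.inr (spineInterval_mem_segment hs hside))
    -- on an edge not crossed by the quadrilateral the interval is mapped to one of its ends
    refine Or.inl (Or.inl ⟨0, by simp, ?_⟩)
    rw [spineRay_single_zero]
    congr 1
    have hcross : ∀ e, quadSide θ e ≠ quadSide θ a → x.1 e = 0 := fun e he =>
      hx e (fun h => he (h ▸ rfl)) (fun h => he (h ▸ hside.symm))
    cases ha : quadSide θ a
    · have hW : crossRatio θ k t x.1 = 0 := by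
        refine Finset.sum_eq_zero fun e _ => ?_
        split_ifs with he
        · rw [hcross e (by rw [he, ha]; decide), zero_div]
        · rfl
      rw [intervalHeight_of_le (by rw [hW]; exact (Real.exp_pos _).le)]
      simp; ring
    · have hP : crossBase θ k t a x.1 = 0 := by
        refine Finset.sum_eq_zero fun e _ => ?_
        split_ifs with he
        · rfl
        · rw [hcross e he, mul_zero]
      rw [intervalHeight_of_one_le hk (one_le_crossRatio ha hpos.1 (by rw [hP]; exact hpos.1.le))]
      simp

theorem IsLevel.tetLeaf_image_openEdge (ht : IsLevel θ k t) (hk : 0 ≤ k) {a b : Fin 4}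
    (hab : a ≠ b) : (fun x : IdealTet => tetLeaf θ k t x.1) '' openEdge a b =
      spineLine (Pi.single θ k) a b := by
  apply Subset.antisymm
  · rintro _ ⟨x, hx, rfl⟩
    exact ht.tetLeaf_mem_spineLine hk hx
  · intro f hf
    obtain ⟨x, hx, ha, hxb⟩ := exists_openEdge_ratio hab (Real.exp_pos (t a b - f b))
    refine ⟨x, hx, ?_⟩
    have hq := isSpineWeight_single (θ := θ) hk
    have h1 := (hq.mem_spineLine_iff hab).1 (ht.tetLeaf_mem_spineLine hk hx)
    have h2 := ht.tetLeaf_edge hk hab hx ha (openEdge_pos hx).2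
    rw [hxb, mul_div_cancel_right₀ _ ha.ne', Real.log_exp] at h2
    dsimp only
    rw [h1, (hq.mem_spineLine_iff hab).1 hf, h2]
    congr 1; ring

theorem IsLevel.tetLeaf_strict (ht : IsLevel θ k t) (hk : 0 ≤ k) {a b : Fin 4} (hab : a ≠ b)
    {x y : IdealTet} (hx : x ∈ openEdge a b) (hy : y ∈ openEdge a b) (h : x.1 b < y.1 b) :
    tetLeaf θ k t y.1 b < tetLeaf θ k t x.1 b := by
  obtain ⟨hxa, hxb⟩ := openEdge_pos hx
  obtain ⟨hya, hyb⟩ := openEdge_pos hy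
  have key : ∀ w ∈ openEdge a b, w.1 a = 1 - w.1 b := by
    intro w hw
    have hs := w.sum_eq_one
    rw [← Finset.sum_subset (Finset.subset_univ {a, b}), Finset.sum_pair hab] at hs
    · linarith
    · intro e _ he
      simp only [Finset.mem_insert, Finset.mem_singleton, not_or] at he
      exact hw e he.1 he.2
  rw [ht.tetLeaf_edge hk hab hx hxa hxb, ht.tetLeaf_edge hk hab hy hya hyb]
  have h1 := key x hx
  have h2 := key y hy
  have : Real.log (x.1 b / x.1 a) < Real.log (y.1 b / y.1 a) := by
    refine Real.log_lt_log (div_pos hxb hxa) ?_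
    rw [div_lt_div_iff₀ hxa hya]
    nlinarith
  linarith

end FaceLeaf

/-! ### The leaves of one tetrahedron are path-connected -/

section Fibres

open Set

theorem IdealTet.isPathConnected_of_segments {s K : Set IdealTet} (hK : IsPathConnected K)
    (hKs : K ⊆ s)
    (h : ∀ x ∈ s, ∃ y ∈ K, ∀ z : IdealTet, z.1 ∈ segment ℝ x.1 y.1 → z ∈ s) :
    IsPathConnected s := by
  have hjoin : ∀ x ∈ s, ∃ y ∈ K, JoinedIn s x y := fun x hx => by
    obtain ⟨y, hy, hxy⟩ := h x hx
    have hc : IsPathConnected {z : IdealTet | z.1 ∈ segment ℝ x.1 y.1} :=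
      IdealTet.isPathConnected_of_convex ⟨x, left_mem_segment ℝ _ _⟩ fun z hz w hw u hu =>
        (convex_segment x.1 y.1).segment_subset hz hw hu
    exact ⟨y, hy, (hc.joinedIn x (left_mem_segment ℝ _ _) y (right_mem_segment ℝ _ _)).mono hxy⟩
  refine isPathConnected_iff.2 ⟨hK.nonempty.mono hKs, fun x hx y hy => ?_⟩
  obtain ⟨x', hx', hxx⟩ := hjoin x hx
  obtain ⟨y', hy', hyy⟩ := hjoin y hy
  exact (hxx.trans ((hK.joinedIn x' hx' y' hy').mono hKs)).trans hyy.symm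

theorem div_max_le_div_max {u P u' P' : ℝ} (hu : 0 ≤ u) (hu' : 0 ≤ u') (hP : 0 < max u P)
    (hP' : 0 < max u' P') (h : u * P' ≤ u' * P) : u / max u P ≤ u' / max u' P' := by
  rw [div_le_div_iff₀ hP hP', mul_max_of_nonneg _ _ hu, mul_max_of_nonneg _ _ hu', mul_comm u u']
  exact max_le_max le_rfl h

variable {θ : Fin 3} {k : ℝ} {t : Fin 4 → Fin 4 → ℝ}

theorem rayBase_combo (b : Fin 4) (u v : ℝ) (x y : Fin 4 → ℝ) :
    rayBase k t b (u • x + v • y) = u * rayBase k t b x + v * rayBase k t b y := by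
  simp only [rayBase, Finset.mul_sum, ← Finset.sum_add_distrib]
  refine Finset.sum_congr rfl fun a _ => ?_
  split_ifs
  · ring
  · simp only [Pi.add_apply, Pi.smul_apply, smul_eq_mul]; ring

theorem crossBase_combo (b : Fin 4) (u v : ℝ) (x y : Fin 4 → ℝ) :
    crossBase θ k t b (u • x + v • y) = u * crossBase θ k t b x + v * crossBase θ k t b y := by
  simp only [crossBase, Finset.mul_sum, ← Finset.sum_add_distrib]
  refine Finset.sum_congr rfl fun a _ => ?_
  split_ifs
  · ring
  · simp only [Pi.add_apply, Pi.smul_apply, smul_eq_mul]; ring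

theorem crossRatio_mono {x y : IdealTet} (h : ∀ b, quadSide θ b = true →
    x.1 b * crossBase θ k t b y.1 ≤ y.1 b * crossBase θ k t b x.1) :
    crossRatio θ k t x.1 ≤ crossRatio θ k t y.1 := by
  refine Finset.sum_le_sum fun b _ => ?_
  split_ifs with hb
  · exact div_max_le_div_max (x.nonneg b) (y.nonneg b) (max_crossBase_pos x b)
      (max_crossBase_pos y b) (h b hb)
  · exact le_rfl

theorem neg_le_spineRay {a b : Fin 4} (hab : b ≠ a) {h : ℝ} (hk : 0 ≤ k) (hh : 0 ≤ h) :
    -(k / 2) ≤ spineRay (Pi.single θ k) a h b := by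
  rw [spineRay_single]
  dsimp only
  rw [if_neg hab]
  split_ifs <;> linarith

theorem spineRay_self (a : Fin 4) (h : ℝ) : spineRay (Pi.single θ k) a h a = -(k / 2 + h) := by
  rw [spineRay_single]; simp

theorem spineRay_ne_spineInterval {a : Fin 4} {h s : ℝ} (hh : 0 < h) (hs : |s| ≤ k / 2) :
    spineRay (Pi.single θ k) a h ≠ spineInterval θ s := by
  intro he
  have h1 := congrFun he a
  have hs' := abs_le.1 hs
  rw [spineRay_self, spineInterval] at h1
  split_ifs at h1 <;> linarith

theorem spineRay_inj {a a' : Fin 4} {h h' : ℝ} (hk : 0 ≤ k) (hh : 0 < h) (hh' : 0 < h')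
    (he : spineRay (Pi.single θ k) a h = spineRay (Pi.single θ k) a' h') : a = a' ∧ h = h' := by
  have h1 := congrFun he a
  rw [spineRay_self] at h1
  by_cases haa : a = a'
  · subst haa
    rw [spineRay_self] at h1
    exact ⟨rfl, by linarith⟩
  · have := neg_le_spineRay (θ := θ) haa hk hh'.le
    linarith

theorem spineInterval_inj {s s' : ℝ} (h : spineInterval θ s = spineInterval θ s') : s = s' := by
  have := congrFun h 0
  simpa [spineInterval, quadSide] using this

theorem IsLevel.tetLeaf_eq_spineRay_iff (ht : IsLevel θ k t) (hk : 0 ≤ k) {x : IdealTet}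
    {b : Fin 4} {h : ℝ} (hh : 0 < h) : tetLeaf θ k t x.1 = spineRay (Pi.single θ k) b h ↔
      x.1 b = Real.exp h * rayBase k t b x.1 := by
  have hD := rayBase_pos (k := k) (t := t) x b
  constructor
  · intro he
    rcases ht.tetLeaf_cases hk x with ⟨b', h', hh', -, hx, he'⟩ | ⟨-, hs, he'⟩
    · obtain ⟨rfl, rfl⟩ := spineRay_inj hk hh hh' (he.symm.trans he')
      exact hx
    · exact absurd (he.symm.trans he') (spineRay_ne_spineInterval hh hs)
  · intro hx
    have h1 : 1 < Real.exp h := Real.one_lt_exp_iff.2 hh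
    rw [ht.tetLeaf_of_lt hk (b := b) (by rw [hx]; nlinarith), hx, mul_div_cancel_right₀ _ hD.ne',
      Real.log_exp]

theorem IsLevel.tetLeaf_eq_spineInterval_iff (ht : IsLevel θ k t) (hk : 0 ≤ k) {x : IdealTet}
    {s : ℝ} (hs : |s| ≤ k / 2) : tetLeaf θ k t x.1 = spineInterval θ s ↔
      (∀ b, x.1 b ≤ rayBase k t b x.1) ∧ intervalHeight θ k t x.1 = s + k / 2 := by
  constructor
  · intro he
    rcases ht.tetLeaf_cases hk x with ⟨b', h', hh', -, hx, he'⟩ | ⟨hx, -, he'⟩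
    · exact absurd (he'.symm.trans he) (spineRay_ne_spineInterval hh' hs)
    · have := spineInterval_inj (he'.symm.trans he)
      exact ⟨hx, by linarith⟩
  · rintro ⟨hx, hJ⟩
    rw [tetLeaf_of_le hx, hJ]
    congr 1; ring

/-- The leaves over a point of a ray are the pieces of a plane cutting off a vertex. -/
theorem IsLevel.isPathConnected_ray (ht : IsLevel θ k t) (hk : 0 ≤ k) (b : Fin 4) {h : ℝ}
    (hh : 0 < h) :
    IsPathConnected ((fun x : IdealTet => tetLeaf θ k t x.1) ⁻¹' {spineRay (Pi.single θ k) b h}) := by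
  refine IdealTet.isPathConnected_of_convex ?_ ?_
  · obtain ⟨a, hab⟩ := exists_ne b
    have hf : spineRay (Pi.single θ k) b h ∈ spineLine (Pi.single θ k) a b :=
      Or.inr ⟨h, hh.le, rfl⟩
    rw [← ht.tetLeaf_image_openEdge hk hab] at hf
    obtain ⟨x, -, hx⟩ := hf
    exact ⟨x, hx⟩
  · rintro x hx y hy z ⟨u, v, -, -, -, hz⟩
    have hx := (ht.tetLeaf_eq_spineRay_iff hk hh).1 hx
    have hy := (ht.tetLeaf_eq_spineRay_iff hk hh).1 hy
    refine (ht.tetLeaf_eq_spineRay_iff hk hh).2 ?_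
    rw [← hz, rayBase_combo]
    simp only [Pi.add_apply, Pi.smul_apply, smul_eq_mul]
    rw [hx, hy]; ring

/-- The point on the edge joining two vertices on the same side of the quadrilateral from which the
two rays emanate. -/
theorem IsLevel.exists_edge_origin (ht : IsLevel θ k t) {a b : Fin 4} (hab : a ≠ b)
    (hs : quadSide θ a = quadSide θ b) :
    ∃ x ∈ openEdge a b, ∀ e, x.1 e ≤ rayBase k t e x.1 := by
  obtain ⟨x, hx, ha, hb⟩ := exists_openEdge_ratio hab (edgeRatio_pos (k := k) (t := t) a b)
  refine ⟨x, hx, fun e => ?_⟩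
  by_cases hea : e = a
  · subst hea
    have h1 := edgeRatio_mul_le_rayBase (k := k) (t := t) x hab.symm
    have h2 := ht.edgeRatio_mul hab.symm
    rw [if_pos hs.symm] at h2
    rw [hb, ← mul_assoc, h2, one_mul] at h1
    exact h1
  by_cases heb : e = b
  · subst heb
    rw [hb]
    exact edgeRatio_mul_le_rayBase x hab
  · rw [hx e hea heb]; exact (rayBase_pos x e).le

theorem IdealTet.le_rayBase_of_mem_segment {x y z : IdealTet}
    (hx : ∀ b, x.1 b ≤ rayBase k t b x.1) (hy : ∀ b, y.1 b ≤ rayBase k t b y.1)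
    (hz : z.1 ∈ segment ℝ x.1 y.1) (b : Fin 4) : z.1 b ≤ rayBase k t b z.1 := by
  obtain ⟨u, v, hu, hv, -, hz⟩ := hz
  rw [← hz, rayBase_combo]
  simp only [Pi.add_apply, Pi.smul_apply, smul_eq_mul]
  exact add_le_add (mul_le_mul_of_nonneg_left (hx b) hu) (mul_le_mul_of_nonneg_left (hy b) hv)

/-- The leaf over the end of the interval on the side of `0` is star-shaped. -/
theorem IsLevel.isPathConnected_left (ht : IsLevel θ k t) (hk : 0 ≤ k) :
    IsPathConnected ((fun x : IdealTet => tetLeaf θ k t x.1) ⁻¹' {spineInterval θ (-(k / 2))}) := by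
  have hs : |-(k / 2)| ≤ k / 2 := by rw [abs_neg, abs_of_nonneg (by linarith)]
  obtain ⟨b, c, d, h0b, h0c, h0d, hbc, hbd, hcd, hb, hc, hd, -⟩ := exists_partition_sum θ 0
  obtain ⟨y, hy, hyle⟩ := ht.exists_edge_origin h0b hb.symm
  have hP : ∀ e, quadSide θ e = true → crossBase θ k t e y.1 = 0 := by
    intro e he
    refine Finset.sum_eq_zero fun a _ => ?_
    split_ifs with hae
    · rfl
    · have ha0 : a ≠ 0 := fun h => hae (by rw [h, he]; simp [quadSide])
      have hab : a ≠ b := fun h => hae (by rw [h, he, hb]; simp [quadSide])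
      rw [hy a ha0 hab, mul_zero]
  have hmem : ∀ {x : IdealTet}, (∀ b, x.1 b ≤ rayBase k t b x.1) → intervalHeight θ k t x.1 = 0 →
      tetLeaf θ k t x.1 = spineInterval θ (-(k / 2)) := fun h h' =>
    (ht.tetLeaf_eq_spineInterval_iff hk hs).2 ⟨h, by rw [h']; ring⟩
  have h0 : quadSide θ 0 = true := by simp [quadSide]
  refine IdealTet.isPathConnected_of_segments (K := {y}) (isPathConnected_singleton y) ?_ fun x hx =>
    ⟨y, rfl, fun z hz => ?_⟩
  · rw [singleton_subset_iff]
    refine hmem hyle (intervalHeight_of_one_le hk (one_le_crossRatio h0 (openEdge_pos hy).1 ?_))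
    rw [hP 0 h0]; exact y.nonneg 0
  · obtain ⟨hxle, hJ⟩ := (ht.tetLeaf_eq_spineInterval_iff hk hs).1 hx
    refine hmem (IdealTet.le_rayBase_of_mem_segment hxle hyle hz) (le_antisymm ?_
      (intervalHeight_nonneg hk _))
    rw [neg_add_cancel] at hJ
    rw [← hJ]
    refine intervalHeight_anti (crossRatio_mono fun e he => ?_)
    obtain ⟨u, v, hu, hv, -, hz⟩ := hz
    rw [← hz, crossBase_combo, hP e he]
    simp only [Pi.add_apply, Pi.smul_apply, smul_eq_mul]
    have := mul_nonneg (mul_nonneg hv (y.nonneg e)) (crossBase_nonneg (θ := θ) (k := k) (t := t) x e)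
    nlinarith

/-- The leaf over the other end of the interval is star-shaped. -/
theorem IsLevel.isPathConnected_right (ht : IsLevel θ k t) (hk : 0 ≤ k) :
    IsPathConnected ((fun x : IdealTet => tetLeaf θ k t x.1) ⁻¹' {spineInterval θ (k / 2)}) := by
  have hs : |k / 2| ≤ k / 2 := by rw [abs_of_nonneg (by linarith)]
  obtain ⟨b, c, d, h0b, h0c, h0d, hbc, hbd, hcd, hb, hc, hd, -⟩ := exists_partition_sum θ 0
  have h0 : quadSide θ 0 = true := by simp [quadSide]
  rw [h0] at hc hd
  obtain ⟨y, hy, hyle⟩ := ht.exists_edge_origin hcd (hc.trans hd.symm)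
  have hy0 : ∀ e, quadSide θ e = true → y.1 e = 0 := fun e he =>
    hy e (fun h => by rw [h, hc] at he; exact absurd he (by decide))
      (fun h => by rw [h, hd] at he; exact absurd he (by decide))
  have hmem : ∀ {x : IdealTet}, (∀ b, x.1 b ≤ rayBase k t b x.1) → intervalHeight θ k t x.1 = k →
      tetLeaf θ k t x.1 = spineInterval θ (k / 2) := fun h h' =>
    (ht.tetLeaf_eq_spineInterval_iff hk hs).2 ⟨h, by rw [h']; ring⟩
  refine IdealTet.isPathConnected_of_segments (K := {y}) (isPathConnected_singleton y) ?_ fun x hx =>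
    ⟨y, rfl, fun z hz => ?_⟩
  · rw [singleton_subset_iff]
    refine hmem hyle (intervalHeight_of_le ?_)
    have hW : crossRatio θ k t y.1 = 0 := by
      refine Finset.sum_eq_zero fun e _ => ?_
      split_ifs with he
      · rw [hy0 e he, zero_div]
      · rfl
    rw [hW]; exact (Real.exp_pos _).le
  · obtain ⟨hxle, hJ⟩ := (ht.tetLeaf_eq_spineInterval_iff hk hs).1 hx
    refine hmem (IdealTet.le_rayBase_of_mem_segment hxle hyle hz) (le_antisymm
      (intervalHeight_le _) ?_)
    rw [add_halves] at hJ
    nth_rw 1 [← hJ]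
    refine intervalHeight_anti (crossRatio_mono fun e he => ?_)
    obtain ⟨u, v, hu, hv, -, hz⟩ := hz
    rw [← hz, crossBase_combo]
    simp only [Pi.add_apply, Pi.smul_apply, smul_eq_mul]
    rw [hy0 e he]
    have := mul_nonneg (mul_nonneg hv (x.nonneg e)) (crossBase_nonneg (θ := θ) (k := k) (t := t) y e)
    nlinarith

/-- The leaf over an interior point of the interval retracts linearly to its intersection with a
face. -/
theorem IsLevel.isPathConnected_interior (ht : IsLevel θ k t) (hk : 0 ≤ k) {s : ℝ}
    (h0 : 0 < s + k / 2) (h1 : s + k / 2 < k) :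
    IsPathConnected ((fun x : IdealTet => tetLeaf θ k t x.1) ⁻¹' {spineInterval θ s}) := by
  have hs : |s| ≤ k / 2 := abs_le.2 ⟨by linarith, by linarith⟩
  obtain ⟨b, c, d, hab, hac, had, hbc, hbd, hcd, hb, hc, hd, hsum⟩ := exists_partition_sum θ 0
  have ha : quadSide θ 0 = true := by simp [quadSide]
  rw [ha] at hb hc hd
  generalize (0 : Fin 4) = a at *
  set w := Real.exp (-(s + k / 2)) with hw
  have hw0 : 0 < w := Real.exp_pos _
  have hw1 : w < 1 := by rw [hw, ← Real.exp_zero]; exact Real.exp_lt_exp.2 (by linarith)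
  have hmem : ∀ {x : IdealTet}, tetLeaf θ k t x.1 = spineInterval θ s ↔ crossRatio θ k t x.1 = w := by
    intro x
    rw [ht.tetLeaf_eq_spineInterval_iff hk hs]
    constructor
    · rintro ⟨-, hJ⟩
      rw [crossRatio_of_intervalHeight (by rw [hJ]; exact h0) (by rw [hJ]; exact h1), hJ]
    · intro hW
      have hJ := intervalHeight_of_crossRatio h0.le h1.le hW
      refine ⟨fun e => ?_, hJ⟩
      by_contra! hlt
      have := ht.intervalHeight_of_lt hk hlt
      rw [hJ] at this
      split_ifs at this <;> linarith
  have hcross : ∀ e, quadSide θ e = true → ∀ x : Fin 4 → ℝ, crossBase θ k t e x =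
      edgeRatio k t c e * x c + edgeRatio k t d e * x d := by
    intro e he x
    rw [crossBase, hsum]
    simp [ha, hb, hc, hd, he]
  have hratio : ∀ x : Fin 4 → ℝ, crossRatio θ k t x =
      x a / max (x a) (crossBase θ k t a x) + x b / max (x b) (crossBase θ k t b x) := by
    intro x
    rw [crossRatio, hsum]
    simp [ha, hb, hc, hd]
  -- the intersection with the face opposite `b`
  have hKmem : ∀ x : IdealTet, x.1 b = 0 → x.1 a = w * crossBase θ k t a x.1 →
      tetLeaf θ k t x.1 = spineInterval θ s := by
    intro x hxb hxa
    rw [hmem, hratio, hxb, zero_div, add_zero]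
    have hP := crossBase_nonneg (θ := θ) (k := k) (t := t) x a
    have hmax := max_crossBase_pos (θ := θ) (k := k) (t := t) x a
    have hle : x.1 a ≤ crossBase θ k t a x.1 := by rw [hxa]; nlinarith
    rw [max_eq_right hle] at hmax ⊢
    rw [hxa, mul_div_cancel_right₀ _ hmax.ne']
  refine IdealTet.isPathConnected_of_segments
    (K := {x | x.1 b = 0 ∧ x.1 a = w * crossBase θ k t a x.1})
    (IdealTet.isPathConnected_of_convex ?_ ?_) (fun x hx => hKmem x hx.1 hx.2) fun x hx => ?_
  · obtain ⟨x, hx, -, hxa⟩ := exists_openEdge_ratio hac.symm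
      (mul_pos hw0 (edgeRatio_pos (k := k) (t := t) c a))
    refine ⟨x, hx b hbc hab.symm, ?_⟩
    rw [hcross a ha, hx d hcd.symm had.symm, hxa]; ring
  · rintro x ⟨hx, hx'⟩ y ⟨hy, hy'⟩ z ⟨u, v, -, -, -, hz⟩
    constructor
    · rw [← hz]
      simp only [Pi.add_apply, Pi.smul_apply, smul_eq_mul]
      rw [hx, hy]; ring
    · rw [← hz, crossBase_combo]
      simp only [Pi.add_apply, Pi.smul_apply, smul_eq_mul]
      rw [hx', hy']; ring
  · have hW := hmem.1 hx
    have hlt : ∀ e, quadSide θ e = true → x.1 e < crossBase θ k t e x.1 := by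
      intro e he
      by_contra! hle
      have hmax := max_crossBase_pos (θ := θ) (k := k) (t := t) x e
      rw [max_eq_left hle] at hmax
      have := one_le_crossRatio he hmax hle
      linarith
    have hPa := (x.nonneg a).trans_lt (hlt a ha)
    have hPb := (x.nonneg b).trans_lt (hlt b hb)
    rw [hratio, max_eq_right (hlt a ha).le, max_eq_right (hlt b hb).le] at hW
    set A := crossBase θ k t a x.1 with hA
    have hwA : 0 < w * A := mul_pos hw0 hPa
    have hD : 0 < x.1 c + x.1 d + w * A := by linarith [x.nonneg c, x.nonneg d]
    -- keep the ratio of the coordinates of `c` and `d`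
    set r := 1 / (x.1 c + x.1 d + w * A) with hr
    have hr0 : 0 < r := by positivity
    have hrD : r * (x.1 c + x.1 d + w * A) = 1 := by rw [hr]; field_simp
    have hcd' : 0 < x.1 c ∨ 0 < x.1 d := by
      by_contra! h
      have hc0 := le_antisymm h.1 (x.nonneg c)
      have hd0 := le_antisymm h.2 (x.nonneg d)
      rw [hA, hcross a ha, hc0, hd0] at hPa
      simp at hPa
    let f : Fin 4 → ℝ := fun e => if e = a then r * (w * A) else if e = b then 0 else r * x.1 e
    have fa : f a = r * (w * A) := by simp [f]
    have fb : f b = 0 := by simp [f, hab.symm]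
    have fc : f c = r * x.1 c := by simp [f, hac.symm, hbc.symm]
    have fd : f d = r * x.1 d := by simp [f, had.symm, hbd.symm]
    have hfsum : ∑ e, f e = 1 := by
      rw [hsum, fa, fb, fc, fd]; linarith
    have hf0 : ∀ e, 0 ≤ f e := by
      intro e
      have := x.nonneg e
      simp only [f]; split_ifs <;> positivity
    have hf1 : ∀ e, f e ≠ 1 := by
      intro e he
      have hfa : 0 < f a := by rw [fa]; positivity
      have hrest : ∀ e', e' ≠ e → f e' = 0 := by
        intro e' hne
        have h2 := Finset.add_le_sum (fun i _ => hf0 i) (Finset.mem_univ e) (Finset.mem_univ e')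
          hne.symm
        rw [hfsum, he] at h2
        exact le_antisymm (by linarith) (hf0 e')
      have hea : e = a := by
        by_contra hne
        exact hfa.ne' (hrest a (Ne.symm hne))
      subst hea
      rcases hcd' with h | h
      · have := hrest c hac.symm
        rw [fc] at this
        exact (mul_pos hr0 h).ne' this
      · have := hrest d had.symm
        rw [fd] at this
        exact (mul_pos hr0 h).ne' this
    have hcf : ∀ e, quadSide θ e = true → crossBase θ k t e f = r * crossBase θ k t e x.1 := by
      intro e he
      rw [hcross e he, hcross e he, fc, fd]; ring
    refine ⟨⟨f, ⟨hf0, hfsum⟩, hf1⟩, ⟨fb, ?_⟩, ?_⟩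
    · show f a = w * crossBase θ k t a f
      rw [fa, hcf a ha]; ring
    · rintro z ⟨u, v, hu, hv, huv, hz⟩
      refine hmem.2 ?_
      have hm : 0 < u + v * r := by
        rcases hu.eq_or_lt with h | h
        · rw [← h] at huv ⊢; rw [zero_add] at huv; rw [huv]; linarith
        · have := mul_nonneg hv hr0.le; linarith
      have hza : z.1 a = u * x.1 a + v * (r * (w * A)) := by
        rw [← hz]; simp [fa]
      have hzb : z.1 b = u * x.1 b := by
        rw [← hz]; simp [fb]
      have hzP : ∀ e, quadSide θ e = true →
          crossBase θ k t e z.1 = (u + v * r) * crossBase θ k t e x.1 := by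
        intro e he
        rw [← hz, crossBase_combo, hcf e he]; ring
      have hla : z.1 a ≤ (u + v * r) * A := by
        have h2 := mul_le_mul_of_nonneg_left (hlt a ha).le hu
        have h3 : v * (r * (w * A)) ≤ v * (r * A) := by
          refine mul_le_mul_of_nonneg_left (mul_le_mul_of_nonneg_left ?_ hr0.le) hv
          nlinarith
        rw [hza]
        linarith
      have hlb : z.1 b ≤ (u + v * r) * crossBase θ k t b x.1 := by
        have h2 := mul_le_mul_of_nonneg_left (hlt b hb).le hu
        have h3 := mul_nonneg (mul_nonneg hv hr0.le) hPb.le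
        rw [hzb]
        linarith
      rw [hratio, hzP a ha, hzP b hb, max_eq_right hla, max_eq_right hlb, hza, hzb]
      have : (u * x.1 a + v * (r * (w * A))) / ((u + v * r) * A) +
          u * x.1 b / ((u + v * r) * crossBase θ k t b x.1) =
          (u * (x.1 a / A + x.1 b / crossBase θ k t b x.1) + v * r * w) / (u + v * r) := by
        field_simp
        ring
      rw [this, hW]
      field_simp

theorem IsLevel.isPathConnected_fibre (ht : IsLevel θ k t) (hk : 0 ≤ k) {f : Fin 4 → ℝ}
    (hf : f ∈ spine (Pi.single θ k)) :
    IsPathConnected ((fun x : IdealTet => tetLeaf θ k t x.1) ⁻¹' {f}) := by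
  have hint : ∀ s, |s| ≤ k / 2 →
      IsPathConnected ((fun x : IdealTet => tetLeaf θ k t x.1) ⁻¹' {spineInterval θ s}) := by
    intro s hs
    obtain ⟨h1, h2⟩ := abs_le.1 hs
    rcases h1.eq_or_lt with rfl | h1
    · exact ht.isPathConnected_left hk
    rcases h2.eq_or_lt with rfl | h2
    · exact ht.isPathConnected_right hk
    · exact ht.isPathConnected_interior hk (by linarith) (by linarith)
  rcases mem_spine_cases hk hf with ⟨a, h, hh, rfl⟩ | ⟨s, hs, rfl⟩
  · rcases hh.eq_or_lt with rfl | hh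
    · rw [spineRay_single_zero]
      refine hint _ ?_
      split_ifs
      · rw [abs_neg, abs_of_nonneg (by linarith)]
      · rw [abs_of_nonneg (by linarith)]
    · exact ht.isPathConnected_ray hk a hh
  · exact hint s hs

end Fibres

/-! ### The foliation and its tree -/

/-- The leaf maps `tetLeaf`, with the levels of the edges chosen by `exists_edgeShift`, form a
foliation: by `IsLevel.tetLeaf_face` their restrictions to the two sides of a face are given by the
same formula. -/
theorem exists_measuredFoliation {ι : Type*} [Finite ι] (T : IdealTriangulation ι)
    {N : ι → Fin 3 → ℝ} (hN : T.IsAdmissible N) : Nonempty (MeasuredFoliation T N) := by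
  obtain ⟨s, hs, hglue⟩ := exists_edgeShift T hN.matching
  choose θ k hk hNk using fun i => (hN.isSpineWeight i).exists_type
  have hlevel : ∀ i, IsLevel (θ i) (k i) (s i) := fun i a b hab => by
    rw [hs i a b hab, hNk i, single_quad hab]
  exact ⟨{
    leaf := fun i x => tetLeaf (θ i) (k i) (s i) x.1
    continuous_leaf := fun i => continuous_tetLeaf
    leaf_mem := fun i x => by rw [hNk i]; exact (hlevel i).tetLeaf_mem_spine (hk i) x
    leaf_face := fun i v x hx => by rw [hNk i]; exact (hlevel i).tetLeaf_mem_faceSpine (hk i) hx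
    leaf_edge := fun i a b hab => by rw [hNk i]; exact (hlevel i).tetLeaf_image_openEdge (hk i) hab
    leaf_edge_strict := fun i a b hab x hx y hy h => (hlevel i).tetLeaf_strict (hk i) hab hx hy h
    leaf_connected := fun i f hf => by
      rw [hNk i] at hf; exact (hlevel i).isPathConnected_fibre (hk i) hf
    leaf_glue := fun i v x hx w hw => by
      have hinj := (T.glue i v).injective
      have hx' : (x.relabel (T.glue i v)).1 (T.glue i v v) = 0 := by
        simpa [IdealTet.relabel] using hx
      have hval : ∀ e, (x.relabel (T.glue i v)).1 (T.glue i v e) = x.1 e := fun e => by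
        simp [IdealTet.relabel]
      have h1 := (hlevel i).tetLeaf_face (hk i) hx hw
      have h2 := (hlevel (T.adj i v)).tetLeaf_face (hk _) hx' (hinj.ne hw)
      rw [← hNk] at h1 h2
      rw [h1, h2, ← Equiv.sum_comp (T.glue i v)]
      have hleg : ∀ e, e ≠ v →
          faceLeg (fun a b => s (T.adj i v) a b - faceCentre (N (T.adj i v)) (T.glue i v v) b)
            (T.glue i v v) (T.glue i v e) (x.relabel (T.glue i v)).1 =
          faceLeg (fun a b => s i a b - faceCentre (N i) v b) v e x.1 := by
        intro e he
        rw [faceLeg, faceLeg, ← Equiv.sum_comp (T.glue i v), hval]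
        congr 3
        refine Finset.sum_congr rfl fun e' _ => ?_
        simp only [hinj.eq_iff, hval]
        by_cases h : e' = e ∨ e' = v
        · rw [if_pos h, if_pos h]
        · rw [if_neg h, if_neg h]
          push Not at h
          rw [hglue i v e' e h.1 h.2 he]
      refine Finset.sum_congr rfl fun e _ => ?_
      simp only [hinj.eq_iff]
      by_cases he : e = v
      · rw [if_pos he, if_pos he]
      · rw [if_neg he, if_neg he, hleg e he] }⟩

theorem theorem5p1 {ι : Type*} [Finite ι] (T : IdealTriangulation ι) [ConnectedSpace T.Manifold]
    (N : ι → Fin 3 → ℝ) (hN : T.IsAdmissible N)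
    {X : Type*} [TopologicalSpace X] [SimplyConnectedSpace X] (p : X → T.Manifold)
    (hp : IsCoveringMap p) (x₀ : X) :
    Nonempty (MeasuredFoliation T N) ∧
    ∃ deck : FundamentalGroup T.Manifold (p x₀) →* (X ≃ₜ X), IsDeckAction hp x₀ deck ∧
      ∀ F : MeasuredFoliation T N,
        IsRTree (F.Tree p) ∧
        ∃ ρ : FundamentalGroup T.Manifold (p x₀) →* (F.Tree p ≃ᵢ F.Tree p),
          ∀ g x, ρ g (F.toTree p x) = F.toTree p (deck g x) := by
  refine ⟨exists_measuredFoliation T hN, ?_⟩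
  have := hp.isLocalHomeomorph.locallyPathConnectedSpace
  obtain ⟨deck, hdeck⟩ := hp.exists_isDeckAction x₀
  exact ⟨deck, hdeck, fun F =>
    ⟨F.isRTree_tree hN hp, F.exists_isometric_action deck fun g x => (hdeck g).1 x⟩⟩
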